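/- Let $\mathcal G$ be the sheaf of groups on a smooth manifold $X$ associated with the presheaf $U\mapsto C^\infty(U,U(1))/\{\text{constant maps } U\to U(1)\}$, regarded as an étalé space. A presentation of a $U(1)_{U(1)}$-bundle on $X$ consists of an open covering $(U_\alpha)$ and continuous sections $\bar g_{\alpha\beta}$ of $\mathcal G$ over $U_\alpha\cap U_\beta$ with $\bar g_{\alpha\beta}\bar g_{\beta\gamma}=\bar g_{\alpha\gamma}$. The $U(1)_{U(1)}$-bundle itself (a principal $\mathcal G$-sheaf bundle) is given by $\mathcal F_\alpha=\mathcal G|_{U_\alpha}$, on which $\mathcal G$ acts by left translation, and the $\mathcal G$-sheaf isomorphisms (continuous stalkwise bijections commuting with left translations) $T_{\alpha\beta}:\mathcal F_\beta\to\mathcal F_\alpha$, $f\mapsto f\bar g_{\alpha\beta}$, over $U_\alpha\cap U_\beta$. Two bundles $(T_{\alpha\beta})$, $(T'_{\alpha\beta})$ are equivalent if, on some common refinement of the coverings, there are $\mathcal G$-sheaf isomorphisms $T_\alpha:\mathcal F_\alpha\to\mathcal F'_\alpha$ with $T_{\alpha\beta}=T_\alpha^{-1}T'_{\alpha\beta}T_\beta$.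 A connection on a presentation is a family of smooth $i\mathbb R$-valued $1$-forms $A_\alpha$ on $U_\alpha$ with $A_\alpha=A_\beta+\bar g_{\alpha\beta}\,d\bar g_{\alpha\beta}^{-1}$ on $U_\alpha\cap U_\beta$ (computed with any local representative of $\bar g_{\alpha\beta}$); its curvature is $F=dA_\alpha$ on $U_\alpha$, and the first Chern class of the bundle is the de Rham class of $\frac{i}{2\pi}F$ for any connection on any presentation of a bundle equivalent to it. Two connections $(\bar g_{\alpha\beta},A_\alpha)$, $(\bar g'_{\alpha\beta},A'_\alpha)$ are equivalent if, on some common refinement, there are sections $\bar g_\alpha$ of $\mathcal G$ with $\bar g'_{\alpha\beta}=\bar g_\alpha^{-1}\bar g_{\alpha\beta}\bar g_\beta$ and $A'_\alpha=A_\alpha+\bar g_\alpha^{-1}d\bar g_\alpha$. A connection is spherically symmetric if it is equivalent to its pullback under every rotation in $SO(3)$. Let $X$ be the unit sphere $S^2\subset\mathbb R^3$, or $\tilde{\mathbb R}^4=\{(x^0,x^1,x^2,x^3): (x^1)^2+(x^2)^2+(x^3)^2>0\}$ (with rotations acting on $(x^1,x^2,x^3)$), and let $(\theta,\phi)$ be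 the colatitude and azimuth of the point, respectively of $(x^1,x^2,x^3)$. Let $0\le a<b\le\pi$, $U_1=\{\theta<b\}$, $U_2=\{\theta>a\}$. For $\nu\in\mathbb R$ let $\mathcal D_\nu$ be the $U(1)_{U(1)}$-bundle over $X$ presented by the covering $\{U_1,U_2\}$ and the section $\bar g_{12}$ over $U_1\cap U_2$ defined locally by $[e^{-i\nu\phi}]$ (with $\bar g_{21}=\bar g_{12}^{-1}$, $\bar g_{11}=\bar g_{22}=1$). Let $dS$ denote the area form of the unit sphere, respectively its pullback to $\tilde{\mathbb R}^4$ along $x\mapsto(x^1,x^2,x^3)/|(x^1,x^2,x^3)|$. Then, for each of the two spaces $X$: 1. For every real $\nu$, the forms $A_\alpha=\tfrac12 i\nu\left[(-1)^{\alpha+1}-\cos\theta\right]d\phi$ on $U_\alpha$, $\alpha=1,2$ (extended by $0$ to the part of the polar axis in $U_\alpha$), constitute a smooth connection on $\mathcal D_\nu$, and this connection is spherically symmetric. 2. Its curvature is $F=\tfrac12 i\nu\,dS$, which equals $\tfrac12 i\nu\sin\theta\,d\theta\wedge d\phi$ off the polar axis. 3. The first Chern class of $\mathcal D_\nu$ is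 well defined and is represented by $\frac{i}{2\pi}F=-\frac{\nu}{4\pi}\,dS$, i.e. by $-\nu$ times the area form normalised to total area $1$ on $S^2$. 4. If $\nu\ne\nu'$, then $\mathcal D_\nu$ and $\mathcal D_{\nu'}$ are not equivalent. -/

import Mathlib

open TopologicalSpace Manifold CategoryTheory Opposite
open scoped ContDiff Topology

namespace DiracSheaf

noncomputable section

/-! ## The sheaf of smooth `U(1)`-valued functions modulo constants

`X` is a smooth manifold modelled on `ℝⁿ`. -/

section Sheaf

variable (n : ℕ) (X : Type) [TopologicalSpace X] [ChartedSpace (EuclideanSpace ℝ (Fin n)) X]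

/-- The constant maps `U → U(1)`, as a subgroup of the group `Γ(U, U(1))` of smooth maps. -/
def constSections (U : Opens X) : Subgroup C^∞⟮𝓡 n, U; 𝓡 1, Circle⟯ where
  carrier := {f | ∃ c : Circle, ∀ x, f x = c}
  mul_mem' := by
    rintro f g ⟨c, hc⟩ ⟨d, hd⟩
    exact ⟨c * d, fun x => by rw [ContMDiffMap.coe_mul, Pi.mul_apply, hc, hd]⟩
  one_mem' := ⟨1, fun x => rfl⟩
  inv_mem' := by
    rintro f ⟨c, hc⟩
    exact ⟨c⁻¹, fun x => by rw [← hc x]; rfl⟩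

/-- Restriction `Γ(U, U(1)) / const → Γ(V, U(1)) / const` for `V ⊆ U`. -/
def resHom {U V : Opens X} (h : V ≤ U) :
    (C^∞⟮𝓡 n, U; 𝓡 1, Circle⟯ ⧸ constSections n X U) →*
      (C^∞⟮𝓡 n, V; 𝓡 1, Circle⟯ ⧸ constSections n X V) :=
  QuotientGroup.map _ _ (ContMDiffMap.restrictMonoidHom (𝓡 n) (𝓡 1) Circle h) (by
    rintro f ⟨c, hc⟩
    exact ⟨c, fun x => hc _⟩)

instance : Limits.HasColimits CommGrpCat.{0} :=
  Adjunction.has_colimits_of_equivalence commGroupAddCommGroupEquivalence.functor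

/-- The presheaf `U ↦ Γ(U, U(1)) / Γ_c(U, U(1))` of smooth `U(1)`-valued functions modulo constant
functions. -/
def phasePresheaf : TopCat.Presheaf CommGrpCat (TopCat.of X) where
  obj U := CommGrpCat.of (C^∞⟮𝓡 n, (unop U : Opens X); 𝓡 1, Circle⟯ ⧸ constSections n X (unop U))
  map i := CommGrpCat.ofHom (resHom n X i.unop.le)
  map_id U := by
    ext f
    rfl
  map_comp i j := by
    ext f
    rfl

/-- The stalk at `x` of (the sheaf associated with) `phasePresheaf`. -/
abbrev Stalk (x : X) : Type := ((phasePresheaf n X).stalk x : CommGrpCat)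

/-- The sheaf `𝒢` associated with `phasePresheaf`, as an espace étalé. -/
abbrev Etale : Type := (phasePresheaf n X).EtaleSpace

variable {X}

/-- The class modulo constants of a smooth map `V → U(1)`. -/
def classOf {V : Opens X} (f : C^∞⟮𝓡 n, V; 𝓡 1, Circle⟯) : (phasePresheaf n X).obj (op V) :=
  (QuotientGroup.mk f : _ ⧸ constSections n X V)

/-- The germ at `x ∈ V` of the class modulo constants of a smooth map `V → U(1)`. -/
def germOf {V : Opens X} (f : C^∞⟮𝓡 n, V; 𝓡 1, Circle⟯) (x : X) (hx : x ∈ V) : Stalk n X x :=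
  (phasePresheaf n X).germ V x hx (classOf n f)

/-- `σ` is a continuous section of the étalé space over the open set `U`. (Only the values `σ x`
with `x ∈ U` are relevant.) -/
def IsSectionOn (U : Opens X) (σ : ∀ x, Stalk n X x) : Prop :=
  ContinuousOn (fun x => (⟨x, σ x⟩ : Etale n X)) U

/-- A family of germs is a continuous section iff it is locally the family of germs of a section of
the presheaf. -/
theorem isSectionOn_iff {U : Opens X} {σ : ∀ x, Stalk n X x} :
    IsSectionOn n U σ ↔ ∀ x ∈ U, ∃ (V : Opens X) (s : (phasePresheaf n X).obj (op V)),
      x ∈ V ∧ ∀ᶠ y in 𝓝 x, ∃ hy : y ∈ V, σ y = (phasePresheaf n X).germ V y hy s := by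
  constructor
  · intro h x hx
    have h1 := h x hx
    rw [ContinuousWithinAt, U.isOpen.nhdsWithin_eq hx] at h1
    obtain ⟨V, hxV, s, hs⟩ := TopCat.Presheaf.EtaleSpace.exists_section_of_tendsto h1
    exact ⟨V, s, hxV, hs⟩
  · intro h x hx
    obtain ⟨V, s, hxV, hs⟩ := h x hx
    rw [ContinuousWithinAt, U.isOpen.nhdsWithin_eq hx]
    refine TopologicalSpace.tendsto_nhds_generateFrom_iff.2 ?_
    rintro S ⟨V', s', rfl⟩ ⟨hxV', hS⟩
    obtain ⟨_, hx'⟩ := hs.self_of_nhds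
    have he : (phasePresheaf n X).germ V x hxV s = (phasePresheaf n X).germ V' x hxV' s' :=
      hx'.symm.trans hS
    obtain ⟨W, hxW, i, i', hW⟩ := TopCat.Presheaf.germ_eq _ _ _ _ _ _ he
    filter_upwards [hs, W.isOpen.mem_nhds hxW] with y hy hyW
    obtain ⟨hyV, hy⟩ := hy
    refine ⟨i'.le hyW, ?_⟩
    change σ y = (phasePresheaf n X).germ V' y (i'.le hyW) s'
    rw [hy, ← TopCat.Presheaf.germ_res_apply _ i y hyW, hW, TopCat.Presheaf.germ_res_apply]

theorem germ_inf_mul {V V' : Opens X} (s : (phasePresheaf n X).obj (op V))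
    (s' : (phasePresheaf n X).obj (op V')) (y : X) (hy : y ∈ V ⊓ V') :
    (phasePresheaf n X).germ (V ⊓ V') y hy
        ((phasePresheaf n X).map (homOfLE inf_le_left).op s *
          (phasePresheaf n X).map (homOfLE inf_le_right).op s') =
      (phasePresheaf n X).germ V y hy.1 s * (phasePresheaf n X).germ V' y hy.2 s' := by
  rw [map_mul, TopCat.Presheaf.germ_res_apply, TopCat.Presheaf.germ_res_apply]

theorem isSectionOn_one {U : Opens X} : IsSectionOn n U (fun _ => 1) :=
  (isSectionOn_iff n).2 fun x _ => ⟨⊤, 1, trivial, .of_forall fun y => ⟨trivial, by rw [map_one]⟩⟩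

theorem isSectionOn_inv {U : Opens X} {σ : ∀ x, Stalk n X x} (h : IsSectionOn n U σ) :
    IsSectionOn n U (fun x => (σ x)⁻¹) := by
  refine (isSectionOn_iff n).2 fun x hx => ?_
  obtain ⟨V, s, hxV, hs⟩ := (isSectionOn_iff n).1 h x hx
  refine ⟨V, s⁻¹, hxV, ?_⟩
  filter_upwards [hs] with y hy
  obtain ⟨hyV, hy⟩ := hy
  exact ⟨hyV, by rw [hy, map_inv]⟩

/-- Two maps that differ by a constant near `y` define the same germ at `y`. -/
theorem germOf_eq {V V' : Opens X} (f : C^∞⟮𝓡 n, V; 𝓡 1, Circle⟯)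
    (f' : C^∞⟮𝓡 n, V'; 𝓡 1, Circle⟯) (y : X) (hy : y ∈ V) (hy' : y ∈ V') (c : Circle)
    (h : ∀ᶠ z in 𝓝 y, ∀ (hz : z ∈ V) (hz' : z ∈ V'), f ⟨z, hz⟩ = f' ⟨z, hz'⟩ * c) :
    germOf n f y hy = germOf n f' y hy' := by
  obtain ⟨W₀, hW₀, hW₀o, hyW₀⟩ := eventually_nhds_iff.1 h
  let W : Opens X := ⟨W₀, hW₀o⟩ ⊓ V ⊓ V'
  have hWV : W ≤ V := fun z hz => hz.1.2
  have hWV' : W ≤ V' := fun z hz => hz.2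
  refine TopCat.Presheaf.germ_ext (phasePresheaf n X) W ⟨⟨hyW₀, hy⟩, hy'⟩ (homOfLE hWV)
    (homOfLE hWV') ?_
  refine QuotientGroup.eq.2 ⟨c⁻¹, fun z => ?_⟩
  change (f ⟨z, hWV z.2⟩)⁻¹ * f' ⟨z, hWV' z.2⟩ = c⁻¹
  rw [hW₀ z z.2.1.1 (hWV z.2) (hWV' z.2)]
  simp

/-- `T` is an isomorphism `𝒢|_U → 𝒢|_U` of `𝒢`-sheaves, where `𝒢` acts on itself by left
translation: a continuous, stalkwise bijective map over `U` that commutes with left translations.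
(Only the values `T x` with `x ∈ U` are relevant.) -/
structure IsSheafIsoOn (U : Opens X) (T : ∀ x, Stalk n X x → Stalk n X x) : Prop where
  bijective : ∀ x ∈ U, Function.Bijective (T x)
  equivariant : ∀ x ∈ U, ∀ g f : Stalk n X x, T x (g * f) = g * T x f
  continuous : ContinuousOn (fun e : Etale n X => (⟨e.base, T e.base e.germ⟩ : Etale n X))
    {e | e.base ∈ U}

end Sheaf

/-! ## `U(1)_{U(1)}`-bundles, presentations, equivalence -/

section Bundles

variable (n : ℕ) (X : Type) [TopologicalSpace X] [ChartedSpace (EuclideanSpace ℝ (Fin n)) X]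

/-- A `U(1)_{U(1)}`-bundle, that is, a principal `𝒢`-sheaf bundle with `𝓕_i = 𝒢|_{U_i}`: an open
covering `(U_i)` of `X` and `𝒢`-sheaf isomorphisms `T_ij : 𝓕_j → 𝓕_i` over `U_i ∩ U_j` with
`T_ij T_jk = T_ik`. -/
structure SheafBundle where
  ι : Type
  cover : ι → Opens X
  covers : ∀ x, ∃ i, x ∈ cover i
  T : ι → ι → ∀ x, Stalk n X x → Stalk n X x
  isIso : ∀ i j, IsSheafIsoOn n (cover i ⊓ cover j) (T i j)
  cocycle : ∀ i j k, ∀ x ∈ cover i ⊓ cover j ⊓ cover k, ∀ f, T i j x (T j k x f) = T i k x f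

/-- A presentation of a `U(1)_{U(1)}`-bundle: an open covering `(U_i)` and sections `g_ij` of `𝒢`
over `U_i ∩ U_j` with `g_ij g_jk = g_ik`. -/
structure Presentation where
  ι : Type
  cover : ι → Opens X
  covers : ∀ x, ∃ i, x ∈ cover i
  g : ι → ι → ∀ x, Stalk n X x
  isSection : ∀ i j, IsSectionOn n (cover i ⊓ cover j) (g i j)
  cocycle : ∀ i j k, ∀ x ∈ cover i ⊓ cover j ⊓ cover k, g i j x * g j k x = g i k x

/-- A common refinement of two families of open subsets of `X`. -/
structure CommonRefinement {X : Type} [TopologicalSpace X] {ι ι' : Type}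
    (U : ι → Opens X) (U' : ι' → Opens X) where
  κ : Type
  W : κ → Opens X
  covers : ∀ x, ∃ k, x ∈ W k
  left : κ → ι
  right : κ → ι'
  le_left : ∀ k, W k ≤ U (left k)
  le_right : ∀ k, W k ≤ U' (right k)

variable {n X}

/-- Equivalence of sheaf bundles: on some common refinement `(W_k)` there are `𝒢`-sheaf isomorphisms
`S_k : 𝓕_k → 𝓕'_k` with `T_kl = S_k⁻¹ T'_kl S_l`. -/
def SheafBundle.Equivalent (B B' : SheafBundle n X) : Prop :=
  ∃ (r : CommonRefinement B.cover B'.cover) (S : r.κ → ∀ x, Stalk n X x → Stalk n X x),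
    (∀ k, IsSheafIsoOn n (r.W k) (S k)) ∧
    ∀ k l, ∀ x ∈ r.W k ⊓ r.W l, ∀ f,
      S k x (B.T (r.left k) (r.left l) x f) = B'.T (r.right k) (r.right l) x (S l x f)

/-- Multiplication by a section of `𝒢` is a `𝒢`-sheaf isomorphism. -/
theorem isSheafIsoOn_mul {U : Opens X} {σ : ∀ x, Stalk n X x} (hσ : IsSectionOn n U σ) :
    IsSheafIsoOn n U (fun x f => f * σ x) where
  bijective x _ := (Equiv.mulRight (σ x)).bijective
  equivariant x _ g f := mul_assoc g f (σ x)
  continuous := by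
    rintro ⟨x, t⟩ hx
    obtain ⟨V, s, hxV, hs⟩ := (isSectionOn_iff n).1 hσ x hx
    obtain ⟨V', hxV', s', hs'⟩ := TopCat.Presheaf.exists_germ_eq _ t
    have hT := TopCat.Presheaf.EtaleSpace.eventually_nhds (⟨x, t⟩ : Etale n X) hxV' _ hs'
    have hb := (TopCat.Presheaf.EtaleSpace.continuous_base (phasePresheaf n X)).tendsto
      (⟨x, t⟩ : Etale n X)
    refine ContinuousAt.continuousWithinAt ?_
    refine TopologicalSpace.tendsto_nhds_generateFrom_iff.2 ?_
    rintro S ⟨VS, sS, rfl⟩ ⟨hxS, hS⟩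
    obtain ⟨_, hx'⟩ := hs.self_of_nhds
    have hS' : t * σ x = (phasePresheaf n X).germ VS x hxS sS := hS
    rw [← hs', hx'] at hS'
    have he := (germ_inf_mul n s' s x ⟨hxV', hxV⟩).trans hS'
    obtain ⟨W, hxW, i, i', hW⟩ := TopCat.Presheaf.germ_eq _ _ _ _ _ _ he
    filter_upwards [hT, hb.eventually hs, hb.eventually (W.isOpen.mem_nhds hxW)] with e h1 h2 h3
    obtain ⟨h1', h1⟩ := h1
    obtain ⟨h2', h2⟩ := h2
    refine ⟨i'.le h3, ?_⟩
    change e.germ * σ e.base = (phasePresheaf n X).germ VS e.base (i'.le h3) sS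
    rw [h1, h2, ← germ_inf_mul n s' s e.base ⟨h1', h2'⟩,
      ← TopCat.Presheaf.germ_res_apply _ i _ h3, hW, TopCat.Presheaf.germ_res_apply]

/-- The sheaf bundle determined by a presentation: `T_ij f = f g_ij`. -/
def Presentation.toBundle (P : Presentation n X) : SheafBundle n X where
  ι := P.ι
  cover := P.cover
  covers := P.covers
  T i j x f := f * P.g i j x
  isIso i j := isSheafIsoOn_mul (P.isSection i j)
  cocycle i j k x hx f := by
    rw [mul_assoc, mul_comm (P.g j k x), P.cocycle i j k x hx]

end Bundles

/-! ## Pullback along smooth maps -/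

section Pullback

variable {n m : ℕ} {X Y : Type} [TopologicalSpace X] [ChartedSpace (EuclideanSpace ℝ (Fin n)) X]
  [TopologicalSpace Y] [ChartedSpace (EuclideanSpace ℝ (Fin m)) Y]

/-- The inverse image of an open set. -/
def preOpen {f : X → Y} (hf : ContMDiff (𝓡 n) (𝓡 m) ∞ f) (U : Opens Y) : Opens X :=
  ⟨f ⁻¹' U, U.isOpen.preimage hf.continuous⟩

/-- Composition with `f`, as a map `Γ(U, U(1)) → Γ(f⁻¹ U, U(1))`. -/
def compSection {f : X → Y} (hf : ContMDiff (𝓡 n) (𝓡 m) ∞ f) (U : Opens Y) :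
    C^∞⟮𝓡 m, U; 𝓡 1, Circle⟯ →* C^∞⟮𝓡 n, preOpen hf U; 𝓡 1, Circle⟯ where
  toFun g := ⟨fun x => g ⟨f x, x.2⟩, g.contMDiff.comp
    ((ContMDiff.subtypeVal_comp_iff U _).1 (hf.comp contMDiff_subtype_val))⟩
  map_one' := rfl
  map_mul' _ _ := rfl

/-- `f` as a morphism of topological spaces. -/
def topHom {f : X → Y} (hf : ContMDiff (𝓡 n) (𝓡 m) ∞ f) : TopCat.of X ⟶ TopCat.of Y :=
  TopCat.ofHom ⟨f, hf.continuous⟩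

/-- Composition with `f`, as a morphism of presheaves over `Y`. -/
def pullPresheaf {f : X → Y} (hf : ContMDiff (𝓡 n) (𝓡 m) ∞ f) :
    phasePresheaf m Y ⟶ (TopCat.Presheaf.pushforward _ (topHom hf)).obj (phasePresheaf n X) where
  app U := CommGrpCat.ofHom (QuotientGroup.map (constSections m Y (unop U))
    (constSections n X (preOpen hf (unop U))) (compSection hf (unop U)) (by
      rintro g ⟨c, hc⟩
      exact ⟨c, fun x => hc _⟩))
  naturality U V i := by
    ext g
    induction g using QuotientGroup.induction_on with
    | H g => rfl

/-- Composition with `f` on germs: the homomorphism `𝒢_{f x} → 𝒢_x`. -/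
def pullStalk {f : X → Y} (hf : ContMDiff (𝓡 n) (𝓡 m) ∞ f) (x : X) :
    (phasePresheaf m Y).stalk (f x) ⟶ (phasePresheaf n X).stalk x :=
  (TopCat.Presheaf.stalkFunctor _ (f x)).map (pullPresheaf hf) ≫
    (phasePresheaf n X).stalkPushforward _ (topHom hf) x

theorem pullStalk_germ {f : X → Y} (hf : ContMDiff (𝓡 n) (𝓡 m) ∞ f) (x : X) (V : Opens Y)
    (hx : f x ∈ V) (s : (phasePresheaf m Y).obj (op V)) :
    pullStalk hf x ((phasePresheaf m Y).germ V (f x) hx s) =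
      (phasePresheaf n X).germ (preOpen hf V) x hx ((pullPresheaf hf).app (op V) s) := by
  have h1 := TopCat.Presheaf.stalkFunctor_map_germ_apply V (f x) hx (pullPresheaf hf) s
  have h2 := TopCat.Presheaf.stalkPushforward_germ_apply _ (topHom hf) (phasePresheaf n X) V x hx
    ((pullPresheaf hf).app (op V) s)
  exact (congrArg ((phasePresheaf n X).stalkPushforward _ (topHom hf) x) h1).trans h2

/-- The pullback `f^* P`: the covering `(f⁻¹ U_i)` with the transition sections `g_ij ∘ f`. -/
def Presentation.pullback {f : X → Y} (P : Presentation m Y) (hf : ContMDiff (𝓡 n) (𝓡 m) ∞ f) :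
    Presentation n X where
  ι := P.ι
  cover i := preOpen hf (P.cover i)
  covers x := P.covers (f x)
  g i j x := pullStalk hf x (P.g i j (f x))
  isSection i j := by
    refine (isSectionOn_iff n).2 fun x hx => ?_
    obtain ⟨V, s, hxV, hs⟩ := (isSectionOn_iff m).1 (P.isSection i j) (f x) hx
    refine ⟨preOpen hf V, (pullPresheaf hf).app (op V) s, hxV, ?_⟩
    filter_upwards [hf.continuous.continuousAt.eventually hs] with y hy
    obtain ⟨hyV, hy⟩ := hy
    exact ⟨hyV, by rw [hy, pullStalk_germ]⟩
  cocycle i j k x hx := by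
    rw [← map_mul, P.cocycle i j k (f x) hx]

end Pullback

/-! ## Differential forms -/

section Forms

variable (n : ℕ) (X : Type) [TopologicalSpace X] [ChartedSpace (EuclideanSpace ℝ (Fin n)) X]

/-- Complex-valued differential `k`-forms on `X` (not necessarily continuous). -/
abbrev DiffForm (k : ℕ) : Type := ∀ x : X, TangentSpace (𝓡 n) x [⋀^Fin k]→L[ℝ] ℂ

variable {X}

/-- A family of linear forms on the tangent spaces, as a `1`-form. -/
def oneForm (a : ∀ x : X, TangentSpace (𝓡 n) x →L[ℝ] ℂ) : DiffForm n X 1 :=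
  fun x => ContinuousAlternatingMap.ofSubsingleton ℝ _ _ (0 : Fin 1) (a x)

variable {k : ℕ}

/-- The expression of `ξ` in the chart of `X` around `x₀`. -/
def chartRep (ξ : DiffForm n X k) (x₀ : X) :
    EuclideanSpace ℝ (Fin n) → EuclideanSpace ℝ (Fin n) [⋀^Fin k]→L[ℝ] ℂ :=
  fun y => (ξ ((extChartAt (𝓡 n) x₀).symm y)).compContinuousLinearMap
    (mfderiv 𝓘(ℝ, EuclideanSpace ℝ (Fin n)) (𝓡 n) (extChartAt (𝓡 n) x₀).symm y)

/-- `ξ` is smooth on the open set `U`: so are its expressions in charts. -/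
def SmoothOn (ξ : DiffForm n X k) (U : Opens X) : Prop :=
  ∀ x₀ : X, ContDiffOn ℝ ∞ (chartRep n ξ x₀)
    ((extChartAt (𝓡 n) x₀).target ∩ (extChartAt (𝓡 n) x₀).symm ⁻¹' U)

/-- The exterior derivative, computed at `x` in the chart around `x`. -/
def extD (ξ : DiffForm n X k) : DiffForm n X (k + 1) :=
  fun x => (extDeriv (chartRep n ξ x) (extChartAt (𝓡 n) x x)).compContinuousLinearMap
    (mfderiv (𝓡 n) 𝓘(ℝ, EuclideanSpace ℝ (Fin n)) (extChartAt (𝓡 n) x) x)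

/-- `ξ` is a smooth closed form on `X`. -/
def IsClosedForm (ξ : DiffForm n X k) : Prop := SmoothOn n ξ ⊤ ∧ extD n ξ = 0

/-- `ξ` and `ξ'` differ by the derivative of a smooth form; for closed forms this means that they
have the same de Rham class. -/
def Cohomologous (ξ ξ' : DiffForm n X (k + 1)) : Prop :=
  ∃ η : DiffForm n X k, SmoothOn n η ⊤ ∧ ξ - ξ' = extD n η

/-- The pullback `f^* ξ` of a differential form along a map of manifolds. -/
def pullForm {m : ℕ} {Y : Type} [TopologicalSpace Y] [ChartedSpace (EuclideanSpace ℝ (Fin m)) Y]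
    (f : X → Y) (ξ : DiffForm m Y k) : DiffForm n X k :=
  fun x => (ξ (f x)).compContinuousLinearMap (mfderiv (𝓡 n) (𝓡 m) f x)

/-- The logarithmic derivative `g⁻¹ dg` at `x ∈ V` of a smooth map `g : V → U(1)`, evaluated at a
tangent vector `v`; `g` is differentiated as a complex-valued function. -/
def logDer {V : Opens X} (g : C^∞⟮𝓡 n, V; 𝓡 1, Circle⟯) (x : X) (hx : x ∈ V)
    (v : TangentSpace (𝓡 n) x) : ℂ :=
  (g ⟨x, hx⟩ : ℂ)⁻¹ *
    NormedSpace.fromTangentSpace _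
      (mfderiv (𝓡 n) 𝓘(ℝ, ℂ) (Function.extend Subtype.val (fun y : V => (g y : ℂ)) 0) x v)

end Forms

/-! ## Connections, curvature, first Chern class -/

section Connections

variable {n : ℕ} {X : Type} [TopologicalSpace X] [ChartedSpace (EuclideanSpace ℝ (Fin n)) X]

/-- The local `1`-forms `A_i` are the local potentials of a (smooth) connection on the
`U(1)_{U(1)}`-bundle presented by `P`: `A_i` is a smooth `𝔲(1) = iℝ`-valued form on `U_i`, and
`A_i = A_j + g_ij d(g_ij⁻¹)` on `U_i ∩ U_j`, where at every point `g_ij` may be replaced by any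
smooth `U(1)`-valued function representing its germ. -/
structure IsConnection (P : Presentation n X) (A : P.ι → DiffForm n X 1) : Prop where
  smooth : ∀ i, SmoothOn n (A i) (P.cover i)
  imaginary : ∀ i, ∀ x ∈ P.cover i, ∀ v, (A i x v).re = 0
  gauge : ∀ i j, ∀ x ∈ P.cover i ⊓ P.cover j,
    ∀ (V : Opens X) (g : C^∞⟮𝓡 n, V; 𝓡 1, Circle⟯) (hx : x ∈ V), germOf n g x hx = P.g i j x →
      ∀ v : TangentSpace (𝓡 n) x, A i x ![v] = A j x ![v] + logDer n g⁻¹ x hx v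

/-- The local curvature forms `F_i = dA_i + A_i ∧ A_i`; the last term vanishes since `U(1)` is
abelian. -/
def curvature {ι : Type} (A : ι → DiffForm n X 1) (i : ι) : DiffForm n X 2 := extD n (A i)

/-- Equivalence of connections: on some common refinement `(W_k)` there are sections `g_k` of `𝒢`
with `g'_kl = g_k⁻¹ g_kl g_l` and `A'_k = A_k + g_k⁻¹ dg_k`. -/
def ConnectionEquivalent (P : Presentation n X) (A : P.ι → DiffForm n X 1)
    (P' : Presentation n X) (A' : P'.ι → DiffForm n X 1) : Prop :=
  ∃ (r : CommonRefinement P.cover P'.cover) (s : r.κ → ∀ x, Stalk n X x),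
    (∀ k, IsSectionOn n (r.W k) (s k)) ∧
    (∀ k l, ∀ x ∈ r.W k ⊓ r.W l,
      P'.g (r.right k) (r.right l) x = (s k x)⁻¹ * P.g (r.left k) (r.left l) x * s l x) ∧
    ∀ k, ∀ x ∈ r.W k,
      ∀ (V : Opens X) (g : C^∞⟮𝓡 n, V; 𝓡 1, Circle⟯) (hx : x ∈ V), germOf n g x hx = s k x →
        ∀ v : TangentSpace (𝓡 n) x,
          A' (r.right k) x ![v] = A (r.left k) x ![v] + logDer n g x hx v

/-- The closed form `c` represents the first Chern class of `B`: `B` has a connection, and for every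
connection on every presentation of `B` the local forms `(i / 2π) F_i` fit together to a global
closed form in the de Rham class of `c`. -/
def RepresentsFirstChernClass (B : SheafBundle n X) (c : DiffForm n X 2) : Prop :=
  IsClosedForm n c ∧
  (∃ (P : Presentation n X) (A : P.ι → DiffForm n X 1),
    P.toBundle.Equivalent B ∧ IsConnection P A) ∧
  ∀ (P : Presentation n X) (A : P.ι → DiffForm n X 1),
    P.toBundle.Equivalent B → IsConnection P A →
      ∃ ξ : DiffForm n X 2, IsClosedForm n ξ ∧
        (∀ i, ∀ x ∈ P.cover i, ξ x = (Complex.I / (2 * Real.pi)) • curvature A i x) ∧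
        Cohomologous n ξ c

end Connections

/-! ## Spherical coordinates -/

section Spherical

/-- Euclidean three-space. -/
abbrev E3 : Type := EuclideanSpace ℝ (Fin 3)

/-- The colatitude `θ ∈ [0, π]` of a nonzero vector. -/
def colatitude (v : E3) : ℝ := Real.arccos (v 2 / ‖v‖)

/-- The horizontal part of a vector, as a complex number. -/
def horizontal (v : E3) : ℂ := v 0 + v 1 * Complex.I

/-- The azimuth of `w` measured from that of `v`, in `(-π, π]`. Up to an additive constant, this is
a smooth branch of the azimuth `φ` near `v` if `v` is not on the polar axis. (If `v` is on the
axis, it is the zero function.) -/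
def azimuthFrom (v w : E3) : ℝ :=
  Complex.arg (horizontal w / horizontal v)

/-- `dθ` at `v`. -/
def dTheta (v : E3) : E3 →L[ℝ] ℝ := fderiv ℝ colatitude v

/-- `dφ` at `v` (zero on the polar axis). -/
def dPhi (v : E3) : E3 →L[ℝ] ℝ := fderiv ℝ (azimuthFrom v) v

/-- `v` is not on the polar axis. -/
def OffAxis (v : E3) : Prop := v 0 ≠ 0 ∨ v 1 ≠ 0

theorem continuous_horizontal : Continuous horizontal := by
  unfold horizontal; fun_prop

theorem contDiff_horizontal : ContDiff ℝ ∞ horizontal := by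
  unfold horizontal
  have h : ∀ i : Fin 3, ContDiff ℝ ∞ fun v : E3 => (v i : ℂ) := fun i =>
    Complex.ofRealCLM.contDiff.comp (EuclideanSpace.proj (𝕜 := ℝ) i).contDiff
  exact (h 0).add ((h 1).mul contDiff_const)

theorem horizontal_ne_zero {v : E3} (h : OffAxis v) : horizontal v ≠ 0 := by
  intro h0
  have h1 := congrArg Complex.re h0
  have h2 := congrArg Complex.im h0
  simp [horizontal] at h1 h2
  rcases h with h | h <;> contradiction

theorem azimuthFrom_eq_zero {v : E3} (h : ¬ OffAxis v) (w : E3) : azimuthFrom v w = 0 := by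
  simp only [OffAxis, not_or, not_not] at h
  simp [azimuthFrom, horizontal, h.1, h.2]

theorem offAxis_of_colatitude {v : E3} (hv : v ≠ 0) (h0 : 0 < colatitude v)
    (h1 : colatitude v < Real.pi) : OffAxis v := by
  by_contra h
  simp only [OffAxis, not_or, not_not] at h
  have hn : ‖v‖ = |v 2| := by
    rw [EuclideanSpace.norm_eq, Fin.sum_univ_three, h.1, h.2]
    simp [Real.sqrt_sq_eq_abs]
  have h2 : v 2 ≠ 0 := fun h2 => hv (norm_eq_zero.1 (by rw [hn, h2, abs_zero]))
  rcases lt_or_gt_of_ne h2 with h3 | h3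
  · rw [colatitude, hn, abs_of_neg h3, div_neg, div_self h2, Real.arccos_neg_one] at h1
    exact lt_irrefl _ h1
  · rw [colatitude, hn, abs_of_pos h3, div_self h2, Real.arccos_one] at h0
    exact lt_irrefl _ h0

/-- The determinant, as an alternating form on `ℝ³`. -/
def volForm : E3 [⋀^Fin 3]→L[ℝ] ℝ :=
  { (Matrix.detRowAlternating (n := Fin 3) (R := ℝ)).compLinearMap
      (WithLp.linearEquiv 2 ℝ (Fin 3 → ℝ)).toLinearMap with
    cont := by
      change Continuous fun w : Fin 3 → E3 => Matrix.det (Matrix.of fun i j => w i j)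
      fun_prop }

theorem volForm_apply (w : Fin 3 → E3) : volForm w = Matrix.det (Matrix.of fun i j => w i j) := rfl

/-- The form `(v, w) ↦ det (p, v, w) / ‖p‖³` at the point `p`: the pullback along `p ↦ p / ‖p‖` of
the area form of the unit sphere. -/
def areaAt (p : E3) : E3 [⋀^Fin 2]→L[ℝ] ℂ :=
  Complex.ofRealCLM.compContinuousAlternatingMap ((‖p‖ ^ 3)⁻¹ • volForm.curryLeft p)

end Spherical

/-! ## The Dirac sheaf bundles -/

section Dirac

/-- A manifold with a nowhere vanishing smooth radius vector in `ℝ³`; its points have spherical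
coordinates `θ`, `φ`. -/
structure RadiusVector (n : ℕ) (X : Type) [TopologicalSpace X]
    [ChartedSpace (EuclideanSpace ℝ (Fin n)) X] where
  pos : X → E3
  smooth : ContMDiff (𝓡 n) 𝓘(ℝ, E3) ∞ pos
  ne_zero : ∀ x, pos x ≠ 0

variable {n : ℕ} {X : Type} [TopologicalSpace X] [ChartedSpace (EuclideanSpace ℝ (Fin n)) X]
  (p : RadiusVector n X)

theorem RadiusVector.continuous_colatitude : Continuous fun x => colatitude (p.pos x) := by
  have h := p.smooth.continuous
  refine Real.continuous_arccos.comp (Continuous.div (by fun_prop) h.norm fun x => ?_)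
  exact norm_ne_zero_iff.2 (p.ne_zero x)

/-- The covering by `{θ < b}` (index `0`) and `{a < θ}` (index `1`). -/
def diracCover (a b : ℝ) : Fin 2 → Opens X
  | 0 => ⟨{x | colatitude (p.pos x) < b}, isOpen_lt p.continuous_colatitude continuous_const⟩
  | 1 => ⟨{x | a < colatitude (p.pos x)}, isOpen_lt continuous_const p.continuous_colatitude⟩

/-- If `x` is not on the polar axis: the set where `azimuthFrom (pos x)` is a smooth function. -/
def azimuthDomain (x : X) : Opens X :=
  ⟨{y | OffAxis (p.pos x) → horizontal (p.pos y) / horizontal (p.pos x) ∈ Complex.slitPlane}, by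
    by_cases h : OffAxis (p.pos x)
    · simp only [h, true_imp_iff]
      exact Complex.isOpen_slitPlane.preimage
        ((continuous_horizontal.comp p.smooth.continuous).div_const _)
    · simp [h]⟩

theorem mem_azimuthDomain (x : X) : x ∈ azimuthDomain p x := fun h => by
  rw [div_self (horizontal_ne_zero h)]
  exact Complex.one_mem_slitPlane

/-- The function `e^{-iνφ}` near `x`, for the branch of `φ` that vanishes at `x`. -/
def localPhase (ν : ℝ) (x : X) : C^∞⟮𝓡 n, azimuthDomain p x; 𝓡 1, Circle⟯ :=
  ⟨fun y => Circle.exp (-(ν * azimuthFrom (p.pos x) (p.pos y))), by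
    refine contMDiff_circleExp.comp ?_
    by_cases h : OffAxis (p.pos x)
    · intro y
      have hy := y.2 h
      have h1 : ContDiffAt ℝ ∞ (fun w : E3 => -(ν * azimuthFrom (p.pos x) w)) (p.pos y) := by
        have h2 : ContDiff ℝ ∞ (fun w : E3 => horizontal w / horizontal (p.pos x)) :=
          contDiff_horizontal.div_const _
        have h3 : ContDiffAt ℝ ∞
            (fun w : E3 => Complex.log (horizontal w / horizontal (p.pos x))) (p.pos y) :=
          ContDiffAt.comp (g := Complex.log) (p.pos y)
            ((Complex.contDiffAt_log hy).restrict_scalars ℝ) h2.contDiffAt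
        have h4 : ContDiffAt ℝ ∞ (fun w : E3 => azimuthFrom (p.pos x) w) (p.pos y) := by
          have h5 := ContDiffAt.comp (p.pos y) Complex.imCLM.contDiff.contDiffAt h3
          refine h5.congr_of_eventuallyEq (.of_forall fun w => ?_)
          simp [azimuthFrom, Complex.log_im]
        exact (contDiffAt_const.mul h4).neg
      exact ContMDiffAt.comp (g := fun w : E3 => -(ν * azimuthFrom (p.pos x) w)) y h1.contMDiffAt
        ((p.smooth.comp contMDiff_subtype_val) y)
    · have : ∀ w, azimuthFrom (p.pos x) w = 0 := fun w => azimuthFrom_eq_zero h w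
      simp only [this]
      exact contMDiff_const⟩

/-- The germ at `x` of the class `[e^{-iνφ}]`; it does not depend on the branch of `φ`, since the
classes are modulo constants. -/
def phaseGerm (ν : ℝ) (x : X) : Stalk n X x :=
  germOf n (localPhase p ν x) x (mem_azimuthDomain p x)

theorem isSectionOn_phaseGerm (ν : ℝ) {U : Opens X} (hU : ∀ x ∈ U, OffAxis (p.pos x)) :
    IsSectionOn n U (phaseGerm p ν) := by
  refine (isSectionOn_iff n).2 fun x hx => ⟨azimuthDomain p x, classOf n (localPhase p ν x),
    mem_azimuthDomain p x, ?_⟩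
  filter_upwards [(azimuthDomain p x).isOpen.mem_nhds (mem_azimuthDomain p x),
    U.isOpen.mem_nhds hx] with y hy hyU
  refine ⟨hy, germOf_eq n _ _ _ _ _
    (Circle.exp (ν * azimuthFrom (p.pos x) (p.pos y))) ?_⟩
  have hx0 := horizontal_ne_zero (hU x hx)
  have hy0 := horizontal_ne_zero (hU y hyU)
  have hcont : ContinuousAt (fun z => azimuthFrom (p.pos y) (p.pos z)) y := by
    refine ContinuousAt.comp (g := Complex.arg) (Complex.continuousAt_arg ?_)
      ((continuous_horizontal.comp p.smooth.continuous).div_const _).continuousAt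
    exact mem_azimuthDomain p y (hU y hyU)
  have h0 : azimuthFrom (p.pos y) (p.pos y) = 0 := by
    rw [azimuthFrom, div_self hy0, Complex.arg_one]
  have h1 := Complex.neg_pi_lt_arg (horizontal (p.pos y) / horizontal (p.pos x))
  have h2 : Complex.arg (horizontal (p.pos y) / horizontal (p.pos x)) < Real.pi :=
    lt_of_le_of_ne (Complex.arg_le_pi _) (Complex.mem_slitPlane_iff_arg.1 (hy (hU x hx))).1
  have h3 := (hcont.add_const (azimuthFrom (p.pos x) (p.pos y))).eventually
    (Ioo_mem_nhds (a := -Real.pi) (b := Real.pi) 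
      (by beta_reduce; rw [h0, zero_add]; exact h1)
      (by beta_reduce; rw [h0, zero_add]; exact h2))
  filter_upwards [h3, U.isOpen.mem_nhds hyU] with z hz hzU hzy hzx
  have hz0 := horizontal_ne_zero (hU z hzU)
  have h4 : azimuthFrom (p.pos x) (p.pos z) =
      azimuthFrom (p.pos y) (p.pos z) + azimuthFrom (p.pos x) (p.pos y) := by
    have h5 : horizontal (p.pos z) / horizontal (p.pos x) =
        (horizontal (p.pos z) / horizontal (p.pos y)) *
          (horizontal (p.pos y) / horizontal (p.pos x)) := by
      field_simp
    rw [azimuthFrom, h5, Complex.arg_mul (div_ne_zero hz0 hy0) (div_ne_zero hy0 hx0) ⟨hz.1, hz.2.le⟩]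
    rfl
  change Circle.exp (-(ν * azimuthFrom (p.pos y) (p.pos z))) =
    Circle.exp (-(ν * azimuthFrom (p.pos x) (p.pos z))) * _
  rw [h4, ← Circle.exp_add]
  congr 1
  ring

/-- The transition sections of the Dirac sheaf bundle: `g_12 = [e^{-iνφ}]`, `g_21 = g_12⁻¹` and
`g_11 = g_22 = 1`, where `U_1`, `U_2` have the indices `0`, `1`. -/
def diracTransition (ν : ℝ) : Fin 2 → Fin 2 → ∀ x, Stalk n X x
  | 0, 0 => fun _ => 1
  | 0, 1 => phaseGerm p ν
  | 1, 0 => fun x => (phaseGerm p ν x)⁻¹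
  | 1, 1 => fun _ => 1

/-- The presentation of the Dirac sheaf bundle `𝓓_ν`, with the covering `{θ < b}`, `{a < θ}`. -/
def diracPresentation {a b : ℝ} (ha : 0 ≤ a) (hab : a < b) (hb : b ≤ Real.pi) (ν : ℝ) :
    Presentation n X where
  ι := Fin 2
  cover := diracCover p a b
  covers x := by
    rcases lt_or_ge (colatitude (p.pos x)) b with h | h
    · exact ⟨0, h⟩
    · exact ⟨1, hab.trans_le h⟩
  g := diracTransition p ν
  isSection i j := by
    have h01 : ∀ x ∈ diracCover p a b 0 ⊓ diracCover p a b 1, OffAxis (p.pos x) :=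
      fun x hx => offAxis_of_colatitude (p.ne_zero x) (ha.trans_lt hx.2) (hx.1.trans_le hb)
    fin_cases i <;> fin_cases j
    · exact isSectionOn_one n
    · exact isSectionOn_phaseGerm p ν h01
    · exact isSectionOn_inv n (isSectionOn_phaseGerm p ν fun x hx => h01 x hx.symm)
    · exact isSectionOn_one n
  cocycle i j k x _ := by
    fin_cases i <;> fin_cases j <;> fin_cases k <;> simp [diracTransition]

/-- The Dirac sheaf bundle `𝓓_ν`. -/
def diracBundle {a b : ℝ} (ha : 0 ≤ a) (hab : a < b) (hb : b ≤ Real.pi) (ν : ℝ) :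
    SheafBundle n X :=
  (diracPresentation p ha hab hb ν).toBundle

/-- The forms `A_1`, `A_2` (indices `0`, `1`) given by `½ iν (±1 - cos θ) dφ`. (On the part of the
polar axis that belongs to the respective open set, the smooth extension of this form vanishes, in
accordance with the convention for `dPhi`.) -/
def diracPotential (ν : ℝ) (i : Fin 2) : DiffForm n X 1 :=
  oneForm n fun x =>
    ((1 / 2 : ℂ) * Complex.I * ν * ((-1) ^ (i : ℕ) - Real.cos (colatitude (p.pos x)))) •
      (Complex.ofRealCLM ∘L dPhi (p.pos x) ∘L mfderiv (𝓡 n) 𝓘(ℝ, E3) p.pos x)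

/-- `dS`, the pullback of the area form of the unit sphere along the direction `pos / ‖pos‖`. -/
def areaForm : DiffForm n X 2 :=
  fun x => (areaAt (p.pos x)).compContinuousLinearMap (mfderiv (𝓡 n) 𝓘(ℝ, E3) p.pos x)

/-- `sin θ dθ ∧ dφ`, evaluated at two tangent vectors at a point off the polar axis. -/
def sinThetaDThetaDPhi (x : X) (v w : TangentSpace (𝓡 n) x) : ℝ :=
  let D := mfderiv (𝓡 n) 𝓘(ℝ, E3) p.pos x
  Real.sin (colatitude (p.pos x)) *
    (dTheta (p.pos x) (D v) * dPhi (p.pos x) (D w) - dTheta (p.pos x) (D w) * dPhi (p.pos x) (D v))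

end Dirac

/-! ## The two base spaces and their rotations -/

section Bases

/-- The unit sphere in `ℝ³`. -/
abbrev S2 : Type := Metric.sphere (0 : E3) 1

instance : Fact (Module.finrank ℝ E3 = 2 + 1) := ⟨by simp⟩

/-- The radius vector of a point of the unit sphere. -/
def sphereRadius : RadiusVector 2 S2 where
  pos := Subtype.val
  smooth := contMDiff_coe_sphere
  ne_zero x := ne_zero_of_mem_unit_sphere x

/-- The action of a linear isometry of `ℝ³` on the unit sphere. -/
def sphereRot (R : E3 ≃ₗᵢ[ℝ] E3) (x : S2) : S2 := ⟨R x, by simp⟩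

theorem contMDiff_sphereRot (R : E3 ≃ₗᵢ[ℝ] E3) : ContMDiff (𝓡 2) (𝓡 2) ∞ (sphereRot R) :=
  (R.contDiff.contMDiff.comp contMDiff_coe_sphere).codRestrict_sphere _

/-- The spatial part of `(x⁰, x¹, x², x³)`. -/
def spatial (x : EuclideanSpace ℝ (Fin 4)) : E3 := !₂[x 1, x 2, x 3]

theorem contDiff_spatial : ContDiff ℝ ∞ spatial := by
  refine contDiff_euclidean.2 fun i => ?_
  fin_cases i
  · exact (EuclideanSpace.proj (𝕜 := ℝ) (1 : Fin 4)).contDiff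
  · exact (EuclideanSpace.proj (𝕜 := ℝ) (2 : Fin 4)).contDiff
  · exact (EuclideanSpace.proj (𝕜 := ℝ) (3 : Fin 4)).contDiff

theorem norm_sq_E3 (v : E3) : ‖v‖ ^ 2 = v 0 ^ 2 + v 1 ^ 2 + v 2 ^ 2 := by
  rw [EuclideanSpace.norm_sq_eq, Fin.sum_univ_three]
  simp

/-- Minkowski space with the spatial origin removed. -/
def minkowskiOpen : Opens (EuclideanSpace ℝ (Fin 4)) :=
  ⟨{x | 0 < x 1 ^ 2 + x 2 ^ 2 + x 3 ^ 2}, isOpen_lt continuous_const (by fun_prop)⟩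

/-- Minkowski space with the spatial origin removed, as a manifold. -/
abbrev R4 : Type := minkowskiOpen

/-- The spatial radius vector. -/
def minkowskiRadius : RadiusVector 4 R4 where
  pos x := spatial x
  smooth := contDiff_spatial.contMDiff.comp contMDiff_subtype_val
  ne_zero x h := by
    have h1 : ‖spatial x‖ ^ 2 = x.1 1 ^ 2 + x.1 2 ^ 2 + x.1 3 ^ 2 := norm_sq_E3 (spatial x)
    have h2 : 0 < x.1 1 ^ 2 + x.1 2 ^ 2 + x.1 3 ^ 2 := x.2
    rw [← h1, h, norm_zero] at h2
    norm_num at h2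

/-- The action of a linear isometry of `ℝ³` on the spatial coordinates. -/
def minkowskiRot (R : E3 ≃ₗᵢ[ℝ] E3) (x : R4) : R4 :=
  ⟨!₂[x.1 0, R (spatial x) 0, R (spatial x) 1, R (spatial x) 2], by
    have h1 := norm_sq_E3 (R (spatial x))
    rw [R.norm_map, norm_sq_E3] at h1
    have h2 : 0 < x.1 1 ^ 2 + x.1 2 ^ 2 + x.1 3 ^ 2 := x.2
    change 0 < R (spatial x) 0 ^ 2 + R (spatial x) 1 ^ 2 + R (spatial x) 2 ^ 2
    rw [← h1]
    exact h2⟩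

theorem contMDiff_minkowskiRot (R : E3 ≃ₗᵢ[ℝ] E3) :
    ContMDiff (𝓡 4) (𝓡 4) ∞ (minkowskiRot R) := by
  refine (ContMDiff.subtypeVal_comp_iff minkowskiOpen _).1 ?_
  have h : ContDiff ℝ ∞ fun x : EuclideanSpace ℝ (Fin 4) =>
      (!₂[x 0, R (spatial x) 0, R (spatial x) 1, R (spatial x) 2] : EuclideanSpace ℝ (Fin 4)) := by
    have hR : ∀ i : Fin 3, ContDiff ℝ ∞ fun x => R (spatial x) i := fun i =>
      (EuclideanSpace.proj (𝕜 := ℝ) i).contDiff.comp (R.contDiff.comp contDiff_spatial)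
    refine contDiff_euclidean.2 fun i => ?_
    fin_cases i
    · exact (EuclideanSpace.proj (𝕜 := ℝ) (0 : Fin 4)).contDiff
    · exact hR 0
    · exact hR 1
    · exact hR 2
  exact h.contMDiff.comp contMDiff_subtype_val

end Bases

end

end DiracSheaf

open DiracSheaf

set_option linter.unusedSectionVars false

/-! Passing to logarithms makes the theory linear. A germ of 𝒢 is a phase modulo constants. It has a
smooth logarithm `u` (`exists_hasLogAt`), two logarithms of it have the same differential
(`HasLogAt.exactForm_eq`), and equality of these differentials near a point forces equality of germs
(`HasLogAt.unique`). Sections of 𝒢 thus amount to closed imaginary 1-forms, with products turned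
into sums, and the gauge law becomes `A_i = A_j - du` (`IsConnection.eq_sub_exactForm`).

Spherical symmetry follows because a connection is determined up to equivalence by its curvature
(`connectionEquivalent_of_curvature_eq`). If the curvatures agree, `A'_k - A_k` is closed and
imaginary, hence locally a logarithmic derivative by the Poincaré lemma. The local phases differ by
constants, which 𝒢 does not see, so they glue without any obstruction from periods. The curvature of
the Dirac connection is a multiple of `dS`, and rotations preserve `dS` (`pullForm_areaForm`).

The Chern class is well defined because an equivalence of bundles is right multiplication by
sections `s_k`, and the forms `A'_k - A_k - d log s_k` agree on overlaps. They make up a global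
1-form whose derivative is the difference of the curvatures (`exists_difference_form`).

For the Dirac potential, `(ε - cos θ) dφ = ε (x dy - y dx) / (r (r + ε z))` with `ε = ±1`. The
right-hand side is smooth off one half-axis, and this half-axis lies outside the corresponding open
set. It is a form on `ℝ³` pulled back to `X`, so smoothness and curvature are computed once in
Cartesian coordinates (`monopoleForm_curl`).

If two Dirac bundles with different parameters were equivalent, a nonzero multiple of `dS` would be
exact. Pulled back to the rectangle `[0, π] × [0, 2π]` of spherical coordinates, this contradicts
Stokes: the boundary terms cancel or vanish, while the integral of `sin θ` is `4π`
(`eq_zero_of_extD_eq_smul_areaForm`). -/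

namespace DiracSheaf

noncomputable section

/-! ## Smooth families of alternating forms -/

section Alternating

variable {E V W : Type*} [NormedAddCommGroup E] [NormedSpace ℝ E] [NormedAddCommGroup V]
  [NormedSpace ℝ V] [NormedAddCommGroup W] [NormedSpace ℝ W] [FiniteDimensional ℝ V] {k : ℕ}

/-- A family of complex alternating forms on a finite-dimensional space is smooth if its values on
all constant vectors are. -/
theorem contDiffAt_alternating {f : E → V [⋀^Fin k]→L[ℝ] ℂ} {x : E}
    (h : ∀ v, ContDiffAt ℝ ∞ (fun y => f y v) x) : ContDiffAt ℝ ∞ f x := by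
  let b := Module.finBasis ℝ V
  let Φ : (V [⋀^Fin k]→L[ℝ] ℂ) →ₗ[ℝ] ((Fin k → Fin (Module.finrank ℝ V)) → ℂ) :=
    { toFun := fun η s => η fun i => b (s i)
      map_add' := fun _ _ => rfl
      map_smul' := fun _ _ => rfl }
  -- A multilinear map is determined by its values on tuples of basis vectors, so `f` is recovered
  -- from finitely many smooth functions by a linear left inverse of `Φ`.
  have hΦ : LinearMap.ker Φ = ⊥ := by
    refine LinearMap.ker_eq_bot.2 fun η η' hη => ?_
    refine ContinuousAlternatingMap.toAlternatingMap_injective ?_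
    refine AlternatingMap.coe_multilinearMap_injective ?_
    exact Module.Basis.ext_multilinear (fun _ => b) fun s => congrFun hη s
  obtain ⟨r, hr⟩ := Φ.exists_leftInverse_of_injective hΦ
  have h1 : f = fun y => LinearMap.toContinuousLinearMap r (Φ (f y)) :=
    funext fun y => (LinearMap.congr_fun hr (f y)).symm
  rw [h1]
  exact (LinearMap.toContinuousLinearMap r).contDiff.contDiffAt.comp x
    (contDiffAt_pi.2 fun s => h _)

/-- The pullback is linear in the form and multilinear in the `k` copies of `L`, hence a smooth
function of both. -/
theorem contDiffAt_compContinuousLinearMap {η : E → W [⋀^Fin k]→L[ℝ] ℂ} {L : E → V →L[ℝ] W} {x : E}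
    (hη : ContDiffAt ℝ ∞ η x) (hL : ContDiffAt ℝ ∞ L x) :
    ContDiffAt ℝ ∞ (fun y => (η y).compContinuousLinearMap (L y)) x := by
  refine contDiffAt_alternating fun v => ?_
  have h0 : ContDiff ℝ ∞ (ContinuousMultilinearMap.compContinuousLinearMapContinuousMultilinear ℝ
      (fun _ : Fin k => V) (fun _ => W) ℂ) :=
    ContinuousMultilinearMap.contDiff
      (F := (W [×k]→L[ℝ] ℂ) →L[ℝ] V [×k]→L[ℝ] ℂ) _
  have h1 : ContDiffAt ℝ ∞ (fun y => ContinuousMultilinearMap.compContinuousLinearMapContinuousMultilinear ℝ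
      (fun _ : Fin k => V) (fun _ => W) ℂ (fun _ => L y)) x :=
    h0.contDiffAt.comp x (contDiffAt_pi.2 fun _ => hL)
  have h2 : ContDiffAt ℝ ∞ (fun y => (η y).toContinuousMultilinearMap) x :=
    (ContinuousAlternatingMap.toContinuousMultilinearMapCLM (𝕜 := ℝ) (E := W) (F := ℂ)
      (ι := Fin k) ℝ).contDiff.contDiffAt.comp x hη
  exact ((ContinuousMultilinearMap.apply ℝ (fun _ : Fin k => V) ℂ v).contDiff.contDiffAt).comp x
    (h1.clm_apply h2)

theorem two_le_smooth : minSmoothness ℝ 2 ≤ (∞ : ℕ∞ω) := by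
  rw [minSmoothness_of_isRCLikeNormedField]
  exact WithTop.coe_le_coe.2 le_top

theorem contDiffAt_extDeriv {η : V → V [⋀^Fin k]→L[ℝ] ℂ} {x : V} (h : ContDiffAt ℝ ∞ η x) :
    ContDiffAt ℝ ∞ (extDeriv η) x :=
  ContDiffAt.comp (g := ContinuousAlternatingMap.alternatizeUncurryFinCLM ℝ V ℂ) x
    (ContinuousLinearMap.contDiff _).contDiffAt (h.fderiv_right (m := ∞) le_rfl)

end Alternating

/-! ## Calculus of differential forms on manifolds -/

section Calculus

variable {n m k : ℕ} {X Y : Type} [TopologicalSpace X] [ChartedSpace (EuclideanSpace ℝ (Fin n)) X]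
  [IsManifold (𝓡 n) ∞ X]
  [TopologicalSpace Y] [ChartedSpace (EuclideanSpace ℝ (Fin m)) Y] [IsManifold (𝓡 m) ∞ Y]

theorem contMDiffAt_chart_symm (x₀ : X) {z : EuclideanSpace ℝ (Fin n)}
    (hz : z ∈ (extChartAt (𝓡 n) x₀).target) :
    ContMDiffAt 𝓘(ℝ, EuclideanSpace ℝ (Fin n)) (𝓡 n) ∞ (extChartAt (𝓡 n) x₀).symm z :=
  (contMDiffOn_extChartAt_symm x₀).contMDiffAt ((isOpen_extChartAt_target x₀).mem_nhds hz)

theorem contMDiffAt_chart (x₀ : X) {x : X} (hx : x ∈ (extChartAt (𝓡 n) x₀).source) :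
    ContMDiffAt (𝓡 n) 𝓘(ℝ, EuclideanSpace ℝ (Fin n)) ∞ (extChartAt (𝓡 n) x₀) x :=
  contMDiffAt_extChartAt' (by rwa [extChartAt_source] at hx)

theorem contDiffAt_chartMap {f : X → Y} (hf : ContMDiff (𝓡 n) (𝓡 m) ∞ f)
    (x₀ : X) (y₀ : Y) {z : EuclideanSpace ℝ (Fin n)} (hz : z ∈ (extChartAt (𝓡 n) x₀).target)
    (hy : f ((extChartAt (𝓡 n) x₀).symm z) ∈ (extChartAt (𝓡 m) y₀).source) :
    ContDiffAt ℝ ∞ (extChartAt (𝓡 m) y₀ ∘ f ∘ (extChartAt (𝓡 n) x₀).symm) z :=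
  ((contMDiffAt_chart y₀ hy).comp z
    (hf.contMDiffAt.comp z (contMDiffAt_chart_symm x₀ hz))).contDiffAt

/-- Two applications of the chain rule to `f ∘ φ⁻¹ = ψ⁻¹ ∘ (ψ ∘ f ∘ φ⁻¹)`. It reduces pullbacks on
manifolds, and with `f = id` changes of charts, to pullbacks between Euclidean spaces. -/
theorem chartRep_pullForm {f : X → Y} (hf : ContMDiff (𝓡 n) (𝓡 m) ∞ f) (ξ : DiffForm m Y k)
    (x₀ : X) (y₀ : Y) {z : EuclideanSpace ℝ (Fin n)} (hz : z ∈ (extChartAt (𝓡 n) x₀).target)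
    (hy : f ((extChartAt (𝓡 n) x₀).symm z) ∈ (extChartAt (𝓡 m) y₀).source) :
    chartRep n (pullForm n f ξ) x₀ z =
      (chartRep m ξ y₀ ((extChartAt (𝓡 m) y₀ ∘ f ∘ (extChartAt (𝓡 n) x₀).symm) z)).compContinuousLinearMap
        (fderiv ℝ (extChartAt (𝓡 m) y₀ ∘ f ∘ (extChartAt (𝓡 n) x₀).symm) z) := by
  set φ := extChartAt (𝓡 n) x₀
  set ψ := extChartAt (𝓡 m) y₀
  have hs := (contMDiffAt_chart_symm x₀ hz).mdifferentiableAt (by simp)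
  have hF := (contDiffAt_chartMap hf x₀ y₀ hz hy).contMDiffAt.mdifferentiableAt
    (by simp)
  have hψ := (contMDiffAt_chart_symm y₀ (ψ.map_source hy)).mdifferentiableAt (by simp)
  have h1 : ψ.symm ∘ (ψ ∘ f ∘ φ.symm) =ᶠ[𝓝 z] f ∘ φ.symm := by
    have hc : ContinuousAt (f ∘ φ.symm) z := hf.continuous.continuousAt.comp hs.continuousAt
    filter_upwards [hc.preimage_mem_nhds ((isOpen_extChartAt_source y₀).mem_nhds hy)] with w hw
    exact ψ.left_inv hw
  have h2 : mfderiv 𝓘(ℝ, EuclideanSpace ℝ (Fin n)) (𝓡 m) (f ∘ φ.symm) z =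
      (mfderiv (𝓡 n) (𝓡 m) f (φ.symm z)).comp
        (mfderiv 𝓘(ℝ, EuclideanSpace ℝ (Fin n)) (𝓡 n) φ.symm z) :=
    mfderiv_comp z (hf.mdifferentiableAt (by simp)) hs
  have h3 := mfderiv_comp z (I'' := 𝓡 m) hψ hF
  rw [mfderiv_eq_fderiv] at h3
  have h4 := h1.mfderiv_eq (I := 𝓘(ℝ, EuclideanSpace ℝ (Fin n))) (I' := 𝓡 m)
  have h5 : ψ.symm ((ψ ∘ f ∘ φ.symm) z) = f (φ.symm z) := ψ.left_inv hy
  ext v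
  change (ξ (f (φ.symm z))) (fun i => (mfderiv (𝓡 n) (𝓡 m) f (φ.symm z)).comp
        (mfderiv 𝓘(ℝ, EuclideanSpace ℝ (Fin n)) (𝓡 n) φ.symm z) (v i)) =
    (ξ (ψ.symm ((ψ ∘ f ∘ φ.symm) z))) (fun i => (mfderiv 𝓘(ℝ, EuclideanSpace ℝ (Fin m)) (𝓡 m)
      ψ.symm ((ψ ∘ f ∘ φ.symm) z)).comp (fderiv ℝ (ψ ∘ f ∘ φ.symm) z) (v i))
  have h6 : ∀ w, (mfderiv (𝓡 n) (𝓡 m) f (φ.symm z)).comp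
        (mfderiv 𝓘(ℝ, EuclideanSpace ℝ (Fin n)) (𝓡 n) φ.symm z) w =
      (mfderiv 𝓘(ℝ, EuclideanSpace ℝ (Fin m)) (𝓡 m)
      ψ.symm ((ψ ∘ f ∘ φ.symm) z)).comp (fderiv ℝ (ψ ∘ f ∘ φ.symm) z) w := by
    intro w
    refine (DFunLike.congr_fun h2 w).symm.trans ?_
    exact (DFunLike.congr_fun h4 w).symm.trans (DFunLike.congr_fun h3 w)
  -- All tangent spaces are the same model space. Reading `ξ` as a family of forms on that fixed
  -- space allows the base point to be rewritten.
  let ξ' : Y → EuclideanSpace ℝ (Fin m) [⋀^Fin k]→L[ℝ] ℂ := ξ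
  change ξ' (f (φ.symm z)) _ = ξ' (ψ.symm ((ψ ∘ f ∘ φ.symm) z)) _
  rw [h5]
  congr 1
  funext i
  exact h6 (v i)

theorem eventually_chartRep_pullForm {f : X → Y} (hf : ContMDiff (𝓡 n) (𝓡 m) ∞ f)
    (ξ : DiffForm m Y k)
    (x₀ : X) (y₀ : Y) {z : EuclideanSpace ℝ (Fin n)} (hz : z ∈ (extChartAt (𝓡 n) x₀).target)
    (hy : f ((extChartAt (𝓡 n) x₀).symm z) ∈ (extChartAt (𝓡 m) y₀).source) :
    chartRep n (pullForm n f ξ) x₀ =ᶠ[𝓝 z] fun z =>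
      (chartRep m ξ y₀ ((extChartAt (𝓡 m) y₀ ∘ f ∘ (extChartAt (𝓡 n) x₀).symm) z)).compContinuousLinearMap
        (fderiv ℝ (extChartAt (𝓡 m) y₀ ∘ f ∘ (extChartAt (𝓡 n) x₀).symm) z) := by
  have hc : ContinuousAt (f ∘ (extChartAt (𝓡 n) x₀).symm) z :=
    hf.continuous.continuousAt.comp (contMDiffAt_chart_symm x₀ hz).continuousAt
  filter_upwards [hc.preimage_mem_nhds ((isOpen_extChartAt_source y₀).mem_nhds hy),
    (isOpen_extChartAt_target x₀).mem_nhds hz] with w hw hw'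
  exact chartRep_pullForm hf ξ x₀ y₀ hw' hw

theorem contDiffAt_chartRep_pullForm {f : X → Y} (hf : ContMDiff (𝓡 n) (𝓡 m) ∞ f)
    {ξ : DiffForm m Y k}
    (x₀ : X) (y₀ : Y) {z : EuclideanSpace ℝ (Fin n)} (hz : z ∈ (extChartAt (𝓡 n) x₀).target)
    (hy : f ((extChartAt (𝓡 n) x₀).symm z) ∈ (extChartAt (𝓡 m) y₀).source)
    (hξ : ContDiffAt ℝ ∞ (chartRep m ξ y₀)
      (extChartAt (𝓡 m) y₀ (f ((extChartAt (𝓡 n) x₀).symm z)))) :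
    ContDiffAt ℝ ∞ (chartRep n (pullForm n f ξ) x₀) z := by
  have hF := contDiffAt_chartMap hf x₀ y₀ hz hy
  refine ContDiffAt.congr_of_eventuallyEq ?_ (eventually_chartRep_pullForm hf ξ x₀ y₀ hz hy)
  exact contDiffAt_compContinuousLinearMap 
    (ContDiffAt.comp (g := chartRep m ξ y₀) z hξ hF) (hF.fderiv_right (m := ∞) le_rfl)

theorem extDeriv_chartRep_pullForm {f : X → Y} (hf : ContMDiff (𝓡 n) (𝓡 m) ∞ f)
    {ξ : DiffForm m Y k}
    (x₀ : X) (y₀ : Y) {z : EuclideanSpace ℝ (Fin n)} (hz : z ∈ (extChartAt (𝓡 n) x₀).target)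
    (hy : f ((extChartAt (𝓡 n) x₀).symm z) ∈ (extChartAt (𝓡 m) y₀).source)
    (hξ : ContDiffAt ℝ ∞ (chartRep m ξ y₀)
      (extChartAt (𝓡 m) y₀ (f ((extChartAt (𝓡 n) x₀).symm z)))) :
    extDeriv (chartRep n (pullForm n f ξ) x₀) z =
      (extDeriv (chartRep m ξ y₀)
        ((extChartAt (𝓡 m) y₀ ∘ f ∘ (extChartAt (𝓡 n) x₀).symm) z)).compContinuousLinearMap
          (fderiv ℝ (extChartAt (𝓡 m) y₀ ∘ f ∘ (extChartAt (𝓡 n) x₀).symm) z) := by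
  rw [(eventually_chartRep_pullForm hf ξ x₀ y₀ hz hy).extDeriv_eq]
  exact extDeriv_pullback (f := extChartAt (𝓡 m) y₀ ∘ f ∘ (extChartAt (𝓡 n) x₀).symm)
    (hξ.differentiableAt (by simp)) (contDiffAt_chartMap hf x₀ y₀ hz hy) two_le_smooth

theorem pullForm_id (ξ : DiffForm n X k) : pullForm n id ξ = ξ := by
  funext x
  ext v
  simp only [pullForm, mfderiv_id]
  rfl

/-- `ξ` is smooth at `x`. -/
def SmoothAt (ξ : DiffForm n X k) (x : X) : Prop :=
  ContDiffAt ℝ ∞ (chartRep n ξ x) (extChartAt (𝓡 n) x x)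

/-- A change of charts is the pullback along the identity, expressed in the two charts. -/
theorem smoothAt_of_chart {ξ : DiffForm n X k} {x x₀ x₁ : X}
    (h₀ : x ∈ (extChartAt (𝓡 n) x₀).source) (h₁ : x ∈ (extChartAt (𝓡 n) x₁).source)
    (h : ContDiffAt ℝ ∞ (chartRep n ξ x₀) (extChartAt (𝓡 n) x₀ x)) :
    ContDiffAt ℝ ∞ (chartRep n ξ x₁) (extChartAt (𝓡 n) x₁ x) := by
  rw [← pullForm_id ξ]
  have hx := (extChartAt (𝓡 n) x₁).left_inv h₁
  refine contDiffAt_chartRep_pullForm contMDiff_id x₁ x₀ ((extChartAt (𝓡 n) x₁).map_source h₁) ?_ ?_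
  · rw [hx]; exact h₀
  · rw [hx]; exact h

theorem smoothAt_iff {ξ : DiffForm n X k} {x x₀ : X} (h₀ : x ∈ (extChartAt (𝓡 n) x₀).source) :
    SmoothAt ξ x ↔ ContDiffAt ℝ ∞ (chartRep n ξ x₀) (extChartAt (𝓡 n) x₀ x) :=
  ⟨smoothAt_of_chart (mem_extChartAt_source x) h₀, smoothAt_of_chart h₀ (mem_extChartAt_source x)⟩

theorem isOpen_chartRep_domain (x₀ : X) (U : Opens X) :
    IsOpen ((extChartAt (𝓡 n) x₀).target ∩ (extChartAt (𝓡 n) x₀).symm ⁻¹' U) :=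
  (continuousOn_extChartAt_symm x₀).isOpen_inter_preimage (isOpen_extChartAt_target x₀) U.isOpen

theorem smoothOn_iff {ξ : DiffForm n X k} {U : Opens X} :
    SmoothOn n ξ U ↔ ∀ x ∈ U, SmoothAt ξ x := by
  constructor
  · intro h x hx
    refine (h x).contDiffAt ((isOpen_chartRep_domain x U).mem_nhds ⟨mem_extChartAt_target x, ?_⟩)
    simpa using hx
  · rintro h x₀ z ⟨hz, hzU⟩
    have h1 := (smoothAt_iff ((extChartAt (𝓡 n) x₀).map_target hz)).1 (h _ hzU)
    rw [(extChartAt (𝓡 n) x₀).right_inv hz] at h1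
    exact h1.contDiffWithinAt

theorem SmoothAt.pullForm {f : X → Y} (hf : ContMDiff (𝓡 n) (𝓡 m) ∞ f) {ξ : DiffForm m Y k} {x : X}
    (h : SmoothAt ξ (f x)) : SmoothAt (pullForm n f ξ) x := by
  refine contDiffAt_chartRep_pullForm hf x (f x) (mem_extChartAt_target x) ?_ ?_
  · rw [extChartAt_to_inv]; exact mem_extChartAt_source _
  · rw [extChartAt_to_inv]; exact h

/-- Naturality of `d` holds for the expression of `f` in charts by `extDeriv_pullback`; the chain
rule for `ψ ∘ f` then accounts for the derivatives of the two charts. -/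
theorem extD_pullForm {f : X → Y} (hf : ContMDiff (𝓡 n) (𝓡 m) ∞ f) {ξ : DiffForm m Y k} {x : X}
    (h : SmoothAt ξ (f x)) : extD n (pullForm n f ξ) x = pullForm n f (extD m ξ) x := by
  have h1 := extDeriv_chartRep_pullForm hf x (f x) (mem_extChartAt_target x)
    (by rw [extChartAt_to_inv]; exact mem_extChartAt_source _)
    (by rw [extChartAt_to_inv]; exact h)
  have h2 : (extChartAt (𝓡 m) (f x) ∘ f ∘ (extChartAt (𝓡 n) x).symm) ∘ extChartAt (𝓡 n) x
      =ᶠ[𝓝 x] extChartAt (𝓡 m) (f x) ∘ f := by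
    filter_upwards [(isOpen_extChartAt_source (I := 𝓡 n) x).mem_nhds (mem_extChartAt_source x)] with y hy
    exact congrArg _ (congrArg f ((extChartAt (𝓡 n) x).left_inv hy))
  have h3 := h2.mfderiv_eq (I := 𝓡 n) (I' := 𝓘(ℝ, EuclideanSpace ℝ (Fin m)))
  rw [mfderiv_comp x (I' := 𝓘(ℝ, EuclideanSpace ℝ (Fin n)))
      ((contDiffAt_chartMap hf x (f x) (mem_extChartAt_target x)
      (by rw [extChartAt_to_inv]; exact mem_extChartAt_source _)).contMDiffAt.mdifferentiableAt (by simp))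
      ((contMDiffAt_chart x (mem_extChartAt_source x)).mdifferentiableAt (by simp)),
    mfderiv_eq_fderiv, mfderiv_comp x (I' := 𝓡 m)
      ((contMDiffAt_chart (f x) (mem_extChartAt_source _)).mdifferentiableAt (by simp))
      (hf.mdifferentiableAt (by simp))] at h3
  ext v
  change extDeriv (chartRep n (DiracSheaf.pullForm n f ξ) x) _ _ =
    extDeriv (chartRep m ξ (f x)) (extChartAt (𝓡 m) (f x) (f x)) _
  rw [h1]
  have h4 : (extChartAt (𝓡 m) (f x) ∘ f ∘ (extChartAt (𝓡 n) x).symm) (extChartAt (𝓡 n) x x) =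
      extChartAt (𝓡 m) (f x) (f x) := by
    simp only [Function.comp_apply]
    rw [extChartAt_to_inv (I := 𝓡 n)]
  change extDeriv (chartRep m ξ (f x)) ((extChartAt (𝓡 m) (f x) ∘ f ∘ (extChartAt (𝓡 n) x).symm) (extChartAt (𝓡 n) x x)) _ = _
  rw [h4]
  congr 1
  funext i
  exact DFunLike.congr_fun h3 (v i)

/-- The exterior derivative may be computed in any chart. -/
theorem extDeriv_chartRep {ξ : DiffForm n X k} {x₀ : X} {z : EuclideanSpace ℝ (Fin n)}
    (hz : z ∈ (extChartAt (𝓡 n) x₀).target) (h : SmoothAt ξ ((extChartAt (𝓡 n) x₀).symm z)) :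
    extDeriv (chartRep n ξ x₀) z = chartRep n (extD n ξ) x₀ z := by
  set x := (extChartAt (𝓡 n) x₀).symm z
  -- The identity is read from the chart around `x₀` to the chart around `x`, the one that enters
  -- the definition of `extD` at `x`.
  have h1 := extDeriv_chartRep_pullForm contMDiff_id x₀ x hz (mem_extChartAt_source x) h
  rw [pullForm_id] at h1
  rw [h1]
  have h2 : mfderiv 𝓘(ℝ, EuclideanSpace ℝ (Fin n)) 𝓘(ℝ, EuclideanSpace ℝ (Fin n))
      (extChartAt (𝓡 n) x ∘ id ∘ (extChartAt (𝓡 n) x₀).symm) z =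
      (mfderiv (𝓡 n) 𝓘(ℝ, EuclideanSpace ℝ (Fin n)) (extChartAt (𝓡 n) x) x).comp
        (mfderiv 𝓘(ℝ, EuclideanSpace ℝ (Fin n)) (𝓡 n) (extChartAt (𝓡 n) x₀).symm z) :=
    mfderiv_comp z (I' := 𝓡 n)
      ((contMDiffAt_chart x (mem_extChartAt_source x)).mdifferentiableAt (by simp))
      ((contMDiffAt_chart_symm x₀ hz).mdifferentiableAt (by simp))
  rw [mfderiv_eq_fderiv] at h2
  ext v
  change extDeriv (chartRep n ξ x) (extChartAt (𝓡 n) x x) _ =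
    extDeriv (chartRep n ξ x) (extChartAt (𝓡 n) x x) _
  congr 1
  funext i
  exact DFunLike.congr_fun h2 (v i)

theorem eventually_chartRep_congr {ξ ξ' : DiffForm n X k} {x : X} (h : ∀ᶠ y in 𝓝 x, ξ y = ξ' y) :
    chartRep n ξ x =ᶠ[𝓝 (extChartAt (𝓡 n) x x)] chartRep n ξ' x := by
  have hc := (contMDiffAt_chart_symm (n := n) x (mem_extChartAt_target x)).continuousAt
  rw [ContinuousAt, extChartAt_to_inv (I := 𝓡 n)] at hc
  filter_upwards [hc.eventually h] with z hz
  simp only [chartRep, hz]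

theorem extD_congr {ξ ξ' : DiffForm n X k} {x : X} (h : ∀ᶠ y in 𝓝 x, ξ y = ξ' y) :
    extD n ξ x = extD n ξ' x := by
  simp only [extD, (eventually_chartRep_congr h).extDeriv_eq]

theorem SmoothAt.congr {ξ ξ' : DiffForm n X k} {x : X} (hξ : SmoothAt ξ x)
    (h : ∀ᶠ y in 𝓝 x, ξ y = ξ' y) : SmoothAt ξ' x :=
  ContDiffAt.congr_of_eventuallyEq hξ (eventually_chartRep_congr h).symm

theorem SmoothAt.const_smul {ξ : DiffForm n X k} {x : X} (c : ℂ) (h : SmoothAt ξ x) :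
    SmoothAt (c • ξ) x :=
  ContDiffAt.const_smul c h

theorem SmoothAt.sub {ξ ξ' : DiffForm n X k} {x : X} (h : SmoothAt ξ x) (h' : SmoothAt ξ' x) :
    SmoothAt (ξ - ξ') x :=
  ContDiffAt.sub h h'

theorem extD_sub {ξ ξ' : DiffForm n X k} {x : X} (h : SmoothAt ξ x) (h' : SmoothAt ξ' x) :
    extD n (ξ - ξ') x = extD n ξ x - extD n ξ' x := by
  have h1 : extDeriv (chartRep n (ξ - ξ') x) (extChartAt (𝓡 n) x x) =
      extDeriv (chartRep n ξ x) (extChartAt (𝓡 n) x x) -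
        extDeriv (chartRep n ξ' x) (extChartAt (𝓡 n) x x) := by
    have h2 : fderiv ℝ (chartRep n (ξ - ξ') x) (extChartAt (𝓡 n) x x) =
        fderiv ℝ (chartRep n ξ x) (extChartAt (𝓡 n) x x) -
          fderiv ℝ (chartRep n ξ' x) (extChartAt (𝓡 n) x x) :=
      fderiv_sub (h.differentiableAt (by simp)) (h'.differentiableAt (by simp))
    rw [extDeriv, h2]
    exact map_sub (ContinuousAlternatingMap.alternatizeUncurryFinCLM ℝ _ ℂ) _ _
  unfold extD
  rw [h1]
  rfl

theorem extD_const_smul {ξ : DiffForm n X k} {x : X} (c : ℂ) (h : SmoothAt ξ x) :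
    extD n (c • ξ) x = c • extD n ξ x := by
  have h1 : extDeriv (chartRep n (c • ξ) x) (extChartAt (𝓡 n) x x) =
      c • extDeriv (chartRep n ξ x) (extChartAt (𝓡 n) x x) := by
    have h2 : fderiv ℝ (chartRep n (c • ξ) x) (extChartAt (𝓡 n) x x) =
        c • fderiv ℝ (chartRep n ξ x) (extChartAt (𝓡 n) x x) :=
      fderiv_const_smul (h.differentiableAt (by simp)) c
    rw [extDeriv, h2]
    ext v
    simp [ContinuousAlternatingMap.alternatizeUncurryFin_apply, extDeriv]
  unfold extD
  rw [h1]
  rfl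

/-- By definition `extD` uses a different chart at every point. Since `d` may be computed in any
chart, one fixed chart serves for a whole neighbourhood, where the claim is about `extDeriv` of a
smooth family. -/
theorem SmoothOn.extD {ξ : DiffForm n X k} {U : Opens X} (h : SmoothOn n ξ U) :
    SmoothOn n (extD n ξ) U := by
  rintro x₀ z hz
  have h1 := (h x₀).contDiffAt ((isOpen_chartRep_domain x₀ U).mem_nhds hz)
  refine ((contDiffAt_extDeriv h1).congr_of_eventuallyEq ?_).contDiffWithinAt
  filter_upwards [(isOpen_chartRep_domain x₀ U).mem_nhds hz] with w hw
  exact (extDeriv_chartRep hw.1 (smoothOn_iff.1 h _ hw.2)).symm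

theorem extD_extD {ξ : DiffForm n X k} {U : Opens X} (h : SmoothOn n ξ U) {x : X} (hx : x ∈ U) :
    extD n (extD n ξ) x = 0 := by
  have hz : extChartAt (𝓡 n) x x ∈
      (extChartAt (𝓡 n) x).target ∩ (extChartAt (𝓡 n) x).symm ⁻¹' U :=
    ⟨mem_extChartAt_target x, by simpa using hx⟩
  have h1 : chartRep n (extD n ξ) x =ᶠ[𝓝 (extChartAt (𝓡 n) x x)] extDeriv (chartRep n ξ x) := by
    filter_upwards [(isOpen_chartRep_domain x U).mem_nhds hz] with w hw
    exact (extDeriv_chartRep hw.1 (smoothOn_iff.1 h _ hw.2)).symm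
  have h2 := extDeriv_extDeriv_apply (smoothOn_iff.1 h x hx) two_le_smooth
  ext v
  change extDeriv (chartRep n (extD n ξ) x) _ _ = 0
  rw [h1.extDeriv_eq, h2]
  rfl

/-! ### Forms on Euclidean space -/

theorem chartRep_euclidean (ξ : DiffForm n (EuclideanSpace ℝ (Fin n)) k)
    (x₀ : EuclideanSpace ℝ (Fin n)) : chartRep n ξ x₀ = ξ := by
  funext z
  ext v
  have h1 : ⇑(extChartAt (𝓡 n) x₀).symm = id := by rw [extChartAt_model_space_eq_id]; rfl
  unfold chartRep
  rw [h1, mfderiv_id]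
  rfl

theorem smoothAt_euclidean {ξ : EuclideanSpace ℝ (Fin n) → EuclideanSpace ℝ (Fin n) [⋀^Fin k]→L[ℝ] ℂ}
    {x : EuclideanSpace ℝ (Fin n)} :
    SmoothAt (n := n) (X := EuclideanSpace ℝ (Fin n)) ξ x ↔ ContDiffAt ℝ ∞ ξ x := by
  unfold SmoothAt
  rw [chartRep_euclidean (n := n) (k := k) ξ x, extChartAt_model_space_eq_id]
  rfl

theorem extD_euclidean (ξ : EuclideanSpace ℝ (Fin n) → EuclideanSpace ℝ (Fin n) [⋀^Fin k]→L[ℝ] ℂ)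
    (x : EuclideanSpace ℝ (Fin n)) :
    extD n (X := EuclideanSpace ℝ (Fin n)) ξ x = extDeriv ξ x := by
  ext v
  change extDeriv (chartRep n ξ x) (extChartAt (𝓡 n) x x) (fun i => mfderiv (𝓡 n) 𝓘(ℝ, EuclideanSpace ℝ (Fin n)) (extChartAt (𝓡 n) x) x (v i)) = _
  have h1 : ⇑(extChartAt (𝓡 n) x) = id := by rw [extChartAt_model_space_eq_id]; rfl
  have h2 := chartRep_euclidean (n := n) (k := k) ξ x
  rw [h2, h1, mfderiv_id]
  rfl

end Calculus

/-! ## Exact forms and the Poincaré lemma -/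

section Exact

variable {n : ℕ} {X : Type} [TopologicalSpace X] [ChartedSpace (EuclideanSpace ℝ (Fin n)) X]
  [IsManifold (𝓡 n) ∞ X]

theorem oneForm_ext {x : X} {a b : TangentSpace (𝓡 n) x [⋀^Fin 1]→L[ℝ] ℂ}
    (h : ∀ v, a ![v] = b ![v]) : a = b := by
  ext v
  have hv : v = ![v 0] := by
    funext i
    fin_cases i
    rfl
  rw [hv]
  exact h _

variable (n) in
/-- The differential `du` of a function. -/
def exactForm (u : X → ℂ) : DiffForm n X 1 :=
  oneForm n fun x => (NormedSpace.fromTangentSpace (𝕜 := ℝ) (u x)).toContinuousLinearMap ∘L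
    mfderiv (𝓡 n) 𝓘(ℝ, ℂ) u x

theorem exactForm_add {u w : X → ℂ} {x : X} (hu : MDifferentiableAt (𝓡 n) 𝓘(ℝ, ℂ) u x)
    (hw : MDifferentiableAt (𝓡 n) 𝓘(ℝ, ℂ) w x) :
    exactForm n (u + w) x = exactForm n u x + exactForm n w x :=
  oneForm_ext fun v => DFunLike.congr_fun (mfderiv_add hu hw) v

theorem exactForm_neg {u : X → ℂ} {x : X} :
    exactForm n (-u) x = -exactForm n u x :=
  oneForm_ext fun v => DFunLike.congr_fun mfderiv_neg v

theorem fderiv_comp_chart_symm {u : X → ℂ} {x₀ : X} {z : EuclideanSpace ℝ (Fin n)}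
    (hz : z ∈ (extChartAt (𝓡 n) x₀).target)
    (hu : MDifferentiableAt (𝓡 n) 𝓘(ℝ, ℂ) u ((extChartAt (𝓡 n) x₀).symm z)) :
    fderiv ℝ (u ∘ (extChartAt (𝓡 n) x₀).symm) z =
      (mfderiv (𝓡 n) 𝓘(ℝ, ℂ) u ((extChartAt (𝓡 n) x₀).symm z)).comp
        (mfderiv 𝓘(ℝ, EuclideanSpace ℝ (Fin n)) (𝓡 n) (extChartAt (𝓡 n) x₀).symm z) := by
  rw [← mfderiv_eq_fderiv]
  exact mfderiv_comp z hu ((contMDiffAt_chart_symm x₀ hz).mdifferentiableAt (by simp))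

/-- With `du` presented as the exterior derivative of a `0`-form, its smoothness and `d(du) = 0`
become instances of the general facts on `extDeriv`. -/
theorem chartRep_exactForm {u : X → ℂ} {x₀ : X} {z : EuclideanSpace ℝ (Fin n)}
    (hz : z ∈ (extChartAt (𝓡 n) x₀).target)
    (hu : MDifferentiableAt (𝓡 n) 𝓘(ℝ, ℂ) u ((extChartAt (𝓡 n) x₀).symm z)) :
    chartRep n (exactForm n u) x₀ z =
      extDeriv (fun w => ContinuousAlternatingMap.constOfIsEmpty ℝ (EuclideanSpace ℝ (Fin n)) (Fin 0)
        ((u ∘ (extChartAt (𝓡 n) x₀).symm) w)) z := by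
  rw [extDeriv_constOfIsEmpty, fderiv_comp_chart_symm hz hu]
  rfl

theorem contDiffAt_constOfIsEmpty {u : EuclideanSpace ℝ (Fin n) → ℂ} {z} (hu : ContDiffAt ℝ ∞ u z) :
    ContDiffAt ℝ ∞ (fun w => ContinuousAlternatingMap.constOfIsEmpty ℝ (EuclideanSpace ℝ (Fin n))
      (Fin 0) (u w)) z :=
  contDiffAt_alternating fun v => by simpa using hu

theorem smoothOn_exactForm {u : X → ℂ} {U : Opens X}
    (hu : ∀ x ∈ U, ContMDiffAt (𝓡 n) 𝓘(ℝ, ℂ) ∞ u x) : SmoothOn n (exactForm n u) U := by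
  intro x₀ z hz
  refine ContDiffAt.contDiffWithinAt ?_
  have h1 : ContDiffAt ℝ ∞ (u ∘ (extChartAt (𝓡 n) x₀).symm) z :=
    ((hu _ hz.2).comp z (contMDiffAt_chart_symm x₀ hz.1)).contDiffAt
  refine (contDiffAt_extDeriv (contDiffAt_constOfIsEmpty h1)).congr_of_eventuallyEq ?_
  filter_upwards [(isOpen_chartRep_domain x₀ U).mem_nhds hz] with w hw
  exact chartRep_exactForm hw.1 ((hu _ hw.2).mdifferentiableAt (by simp))

theorem extD_exactForm {u : X → ℂ} {U : Opens X}
    (hu : ∀ x ∈ U, ContMDiffAt (𝓡 n) 𝓘(ℝ, ℂ) ∞ u x) {x : X} (hx : x ∈ U) :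
    extD n (exactForm n u) x = 0 := by
  have hz : extChartAt (𝓡 n) x x ∈
      (extChartAt (𝓡 n) x).target ∩ (extChartAt (𝓡 n) x).symm ⁻¹' U :=
    ⟨mem_extChartAt_target x, by rwa [Set.mem_preimage, extChartAt_to_inv]⟩
  have h1 : ContDiffAt ℝ ∞ (u ∘ (extChartAt (𝓡 n) x).symm) (extChartAt (𝓡 n) x x) :=
    ((hu _ hz.2).comp _ (contMDiffAt_chart_symm x hz.1)).contDiffAt
  have h2 : chartRep n (exactForm n u) x =ᶠ[𝓝 (extChartAt (𝓡 n) x x)] extDeriv (fun w =>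
      ContinuousAlternatingMap.constOfIsEmpty ℝ (EuclideanSpace ℝ (Fin n)) (Fin 0)
        ((u ∘ (extChartAt (𝓡 n) x).symm) w)) := by
    filter_upwards [(isOpen_chartRep_domain x U).mem_nhds hz] with w hw
    exact chartRep_exactForm hw.1 ((hu _ hw.2).mdifferentiableAt (by simp))
  have h3 := extDeriv_extDeriv_apply (contDiffAt_constOfIsEmpty h1) two_le_smooth
  ext v
  change extDeriv (chartRep n (exactForm n u) x) _ _ = 0
  rw [h2.extDeriv_eq, h3]
  rfl

/-- A form can be recovered from its expression in a chart. -/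
theorem eq_chartRep {k : ℕ} (ξ : DiffForm n X k) {x x₀ : X} (hx : x ∈ (extChartAt (𝓡 n) x₀).source) :
    ξ x = (chartRep n ξ x₀ (extChartAt (𝓡 n) x₀ x)).compContinuousLinearMap
      (mfderiv (𝓡 n) 𝓘(ℝ, EuclideanSpace ℝ (Fin n)) (extChartAt (𝓡 n) x₀) x) := by
  have h1 := mfderiv_comp x (I := 𝓡 n) (I' := 𝓘(ℝ, EuclideanSpace ℝ (Fin n))) (I'' := 𝓡 n)
    ((contMDiffAt_chart_symm x₀ ((extChartAt (𝓡 n) x₀).map_source hx)).mdifferentiableAt (by simp))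
    ((contMDiffAt_chart x₀ hx).mdifferentiableAt (by simp))
  have h2 : (extChartAt (𝓡 n) x₀).symm ∘ extChartAt (𝓡 n) x₀ =ᶠ[𝓝 x] id := by
    filter_upwards [(isOpen_extChartAt_source (I := 𝓡 n) x₀).mem_nhds hx] with y hy
    exact (extChartAt (𝓡 n) x₀).left_inv hy
  rw [h2.mfderiv_eq, mfderiv_id] at h1
  let ξ' : X → EuclideanSpace ℝ (Fin n) [⋀^Fin k]→L[ℝ] ℂ := ξ
  ext v
  change ξ' x v = ξ' ((extChartAt (𝓡 n) x₀).symm (extChartAt (𝓡 n) x₀ x)) _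
  rw [(extChartAt (𝓡 n) x₀).left_inv hx]
  congr 1
  funext i
  exact DFunLike.congr_fun h1 (v i)

/-- A function with vanishing differential is locally constant. -/
theorem eventually_eq_of_exactForm_eq_zero {u : X → ℂ} {x : X}
    (h : ∀ᶠ y in 𝓝 x, MDifferentiableAt (𝓡 n) 𝓘(ℝ, ℂ) u y ∧ exactForm n u y = 0) :
    ∀ᶠ y in 𝓝 x, u y = u x := by
  set φ := extChartAt (𝓡 n) x
  have hc := (contMDiffAt_chart_symm (n := n) x (mem_extChartAt_target x)).continuousAt
  rw [ContinuousAt, extChartAt_to_inv (I := 𝓡 n)] at hc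
  obtain ⟨ε, hε, hB⟩ := Metric.mem_nhds_iff.1 (Filter.inter_mem (hc.eventually h)
    ((isOpen_extChartAt_target x).mem_nhds (mem_extChartAt_target (I := 𝓡 n) x)))
  have h0 : ∀ z ∈ Metric.ball (φ x) ε, fderiv ℝ (u ∘ φ.symm) z = 0 := by
    intro z hz
    obtain ⟨⟨h1, h2⟩, h3⟩ := hB hz
    rw [fderiv_comp_chart_symm h3 h1]
    ext w
    exact congrArg (fun a => a ![mfderiv 𝓘(ℝ, EuclideanSpace ℝ (Fin n)) (𝓡 n) φ.symm z w]) h2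
  have hd : DifferentiableOn ℝ (u ∘ φ.symm) (Metric.ball (φ x) ε) := fun z hz =>
    (mdifferentiableAt_iff_differentiableAt.1 ((hB hz).1.1.comp z ((contMDiffAt_chart_symm x
      (hB hz).2).mdifferentiableAt (by simp)))).differentiableWithinAt
  have hcx := (contMDiffAt_chart (n := n) x (mem_extChartAt_source x)).continuousAt
  filter_upwards [hcx.preimage_mem_nhds (Metric.ball_mem_nhds _ hε),
    (isOpen_extChartAt_source (I := 𝓡 n) x).mem_nhds (mem_extChartAt_source x)] with y hy hy'
  have h1 := Metric.isOpen_ball.is_const_of_fderiv_eq_zero (convex_ball _ _).isPreconnected hd h0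
    hy (Metric.mem_ball_self hε)
  simp only [Function.comp_apply] at h1
  rwa [φ.left_inv hy', φ.left_inv (mem_extChartAt_source x)] at h1

/-- The Poincaré lemma for `1`-forms: closed forms are locally exact. -/
theorem exists_exactForm_eq {α : DiffForm n X 1} {U : Opens X} (hs : SmoothOn n α U)
    (hc : ∀ x ∈ U, extD n α x = 0) {x : X} (hx : x ∈ U) :
    ∃ (V : Opens X) (u : X → ℂ), x ∈ V ∧ V ≤ U ∧
      (∀ y ∈ V, ContMDiffAt (𝓡 n) 𝓘(ℝ, ℂ) ∞ u y) ∧ ∀ y ∈ V, exactForm n u y = α y := by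
  set φ := extChartAt (𝓡 n) x
  have hz : φ x ∈ φ.target ∩ φ.symm ⁻¹' U :=
    ⟨mem_extChartAt_target x, by rwa [Set.mem_preimage, extChartAt_to_inv]⟩
  obtain ⟨ε, hε, hB⟩ := Metric.isOpen_iff.1 (isOpen_chartRep_domain x U) _ hz
  set B := Metric.ball (φ x) ε
  set c := chartRep n α x
  have hcs : ContDiffOn ℝ ∞ c B := (hs x).mono hB
  let e := (ContinuousAlternatingMap.ofSubsingletonLIE (𝕜 := ℝ) (E := EuclideanSpace ℝ (Fin n))
    (F := ℂ) (0 : Fin 1)).symm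
  let a : EuclideanSpace ℝ (Fin n) → EuclideanSpace ℝ (Fin n) →L[ℝ] ℂ := fun z => e (c z)
  have has : ContDiffOn ℝ ∞ a B := e.contDiff.comp_contDiffOn hcs
  have ha : ∀ z w, a z w = c z ![w] := by
    intro z w
    have h1 : c z = ContinuousAlternatingMap.ofSubsingletonLIE (0 : Fin 1) (a z) :=
      (LinearIsometryEquiv.apply_symm_apply _ _).symm
    rw [h1]
    rfl
  -- Closedness of a 1-form in coordinates is the symmetry of its derivative, which on a convex set
  -- is the integrability condition for a primitive.
  have hd : ∀ z ∈ B, ∀ v w, fderiv ℝ a z v w = fderiv ℝ a z w v := by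
    intro z hzB v w
    have hcd : DifferentiableAt ℝ c z :=
      (hcs.contDiffAt (Metric.isOpen_ball.mem_nhds hzB)).differentiableAt (by simp)
    have had : DifferentiableAt ℝ a z :=
      (has.contDiffAt (Metric.isOpen_ball.mem_nhds hzB)).differentiableAt (by simp)
    have h1 : extDeriv c z = 0 := by
      rw [extDeriv_chartRep (hB hzB).1 (smoothOn_iff.1 hs _ (hB hzB).2)]
      unfold chartRep
      rw [hc _ (hB hzB).2]
      rfl
    have h2 := extDeriv_apply hcd ![v, w]
    have h3 : ∀ v w, fderiv ℝ a z v w = fderiv ℝ (fun y => c y ![w]) z v := by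
      intro v w
      simp only [← ha]
      rw [fderiv_clm_apply had (differentiableAt_const w)]
      simp
    rw [h1, Fin.sum_univ_two] at h2
    have h4 : (0 : Fin 2).removeNth ![v, w] = ![w] := by
      funext i; fin_cases i; rfl
    have h5 : (1 : Fin 2).removeNth ![v, w] = ![v] := by
      funext i; fin_cases i; rfl
    rw [h4, h5] at h2
    simp only [Fin.val_zero, pow_zero, one_smul, Fin.val_one, pow_one, neg_smul,
      Matrix.cons_val_zero, Matrix.cons_val_one] at h2
    rw [h3, h3]
    exact sub_eq_zero.1 ((sub_eq_add_neg _ _).trans h2.symm)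
  obtain ⟨f, hf⟩ := (convex_ball (φ x) ε).exists_forall_hasFDerivAt_of_fderiv_symmetric
    Metric.isOpen_ball (has.differentiableOn (by simp)) hd
  -- The primitive is smooth because its derivative `a` is.
  have hfs : ContDiffOn ℝ ∞ f B := by
    refine (contDiffOn_infty_iff_fderiv_of_isOpen Metric.isOpen_ball).2
      ⟨fun z hz => (hf z hz).differentiableAt.differentiableWithinAt, ?_⟩
    exact has.congr fun z hz => (hf z hz).fderiv
  have hVo : IsOpen (φ.source ∩ φ ⁻¹' B) :=
    (continuousOn_extChartAt x).isOpen_inter_preimage (isOpen_extChartAt_source x) Metric.isOpen_ball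
  have hsm : ∀ y ∈ φ.source ∩ φ ⁻¹' B, ContMDiffAt (𝓡 n) 𝓘(ℝ, ℂ) ∞ (f ∘ φ) y := by
    intro y hy
    exact ContMDiffAt.comp y ((hfs.contDiffAt (Metric.isOpen_ball.mem_nhds hy.2)).contMDiffAt)
      (contMDiffAt_chart x hy.1)
  refine ⟨⟨φ.source ∩ φ ⁻¹' B, hVo⟩, f ∘ φ, ⟨mem_extChartAt_source x, Metric.mem_ball_self hε⟩, ?_,
    hsm, ?_⟩
  · rintro y ⟨hy, hyB⟩
    have h1 := (hB hyB).2
    rwa [Set.mem_preimage, φ.left_inv hy] at h1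
  · rintro y ⟨hy, hyB⟩
    rw [eq_chartRep α hy, eq_chartRep (exactForm n (f ∘ φ)) hy, chartRep_exactForm (hB hyB).1
      (by rw [φ.left_inv hy]; exact (hsm y ⟨hy, hyB⟩).mdifferentiableAt (by simp)),
      extDeriv_constOfIsEmpty]
    have h2 : (f ∘ φ) ∘ φ.symm =ᶠ[𝓝 (φ y)] f := by
      filter_upwards [(isOpen_extChartAt_target x).mem_nhds (hB hyB).1] with w hw
      exact congrArg f (φ.right_inv hw)
    rw [h2.fderiv_eq, (hf _ hyB).fderiv]
    congr 1
    exact (ContinuousAlternatingMap.ofSubsingletonLIE (𝕜 := ℝ) (E := EuclideanSpace ℝ (Fin n))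
      (F := ℂ) (0 : Fin 1)).apply_symm_apply (c (φ y))

end Exact

/-! ## Logarithms of germs -/

section Germs

variable {n : ℕ} {X : Type} [TopologicalSpace X] [ChartedSpace (EuclideanSpace ℝ (Fin n)) X]

theorem exists_germOf {x : X} (s : Stalk n X x) :
    ∃ (V : Opens X) (g : C^∞⟮𝓡 n, V; 𝓡 1, Circle⟯) (hx : x ∈ V), germOf n g x hx = s := by
  obtain ⟨V, hx, t, ht⟩ := TopCat.Presheaf.exists_germ_eq (phasePresheaf n X) s
  obtain ⟨g, rfl⟩ := QuotientGroup.mk_surjective t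
  exact ⟨V, g, hx, ht⟩

/-- Converse of `germOf_eq`: equal germs come from equal classes on a smaller open set, and equality
of classes there provides the constant. -/
theorem eventually_eq_of_germOf_eq {V V' : Opens X} {g : C^∞⟮𝓡 n, V; 𝓡 1, Circle⟯}
    {g' : C^∞⟮𝓡 n, V'; 𝓡 1, Circle⟯} {x : X} {hx : x ∈ V} {hx' : x ∈ V'}
    (h : germOf n g x hx = germOf n g' x hx') :
    ∃ c : Circle, ∀ᶠ y in 𝓝 x, ∀ (hy : y ∈ V) (hy' : y ∈ V'), g ⟨y, hy⟩ = g' ⟨y, hy'⟩ * c := by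
  obtain ⟨W, hxW, i, i', hW⟩ := TopCat.Presheaf.germ_eq _ _ _ _ _ _ h
  obtain ⟨c, hc⟩ := QuotientGroup.eq.1 hW
  refine ⟨c⁻¹, ?_⟩
  filter_upwards [W.isOpen.mem_nhds hxW] with y hyW hy hy'
  have h1 : (g ⟨y, hy⟩)⁻¹ * g' ⟨y, hy'⟩ = c := hc ⟨y, hyW⟩
  rw [← h1]
  simp

theorem germOf_mul {V : Opens X} (g g' : C^∞⟮𝓡 n, V; 𝓡 1, Circle⟯) (x : X) (hx : x ∈ V) :
    germOf n (g * g') x hx = germOf n g x hx * germOf n g' x hx :=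
  map_mul ((phasePresheaf n X).germ V x hx).hom (classOf n g) (classOf n g')

theorem germOf_inv {V : Opens X} (g : C^∞⟮𝓡 n, V; 𝓡 1, Circle⟯) (x : X) (hx : x ∈ V) :
    germOf n g⁻¹ x hx = (germOf n g x hx)⁻¹ :=
  map_inv ((phasePresheaf n X).germ V x hx).hom (classOf n g)

theorem germOf_restrict {V W : Opens X} (h : W ≤ V) (g : C^∞⟮𝓡 n, V; 𝓡 1, Circle⟯) (x : X)
    (hx : x ∈ W) :
    germOf n (ContMDiffMap.restrictMonoidHom (𝓡 n) (𝓡 1) Circle h g) x hx = germOf n g x (h hx) :=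
  germOf_eq n _ _ x hx (h hx) 1 (.of_forall fun _ _ _ => (mul_one _).symm)

/-- `u` is, up to a constant, a complex logarithm of the germ `s`. -/
def HasLogAt {x : X} (s : Stalk n X x) (u : X → ℂ) : Prop :=
  ∃ (V : Opens X) (g : C^∞⟮𝓡 n, V; 𝓡 1, Circle⟯) (hx : x ∈ V), germOf n g x hx = s ∧
    ∃ c : ℂ, ∀ᶠ y in 𝓝 x, ∀ hy : y ∈ V, (g ⟨y, hy⟩ : ℂ) = c * Complex.exp (u y)

/-- `HasLogAt` does not depend on the representative: two representatives differ by a constant near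
`x`, which is absorbed into `c`. -/
theorem HasLogAt.of_germOf {x : X} {s : Stalk n X x} {u : X → ℂ} (h : HasLogAt s u) {V : Opens X}
    {g : C^∞⟮𝓡 n, V; 𝓡 1, Circle⟯} {hx : x ∈ V} (hg : germOf n g x hx = s) :
    ∃ c : ℂ, ∀ᶠ y in 𝓝 x, ∀ hy : y ∈ V, (g ⟨y, hy⟩ : ℂ) = c * Complex.exp (u y) := by
  obtain ⟨V', g', hx', hs, c, hc⟩ := h
  obtain ⟨d, hd⟩ := eventually_eq_of_germOf_eq (hg.trans hs.symm)
  refine ⟨c * d, ?_⟩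
  filter_upwards [hc, hd, V'.isOpen.mem_nhds hx'] with y h1 h2 h3 hy
  rw [h2 hy h3, Circle.coe_mul, h1 h3]
  ring

theorem HasLogAt.mul {x : X} {s t : Stalk n X x} {u w : X → ℂ} (hs : HasLogAt s u)
    (ht : HasLogAt t w) : HasLogAt (s * t) (u + w) := by
  obtain ⟨V, g, hx, rfl, c, hc⟩ := hs
  obtain ⟨V', g', hx', rfl, c', hc'⟩ := ht
  refine ⟨V ⊓ V', ContMDiffMap.restrictMonoidHom (𝓡 n) (𝓡 1) Circle inf_le_left g *
    ContMDiffMap.restrictMonoidHom (𝓡 n) (𝓡 1) Circle inf_le_right g',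
    show x ∈ V ⊓ V' from ⟨hx, hx'⟩, ?_, c * c', ?_⟩
  · rw [germOf_mul, germOf_restrict, germOf_restrict]
  · filter_upwards [hc, hc'] with y h1 h2 hy
    change ((g ⟨y, hy.1⟩ * g' ⟨y, hy.2⟩ : Circle) : ℂ) = _
    rw [Circle.coe_mul, h1, h2, Pi.add_apply, Complex.exp_add]
    ring

theorem HasLogAt.inv {x : X} {s : Stalk n X x} {u : X → ℂ} (hs : HasLogAt s u) :
    HasLogAt s⁻¹ (-u) := by
  obtain ⟨V, g, hx, rfl, c, hc⟩ := hs
  refine ⟨V, g⁻¹, hx, germOf_inv g x hx, c⁻¹, ?_⟩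
  filter_upwards [hc] with y h1 hy
  change (((g ⟨y, hy⟩)⁻¹ : Circle) : ℂ) = _
  rw [Circle.coe_inv, h1, Pi.neg_apply, Complex.exp_neg, mul_inv]

theorem extend_apply {V : Opens X} (g : C^∞⟮𝓡 n, V; 𝓡 1, Circle⟯) {y : X} (hy : y ∈ V) :
    Function.extend Subtype.val (fun y : V => (g y : ℂ)) 0 y = g ⟨y, hy⟩ :=
  Subtype.val_injective.extend_apply (fun y : V => (g y : ℂ)) 0 ⟨y, hy⟩

theorem contMDiff_coe_circle : ContMDiff (𝓡 1) 𝓘(ℝ, ℂ) ∞ (fun z : Circle => (z : ℂ)) := by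
  have : Fact (Module.finrank ℝ ℂ = 1 + 1) := finrank_real_complex_fact'
  exact contMDiff_coe_sphere

theorem contMDiffAt_extend {V : Opens X} (g : C^∞⟮𝓡 n, V; 𝓡 1, Circle⟯) {y : X} (hy : y ∈ V) :
    ContMDiffAt (𝓡 n) 𝓘(ℝ, ℂ) ∞ (Function.extend Subtype.val (fun y : V => (g y : ℂ)) 0) y := by
  refine (contMDiffAt_subtype_iff (x := (⟨y, hy⟩ : V))).1 ?_
  have h1 : (fun z : V => Function.extend Subtype.val (fun y : V => (g y : ℂ)) 0 (z : X)) =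
      fun z => (g z : ℂ) := funext fun z => extend_apply g z.2
  rw [h1]
  exact (contMDiff_coe_circle.comp g.contMDiff).contMDiffAt

/-- The logarithmic derivative of a representative is the differential of a logarithm. -/
theorem logDer_eq {V : Opens X} {g : C^∞⟮𝓡 n, V; 𝓡 1, Circle⟯} {x : X} (hx : x ∈ V) {u : X → ℂ}
    (hu : MDifferentiableAt (𝓡 n) 𝓘(ℝ, ℂ) u x) {c : ℂ}
    (h : ∀ᶠ y in 𝓝 x, ∀ hy : y ∈ V, (g ⟨y, hy⟩ : ℂ) = c * Complex.exp (u y))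
    (v : TangentSpace (𝓡 n) x) : logDer n g x hx v = exactForm n u x ![v] := by
  have h1 : Function.extend Subtype.val (fun y : V => (g y : ℂ)) 0 =ᶠ[𝓝 x]
      (fun z => c * Complex.exp z) ∘ u := by
    filter_upwards [h, V.isOpen.mem_nhds hx] with y hy hyV
    rw [extend_apply g hyV]
    exact hy hyV
  have h2 : HasFDerivAt (𝕜 := ℝ) (fun z => c * Complex.exp z)
      ((ContinuousLinearMap.toSpanSingleton ℂ (c * Complex.exp (u x))).restrictScalars ℝ) (u x) :=
    ((Complex.hasDerivAt_exp (u x)).const_mul c).hasFDerivAt.restrictScalars ℝ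
  have h3 := (h2.hasMFDerivAt.comp x hu.hasMFDerivAt).mfderiv
  have h4 : (g ⟨x, hx⟩ : ℂ) = c * Complex.exp (u x) := h.self_of_nhds hx
  have h5 : (g ⟨x, hx⟩ : ℂ) ≠ 0 := Circle.coe_ne_zero _
  unfold logDer
  rw [h1.mfderiv_eq, h3]
  let d : ℂ := mfderiv (𝓡 n) 𝓘(ℝ, ℂ) u x v
  change (g ⟨x, hx⟩ : ℂ)⁻¹ * (d * (c * Complex.exp (u x))) = d
  rw [← h4]
  field_simp

/-- A smooth `U(1)`-valued function has a smooth logarithm locally. -/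
theorem exists_log {V : Opens X} (g : C^∞⟮𝓡 n, V; 𝓡 1, Circle⟯) {x : X} (hx : x ∈ V) :
    ∃ (W : Opens X) (u : X → ℂ), x ∈ W ∧ W ≤ V ∧ (∀ y ∈ W, ContMDiffAt (𝓡 n) 𝓘(ℝ, ℂ) ∞ u y) ∧
      ∀ y ∈ W, ∀ hy : y ∈ V, HasLogAt (germOf n g y hy) u := by
  set G := Function.extend Subtype.val (fun y : V => (g y : ℂ)) 0
  have hG : ∀ y ∈ V, ContMDiffAt (𝓡 n) 𝓘(ℝ, ℂ) ∞ G y := fun y hy => contMDiffAt_extend g hy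
  have h0 : ∀ y ∈ V, G y ≠ 0 := fun y hy => by
    rw [show G y = g ⟨y, hy⟩ from extend_apply g hy]; exact Circle.coe_ne_zero _
  -- Dividing by `G x` moves the value at `x` to `1`, so that the principal branch is smooth nearby;
  -- the factor `G x` reappears as the constant in `HasLogAt`.
  have hWo : IsOpen ((V : Set X) ∩ (fun y => G y / G x) ⁻¹' Complex.slitPlane) := by
    refine ContinuousOn.isOpen_inter_preimage (fun y hy => ?_) V.isOpen Complex.isOpen_slitPlane
    exact ((hG y hy).continuousAt.div_const _).continuousWithinAt
  refine ⟨⟨_, hWo⟩, fun y => Complex.log (G y / G x), ⟨hx, ?_⟩, fun y hy => hy.1, ?_, ?_⟩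
  · simp [div_self (h0 x hx), Complex.one_mem_slitPlane]
  · rintro y ⟨hy, hy'⟩
    have h1 : ContDiffAt ℝ ∞ (fun w : ℂ => Complex.log (w / G x)) (G y) :=
      ContDiffAt.comp (g := Complex.log) (G y) ((Complex.contDiffAt_log hy').restrict_scalars ℝ)
        (contDiffAt_id.div_const _)
    exact ContMDiffAt.comp (g := fun w : ℂ => Complex.log (w / G x)) y h1.contMDiffAt (hG y hy)
  · rintro y - hyV
    refine ⟨V, g, hyV, rfl, G x, .of_forall fun z hz => ?_⟩
    rw [Complex.exp_log (div_ne_zero (h0 z hz) (h0 x hx)), mul_div_cancel₀ _ (h0 x hx)]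
    exact (extend_apply g hz).symm

/-- A section of `𝒢` has a smooth logarithm locally. -/
theorem IsSectionOn.exists_log {U : Opens X} {σ : ∀ x, Stalk n X x} (h : IsSectionOn n U σ) {x : X}
    (hx : x ∈ U) :
    ∃ (W : Opens X) (u : X → ℂ), x ∈ W ∧ W ≤ U ∧ (∀ y ∈ W, ContMDiffAt (𝓡 n) 𝓘(ℝ, ℂ) ∞ u y) ∧
      ∀ y ∈ W, HasLogAt (σ y) u := by
  obtain ⟨V, s, hxV, hs⟩ := (isSectionOn_iff n).1 h x hx
  obtain ⟨g, rfl⟩ := QuotientGroup.mk_surjective s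
  obtain ⟨W, u, hxW, hWV, hu, hl⟩ := DiracSheaf.exists_log g hxV
  obtain ⟨N, hN, hNo, hxN⟩ := eventually_nhds_iff.1 hs
  refine ⟨W ⊓ ⟨N, hNo⟩ ⊓ U, u, ⟨⟨hxW, hxN⟩, hx⟩, inf_le_right, fun y hy => hu y hy.1.1, ?_⟩
  rintro y ⟨⟨hyW, hyN⟩, -⟩
  obtain ⟨hyV, hy⟩ := hN y hyN
  rw [hy]
  exact hl y hyW hyV

variable [IsManifold (𝓡 n) ∞ X]

/-- Germs whose logarithms have the same differential are equal. -/
theorem HasLogAt.unique {x : X} {s t : Stalk n X x} {u w : X → ℂ} (hs : HasLogAt s u)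
    (ht : HasLogAt t w)
    (h : ∀ᶠ y in 𝓝 x, MDifferentiableAt (𝓡 n) 𝓘(ℝ, ℂ) u y ∧ MDifferentiableAt (𝓡 n) 𝓘(ℝ, ℂ) w y ∧
      exactForm n u y = exactForm n w y) : s = t := by
  obtain ⟨V, g, hx, rfl, c, hc⟩ := hs
  obtain ⟨V', g', hx', rfl, c', hc'⟩ := ht
  -- The difference of the logarithms is locally constant, so `g / g'` keeps its value at `x`, and
  -- this value is the constant required by `germOf_eq`.
  have h1 := eventually_eq_of_exactForm_eq_zero (u := u + -w) (x := x) (by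
    filter_upwards [h] with y hy
    exact ⟨hy.1.add hy.2.1.neg, by rw [exactForm_add hy.1 hy.2.1.neg, exactForm_neg, hy.2.2]; simp⟩)
  refine germOf_eq n g g' x hx hx' (g ⟨x, hx⟩ * (g' ⟨x, hx'⟩)⁻¹) ?_
  filter_upwards [h1, hc, hc'] with y h2 h3 h4 hy hy'
  refine Circle.ext ?_
  simp only [Circle.coe_mul, Circle.coe_inv]
  have h6 : (g' ⟨x, hx'⟩ : ℂ) ≠ 0 := Circle.coe_ne_zero _
  have h7 : u y = (u x + w y) - w x := by
    simp only [Pi.add_apply, Pi.neg_apply] at h2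
    linear_combination h2
  have h8 := hc'.self_of_nhds hx'
  rw [h8] at h6 ⊢
  rw [h3, h4, hc.self_of_nhds hx, h7, Complex.exp_sub, Complex.exp_add]
  -- `HasLogAt` does not ask for a nonzero constant; here it cannot vanish because `g'` takes values
  -- in the circle.
  have h9 : c' ≠ 0 := left_ne_zero_of_mul h6
  field_simp [Complex.exp_ne_zero]

theorem HasLogAt.logDer_eq {x : X} {s : Stalk n X x} {u : X → ℂ} (hs : HasLogAt s u)
    (hu : MDifferentiableAt (𝓡 n) 𝓘(ℝ, ℂ) u x) {V : Opens X}
    {g : C^∞⟮𝓡 n, V; 𝓡 1, Circle⟯} {hx : x ∈ V} (hg : germOf n g x hx = s)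
    (v : TangentSpace (𝓡 n) x) : logDer n g x hx v = exactForm n u x ![v] :=
  (hs.of_germOf hg).elim fun _ hc => DiracSheaf.logDer_eq hx hu hc v

/-- Every germ has a logarithm. -/
theorem exists_hasLogAt {x : X} (s : Stalk n X x) :
    ∃ u : X → ℂ, ContMDiffAt (𝓡 n) 𝓘(ℝ, ℂ) ∞ u x ∧ HasLogAt s u := by
  obtain ⟨V, g, hx, rfl⟩ := exists_germOf s
  obtain ⟨W, u, hxW, hWV, hu, hl⟩ := exists_log g hx
  exact ⟨u, hu x hxW, hl x hxW hx⟩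

end Germs

/-! ## Connections and their curvature -/

section ConnectionTheory

variable {n m : ℕ} {X Y : Type} [TopologicalSpace X] [ChartedSpace (EuclideanSpace ℝ (Fin n)) X]
  [IsManifold (𝓡 n) ∞ X]
  [TopologicalSpace Y] [ChartedSpace (EuclideanSpace ℝ (Fin m)) Y] [IsManifold (𝓡 m) ∞ Y]

/-- Both differentials are the logarithmic derivative of one and the same representative. -/
theorem HasLogAt.exactForm_eq {x : X} {s : Stalk n X x} {u w : X → ℂ} (hu : HasLogAt s u)
    (hw : HasLogAt s w) (hu' : MDifferentiableAt (𝓡 n) 𝓘(ℝ, ℂ) u x)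
    (hw' : MDifferentiableAt (𝓡 n) 𝓘(ℝ, ℂ) w x) : exactForm n u x = exactForm n w x := by
  obtain ⟨V, g, hx, hg⟩ := exists_germOf s
  exact oneForm_ext fun v => (hu.logDer_eq hu' hg v).symm.trans (hw.logDer_eq hw' hg v)

/-- The gauge law in additive form: `g d(g⁻¹) = -du` for a logarithm `u` of `g`. The later arguments
use it in place of `gauge`. -/
theorem IsConnection.eq_sub_exactForm {P : Presentation n X} {A : P.ι → DiffForm n X 1}
    (h : IsConnection P A) {i j : P.ι} {x : X} (hx : x ∈ P.cover i ⊓ P.cover j) {u : X → ℂ}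
    (hu : MDifferentiableAt (𝓡 n) 𝓘(ℝ, ℂ) u x) (hl : HasLogAt (P.g i j x) u) :
    A i x = A j x - exactForm n u x := by
  obtain ⟨V, g, hxV, hg⟩ := exists_germOf (P.g i j x)
  refine oneForm_ext fun v => ?_
  rw [h.gauge i j x hx V g hxV hg v,
    hl.inv.logDer_eq hu.neg ((germOf_inv g x hxV).trans (congrArg _ hg)), exactForm_neg]
  exact (sub_eq_add_neg _ _).symm

/-- The potentials differ locally by some `du`, which is closed. -/
theorem IsConnection.curvature_eq {P : Presentation n X} {A : P.ι → DiffForm n X 1}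
    (h : IsConnection P A) {i j : P.ι} {x : X} (hx : x ∈ P.cover i ⊓ P.cover j) :
    curvature A i x = curvature A j x := by
  obtain ⟨W, u, hxW, hWU, hu, hl⟩ := (P.isSection i j).exists_log hx
  have h1 : extD n (A i) x = extD n (A j - exactForm n u) x := by
    refine extD_congr ?_
    filter_upwards [W.isOpen.mem_nhds hxW] with y hy
    exact h.eq_sub_exactForm (hWU hy) ((hu y hy).mdifferentiableAt (by simp)) (hl y hy)
  rw [curvature, curvature, h1, extD_sub (smoothOn_iff.1 (h.smooth j) x hx.2)
    (smoothOn_iff.1 (smoothOn_exactForm hu) x hxW), extD_exactForm hu hxW, sub_zero]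

theorem exactForm_clm_comp (L : ℂ →L[ℝ] ℂ) {u : X → ℂ} {x : X}
    (hu : MDifferentiableAt (𝓡 n) 𝓘(ℝ, ℂ) u x) (v : TangentSpace (𝓡 n) x) :
    exactForm n (fun y => L (u y)) x ![v] = L (exactForm n u x ![v]) :=
  DFunLike.congr_fun (L.hasFDerivAt.hasMFDerivAt.comp x hu.hasMFDerivAt).mfderiv v

/-- A closed imaginary `1`-form is locally the logarithmic derivative of a smooth `U(1)`-valued
function. -/
theorem exists_circle_primitive {α : DiffForm n X 1} {U : Opens X} (hs : SmoothOn n α U)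
    (hc : ∀ x ∈ U, extD n α x = 0) (hi : ∀ x ∈ U, ∀ v, (α x v).re = 0) {x : X} (hx : x ∈ U) :
    ∃ (V : Opens X) (u : X → ℂ) (g : C^∞⟮𝓡 n, V; 𝓡 1, Circle⟯), x ∈ V ∧ V ≤ U ∧
      (∀ y ∈ V, ContMDiffAt (𝓡 n) 𝓘(ℝ, ℂ) ∞ u y) ∧ (∀ y ∈ V, exactForm n u y = α y) ∧
      ∀ (y : X) (hy : y ∈ V), HasLogAt (germOf n g y hy) u := by
  obtain ⟨V, w, hxV, hVU, hw, hα⟩ := exists_exactForm_eq hs hc hx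
  -- `L z = i Im z`. Since `α` is imaginary, replacing the primitive `w` by `L w` leaves its
  -- differential unchanged, and `exp (L w)` has modulus one.
  let L : ℂ →L[ℝ] ℂ := (ContinuousLinearMap.toSpanSingleton ℝ Complex.I).comp Complex.imCLM
  have hL : ∀ z, L z = z.im * Complex.I := fun z => by simp [L]
  have ht : ContMDiff (𝓡 n) 𝓘(ℝ, ℝ) ∞ (fun y : V => (w y).im) := fun y =>
    Complex.imCLM.contDiff.contMDiff.contMDiffAt.comp y (contMDiffAt_subtype_iff.2 (hw y y.2))
  refine ⟨V, fun y => L (w y), ⟨fun y => Circle.exp (w y).im, contMDiff_circleExp.comp ht⟩, hxV, hVU,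
    fun y hy => ?_, fun y hy => ?_, fun y hy => ?_⟩
  · exact L.contDiff.contMDiff.contMDiffAt.comp y (hw y hy)
  · refine oneForm_ext fun v => ?_
    rw [exactForm_clm_comp L ((hw y hy).mdifferentiableAt (by simp)), hα y hy, hL]
    have h1 := hi y (hVU hy) ![v]
    exact Complex.ext (by simp [h1]) (by simp)
  · refine ⟨V, _, hy, rfl, 1, .of_forall fun z hz => ?_⟩
    change ((Circle.exp (w z).im : Circle) : ℂ) = 1 * Complex.exp (L (w z))
    rw [hL, one_mul]
    exact Circle.coe_exp _

/-- A closed imaginary `1`-form on `U` is the logarithmic derivative of a section of `𝒢`. -/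
theorem exists_section_primitive {α : DiffForm n X 1} {U : Opens X} (hs : SmoothOn n α U)
    (hc : ∀ x ∈ U, extD n α x = 0) (hi : ∀ x ∈ U, ∀ v, (α x v).re = 0) :
    ∃ σ : ∀ x, Stalk n X x, IsSectionOn n U σ ∧
      ∀ x ∈ U, ∀ u : X → ℂ, MDifferentiableAt (𝓡 n) 𝓘(ℝ, ℂ) u x → HasLogAt (σ x) u →
        exactForm n u x = α x := by
  classical
  choose! V u g hxV hVU hu hα hl using fun x hx => exists_circle_primitive hs hc hi (x := x) hx
  -- The phases chosen at different points have the same logarithmic derivative `α`, hence the same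
  -- germs modulo constants. This is why local primitives glue to a section of 𝒢 even if `α` has
  -- periods.
  have hσ : ∀ x (hx : x ∈ U) y (hy : y ∈ V x), germOf n (g y) y (hxV y (hVU x hx hy)) =
      germOf n (g x) y hy := by
    intro x hx y hy
    have hyU := hVU x hx hy
    refine (hl y hyU y (hxV y hyU)).unique (hl x hx y hy) ?_
    filter_upwards [(V x).isOpen.mem_nhds hy, (V y).isOpen.mem_nhds (hxV y hyU)] with z hz hz'
    exact ⟨(hu y hyU z hz').mdifferentiableAt (by simp), (hu x hx z hz).mdifferentiableAt (by simp),
      (hα y hyU z hz').trans (hα x hx z hz).symm⟩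
  refine ⟨fun x => if hx : x ∈ U then germOf n (g x) x (hxV x hx) else 1, ?_, ?_⟩
  · refine (isSectionOn_iff n).2 fun x hx => ⟨V x, classOf n (g x), hxV x hx, ?_⟩
    filter_upwards [(V x).isOpen.mem_nhds (hxV x hx)] with y hy
    refine ⟨hy, ?_⟩
    rw [dif_pos (hVU x hx hy)]
    exact hσ x hx y hy
  · intro x hx w hw hlw
    simp only [dif_pos hx] at hlw
    rw [hlw.exactForm_eq (hl x hx x (hxV x hx)) hw
      ((hu x hx x (hxV x hx)).mdifferentiableAt (by simp)), hα x hx x (hxV x hx)]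

/-- A `U(1)_{U(1)}`-connection is determined up to equivalence by its curvature. -/
theorem connectionEquivalent_of_curvature_eq {P P' : Presentation n X} {A : P.ι → DiffForm n X 1}
    {A' : P'.ι → DiffForm n X 1} (h : IsConnection P A) (h' : IsConnection P' A')
    (hF : ∀ i j, ∀ x ∈ P.cover i ⊓ P'.cover j, curvature A i x = curvature A' j x) :
    ConnectionEquivalent P A P' A' := by
  -- On each intersection the required `s_k` is a section of 𝒢 with logarithmic derivative `A'_k -
  -- A_k`.
  let W : P.ι × P'.ι → Opens X := fun k => P.cover k.1 ⊓ P'.cover k.2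
  have hs : ∀ k, SmoothOn n (A' k.2 - A k.1) (W k) := fun k =>
    smoothOn_iff.2 fun x hx => (smoothOn_iff.1 (h'.smooth k.2) x hx.2).sub
      (smoothOn_iff.1 (h.smooth k.1) x hx.1)
  have hc : ∀ k, ∀ x ∈ W k, extD n (A' k.2 - A k.1) x = 0 := fun k x hx => by
    rw [extD_sub (smoothOn_iff.1 (h'.smooth k.2) x hx.2) (smoothOn_iff.1 (h.smooth k.1) x hx.1)]
    exact sub_eq_zero.2 (hF k.1 k.2 x hx).symm
  have hi : ∀ k, ∀ x ∈ W k, ∀ v, ((A' k.2 - A k.1) x v).re = 0 := fun k x hx v => by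
    have h1 := h'.imaginary k.2 x hx.2 v
    have h2 := h.imaginary k.1 x hx.1 v
    change (A' k.2 x v - A k.1 x v).re = 0
    rw [Complex.sub_re, h1, h2, sub_zero]
  choose s hs1 hs2 using fun k => exists_section_primitive (hs k) (hc k) (hi k)
  let r : CommonRefinement P.cover P'.cover :=
    { κ := P.ι × P'.ι
      W := W
      covers := fun x => by
        obtain ⟨i, hi⟩ := P.covers x
        obtain ⟨j, hj⟩ := P'.covers x
        exact ⟨(i, j), hi, hj⟩
      left := Prod.fst
      right := Prod.snd
      le_left := fun _ => inf_le_left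
      le_right := fun _ => inf_le_right }
  refine ⟨r, s, hs1, ?_, ?_⟩
  · intro k l x hx
    obtain ⟨Wa, ua, hxa, ha1, ha2, ha3⟩ := (hs1 k).exists_log hx.1
    obtain ⟨Wb, ub, hxb, hb1, hb2, hb3⟩ := (P.isSection k.1 l.1).exists_log ⟨hx.1.1, hx.2.1⟩
    obtain ⟨Wc, uc, hxc, hc1, hc2, hc3⟩ := (hs1 l).exists_log hx.2
    obtain ⟨Wd, ud, hxd, hd1, hd2, hd3⟩ := (P'.isSection k.2 l.2).exists_log ⟨hx.1.2, hx.2.2⟩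
    -- Both sides of the transition law have logarithmic derivative `A'_l - A'_k`, since `-(A'_k -
    -- A_k) + (A_l - A_k) + (A'_l - A_l) = A'_l - A'_k`.
    refine (hd3 x hxd).unique (((ha3 x hxa).inv.mul (hb3 x hxb)).mul (hc3 x hxc)) ?_
    filter_upwards [Wa.isOpen.mem_nhds hxa, Wb.isOpen.mem_nhds hxb, Wc.isOpen.mem_nhds hxc,
      Wd.isOpen.mem_nhds hxd] with y hya hyb hyc hyd
    have da := (ha2 y hya).mdifferentiableAt (n := ∞) (by simp)
    have db := (hb2 y hyb).mdifferentiableAt (n := ∞) (by simp)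
    have dc := (hc2 y hyc).mdifferentiableAt (n := ∞) (by simp)
    have dd := (hd2 y hyd).mdifferentiableAt (n := ∞) (by simp)
    refine ⟨dd, (da.neg.add db).add dc, ?_⟩
    rw [exactForm_add (da.neg.add db) dc, exactForm_add da.neg db, exactForm_neg,
      hs2 k y (ha1 hya) ua da (ha3 y hya), hs2 l y (hc1 hyc) uc dc (hc3 y hyc)]
    have e1 := h.eq_sub_exactForm (hb1 hyb) db (hb3 y hyb)
    have e2 := h'.eq_sub_exactForm (hd1 hyd) dd (hd3 y hyd)
    rw [Pi.sub_apply, Pi.sub_apply, e1, e2]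
    abel
  · intro k x hx V g hxV hg v
    obtain ⟨u, hu, hl⟩ := exists_hasLogAt (s k x)
    rw [hl.logDer_eq (hu.mdifferentiableAt (by simp)) hg,
      hs2 k x hx u (hu.mdifferentiableAt (by simp)) hl]
    exact (add_sub_cancel _ _).symm

theorem HasLogAt.pullStalk {f : X → Y} (hf : ContMDiff (𝓡 n) (𝓡 m) ∞ f) {x : X}
    {s : Stalk m Y (f x)} {u : Y → ℂ} (h : HasLogAt s u) :
    HasLogAt (DiracSheaf.pullStalk hf x s) (u ∘ f) := by
  obtain ⟨V, g, hx, rfl, c, hc⟩ := h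
  refine ⟨preOpen hf V, compSection hf V g, hx,
    (pullStalk_germ hf x V hx (classOf m g)).symm, c, ?_⟩
  filter_upwards [hf.continuous.continuousAt.eventually hc] with y hy hyV
  exact hy hyV

theorem exactForm_comp {f : X → Y} (hf : ContMDiff (𝓡 n) (𝓡 m) ∞ f) {x : X} {u : Y → ℂ}
    (hu : MDifferentiableAt (𝓡 m) 𝓘(ℝ, ℂ) u (f x)) :
    exactForm n (u ∘ f) x = pullForm n f (exactForm m u) x :=
  oneForm_ext fun v =>
    DFunLike.congr_fun (mfderiv_comp x hu (hf.mdifferentiableAt (by simp))) v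

/-- If `u` is a logarithm of `g_ij` at `f x`, then `u ∘ f` is one of the pulled-back germ at `x`,
and `d(u ∘ f) = f^* du`. -/
theorem IsConnection.pullback {f : X → Y} (hf : ContMDiff (𝓡 n) (𝓡 m) ∞ f)
    {P : Presentation m Y} {A : P.ι → DiffForm m Y 1} (h : IsConnection P A) :
    IsConnection (P.pullback hf) (fun i => pullForm n f (A i)) where
  smooth i := smoothOn_iff.2 fun x hx => (smoothOn_iff.1 (h.smooth i) (f x) hx).pullForm hf
  imaginary i x hx v := h.imaginary i (f x) hx _
  gauge i j x hx V g hxV hg v := by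
    obtain ⟨u, hu, hl⟩ := exists_hasLogAt (P.g i j (f x))
    have hu' := hu.mdifferentiableAt (by simp)
    have hl' := hl.pullStalk hf
    have huf := hu'.comp x (hf.mdifferentiableAt (by simp) (x := x))
    rw [hl'.inv.logDer_eq huf.neg ((germOf_inv g x hxV).trans (congrArg _ hg)), exactForm_neg,
      exactForm_comp hf hu']
    have e : pullForm n f (A i) x = pullForm n f (A j) x - pullForm n f (exactForm m u) x :=
      congrArg (fun a => a.compContinuousLinearMap (mfderiv (𝓡 n) (𝓡 m) f x))
        (h.eq_sub_exactForm hx hu' hl)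
    rw [e]
    exact sub_eq_add_neg _ _

theorem curvature_pullForm {f : X → Y} (hf : ContMDiff (𝓡 n) (𝓡 m) ∞ f)
    {P : Presentation m Y} {A : P.ι → DiffForm m Y 1} (h : IsConnection P A) {i : P.ι} {x : X}
    (hx : f x ∈ P.cover i) :
    curvature (fun i => pullForm n f (A i)) i x = pullForm n f (curvature A i) x :=
  extD_pullForm hf (smoothOn_iff.1 (h.smooth i) (f x) hx)

end ConnectionTheory

/-! ## The first Chern class -/

section Chern

variable {n : ℕ} {X : Type} [TopologicalSpace X] [ChartedSpace (EuclideanSpace ℝ (Fin n)) X]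
  [IsManifold (𝓡 n) ∞ X]

theorem SheafBundle.Equivalent.refl (B : SheafBundle n X) : B.Equivalent B := by
  refine ⟨⟨B.ι, B.cover, B.covers, id, id, fun _ => le_rfl, fun _ => le_rfl⟩, fun _ _ f => f, fun k => ?_,
    fun _ _ _ _ _ => rfl⟩
  have h := isSheafIsoOn_mul (n := n) (isSectionOn_one n (U := B.cover k))
  simpa only [mul_one] using h

/-- By equivariance `T f = f * T 1`, so the section `T 1` carries all the information of the
isomorphism. -/
theorem IsSheafIsoOn.isSectionOn {U : Opens X} {T : ∀ x, Stalk n X x → Stalk n X x}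
    (h : IsSheafIsoOn n U T) : IsSectionOn n U (fun x => T x 1) :=
  ContinuousOn.comp (f := fun x => (⟨x, 1⟩ : Etale n X)) h.continuous (isSectionOn_one n)
    fun _ hx => hx

/-- Locally `c = q dA_i`, so `dc = 0` is `d² = 0`. -/
theorem isClosedForm_of_curvature {P : Presentation n X} {A : P.ι → DiffForm n X 1}
    (h : IsConnection P A) {q : ℂ} {c : DiffForm n X 2}
    (hc : ∀ i, ∀ x ∈ P.cover i, c x = q • curvature A i x) : IsClosedForm n c := by
  have h1 : ∀ i, ∀ x ∈ P.cover i, ∀ᶠ y in 𝓝 x, (q • extD n (A i)) y = c y := fun i x hx => by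
    filter_upwards [(P.cover i).isOpen.mem_nhds hx] with y hy
    exact (hc i y hy).symm
  refine ⟨smoothOn_iff.2 fun x _ => ?_, funext fun x => ?_⟩
  · obtain ⟨i, hi⟩ := P.covers x
    exact ((smoothOn_iff.1 (h.smooth i).extD x hi).const_smul q).congr (h1 i x hi)
  · obtain ⟨i, hi⟩ := P.covers x
    rw [← extD_congr (h1 i x hi), extD_const_smul q (smoothOn_iff.1 (h.smooth i).extD x hi),
      extD_extD (h.smooth i) hi]
    exact smul_zero (A := TangentSpace (𝓡 n) x [⋀^Fin 3]→L[ℝ] ℂ) q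

/-- Connections on equivalent bundles differ by a global `1`-form, up to closed local forms. -/
theorem exists_difference_form {P P' : Presentation n X} {A : P.ι → DiffForm n X 1}
    {A' : P'.ι → DiffForm n X 1} (h : IsConnection P A) (h' : IsConnection P' A')
    (e : P'.toBundle.Equivalent P.toBundle) :
    ∃ η : DiffForm n X 1, SmoothOn n η ⊤ ∧
      ∀ i j, ∀ x ∈ P'.cover i ⊓ P.cover j, extD n η x = curvature A' i x - curvature A j x := by
  obtain ⟨r, S, hS, hT⟩ := e
  have hsec : ∀ k, IsSectionOn n (r.W k) (fun x => S k x 1) := fun k => (hS k).isSectionOn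
  have hrel : ∀ k l, ∀ x ∈ r.W k ⊓ r.W l,
      P'.g (r.left k) (r.left l) x * S k x 1 = S l x 1 * P.g (r.right k) (r.right l) x := by
    intro k l x hx
    have h1 : S k x (1 * P'.g (r.left k) (r.left l) x) = S l x 1 * P.g (r.right k) (r.right l) x :=
      hT k l x hx 1
    rw [← h1, one_mul, ← (hS k).equivariant x hx.1, mul_one]
  -- At every point an index and a logarithm are chosen arbitrarily. The form `η = A' - A - d log s`
  -- does not depend on these choices (`hη`) and is therefore smooth.
  choose k hk using r.covers
  choose u hu hl using fun x => exists_hasLogAt (S (k x) x 1)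
  let η : DiffForm n X 1 := fun x =>
    A' (r.left (k x)) x - A (r.right (k x)) x - exactForm n (u x) x
  have hη : ∀ l, ∀ x ∈ r.W l, ∀ w : X → ℂ, MDifferentiableAt (𝓡 n) 𝓘(ℝ, ℂ) w x →
      HasLogAt (S l x 1) w →
        η x = A' (r.left l) x - A (r.right l) x - exactForm n w x := by
    intro l x hx w hw hlw
    have hmem := hk x
    obtain ⟨a, ha, hla⟩ := exists_hasLogAt (P'.g (r.left (k x)) (r.left l) x)
    obtain ⟨b, hb, hlb⟩ := exists_hasLogAt (P.g (r.right (k x)) (r.right l) x)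
    have da := ha.mdifferentiableAt (n := ∞) (by simp)
    have db := hb.mdifferentiableAt (n := ∞) (by simp)
    have du := (hu x).mdifferentiableAt (n := ∞) (by simp)
    have e1 := hla.mul (hl x)
    rw [hrel (k x) l x ⟨hmem, hx⟩] at e1
    have e2 := e1.exactForm_eq (hlw.mul hlb) (da.add du) (hw.add db)
    rw [exactForm_add da du, exactForm_add hw db] at e2
    have e3 := h'.eq_sub_exactForm ⟨r.le_left _ hmem, r.le_left _ hx⟩ da hla
    have e4 := h.eq_sub_exactForm ⟨r.le_right _ hmem, r.le_right _ hx⟩ db hlb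
    change A' (r.left (k x)) x - A (r.right (k x)) x - exactForm n (u x) x = _
    rw [e3, e4]
    -- This is the intertwining relation `hrel` after taking logarithmic derivatives; it compensates
    -- the change of `A'` and `A` under a change of index.
    have e5 : exactForm n a x = exactForm n w x + exactForm n b x - exactForm n (u x) x :=
      eq_sub_of_add_eq e2
    rw [e5]
    abel
  have hloc : ∀ x, ∃ (W : Opens X) (w : X → ℂ), x ∈ W ∧ W ≤ r.W (k x) ∧
      (∀ y ∈ W, ContMDiffAt (𝓡 n) 𝓘(ℝ, ℂ) ∞ w y) ∧
      ∀ᶠ y in 𝓝 x, (A' (r.left (k x)) - A (r.right (k x)) - exactForm n w) y = η y := by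
    intro x
    obtain ⟨W, w, hxW, hW, hw, hlw⟩ := (hsec (k x)).exists_log (hk x)
    refine ⟨W, w, hxW, hW, hw, ?_⟩
    filter_upwards [W.isOpen.mem_nhds hxW] with y hy
    exact (hη (k x) y (hW hy) w ((hw y hy).mdifferentiableAt (by simp)) (hlw y hy)).symm
  have hA' : ∀ x, SmoothAt (A' (r.left (k x))) x := fun x =>
    smoothOn_iff.1 (h'.smooth _) x (r.le_left _ (hk x))
  have hA : ∀ x, SmoothAt (A (r.right (k x))) x := fun x =>
    smoothOn_iff.1 (h.smooth _) x (r.le_right _ (hk x))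
  refine ⟨η, smoothOn_iff.2 fun x _ => ?_, fun i j x hx => ?_⟩
  · obtain ⟨W, w, hxW, hW, hw, hev⟩ := hloc x
    exact (((hA' x).sub (hA x)).sub (smoothOn_iff.1 (smoothOn_exactForm hw) x hxW)).congr hev
  · obtain ⟨W, w, hxW, hW, hw, hev⟩ := hloc x
    rw [← extD_congr hev, extD_sub ((hA' x).sub (hA x))
      (smoothOn_iff.1 (smoothOn_exactForm hw) x hxW), extD_sub (hA' x) (hA x), extD_exactForm hw hxW,
      sub_zero]
    exact congrArg₂ _ (h'.curvature_eq ⟨r.le_left _ (hk x), hx.1⟩)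
      (h.curvature_eq ⟨r.le_right _ (hk x), hx.2⟩)

/-- The curvature of a connection represents the first Chern class. -/
theorem representsFirstChernClass_of_curvature {P : Presentation n X} {A : P.ι → DiffForm n X 1}
    (h : IsConnection P A) {c : DiffForm n X 2}
    (hc : ∀ i, ∀ x ∈ P.cover i, c x = (Complex.I / (2 * Real.pi)) • curvature A i x) :
    RepresentsFirstChernClass P.toBundle c := by
  have hcl := isClosedForm_of_curvature h hc
  refine ⟨hcl, ⟨P, A, SheafBundle.Equivalent.refl _, h⟩, fun P' A' e h' => ?_⟩
  obtain ⟨η, hη, hd⟩ := exists_difference_form h h' e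
  set q : ℂ := Complex.I / (2 * Real.pi)
  have hqη : SmoothOn n (q • η) ⊤ :=
    smoothOn_iff.2 fun x hx => (smoothOn_iff.1 hη x hx).const_smul q
  -- The global form that the local curvatures of `A'` make up is `c` plus an exact form, since `dη
  -- = F' - F`.
  have hval : ∀ i, ∀ x ∈ P'.cover i, (c + extD n (q • η)) x = q • curvature A' i x := by
    intro i x hx
    obtain ⟨j, hj⟩ := P.covers x
    rw [Pi.add_apply, extD_const_smul q (smoothOn_iff.1 hη x trivial), hd i j x ⟨hx, hj⟩, hc j x hj,
      smul_sub, add_sub_cancel]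
  exact ⟨c + extD n (q • η), isClosedForm_of_curvature h' hval, hval, q • η, hqη,
    add_sub_cancel_left _ _⟩

end Chern

/-! ## The monopole potential on `ℝ³` -/

section Monopole

/-- The `i`-th coordinate on `ℝ³`. -/
abbrev coord (i : Fin 3) : E3 →L[ℝ] ℝ := EuclideanSpace.proj i

theorem coord_apply (i : Fin 3) (w : E3) : coord i w = w i := rfl

theorem hasFDerivAt_coord (i : Fin 3) (v : E3) : HasFDerivAt (fun y : E3 => y i) (coord i) v :=
  (coord i).hasFDerivAt

theorem hasFDerivAt_norm_E3 {v : E3} (hv : v ≠ 0) :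
    HasFDerivAt (fun y : E3 => ‖y‖)
      (‖v‖⁻¹ • (v 0 • coord 0 + v 1 • coord 1 + v 2 • coord 2)) v := by
  have h1 : (fun y : E3 => ‖y‖) = fun y => √(y 0 * y 0 + y 1 * y 1 + y 2 * y 2) := by
    funext y
    rw [← Real.sqrt_sq (norm_nonneg y), norm_sq_E3]
    ring_nf
  have h2 := (((hasFDerivAt_coord 0 v).mul (hasFDerivAt_coord 0 v)).add
    ((hasFDerivAt_coord 1 v).mul (hasFDerivAt_coord 1 v))).add
    ((hasFDerivAt_coord 2 v).mul (hasFDerivAt_coord 2 v))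
  have h3 : v 0 * v 0 + v 1 * v 1 + v 2 * v 2 = ‖v‖ ^ 2 := by rw [norm_sq_E3]; ring
  have h4 : v 0 * v 0 + v 1 * v 1 + v 2 * v 2 ≠ 0 := by
    rw [h3]; exact pow_ne_zero 2 (norm_ne_zero_iff.2 hv)
  have h5 := HasFDerivAt.sqrt h2 h4
  rw [h1]
  refine h5.congr_fderiv (DFunLike.ext _ _ fun w => ?_)
  have h6 : √(v 0 * v 0 + v 1 * v 1 + v 2 * v 2) = ‖v‖ := by rw [h3, Real.sqrt_sq (norm_nonneg v)]
  simp [h6]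
  ring

theorem cos_colatitude {v : E3} (hv : v ≠ 0) : Real.cos (colatitude v) = v 2 / ‖v‖ := by
  have h1 : 0 < ‖v‖ := norm_pos_iff.2 hv
  have h2 : |v 2| ≤ ‖v‖ := abs_le_of_sq_le_sq (by rw [norm_sq_E3]; nlinarith [sq_nonneg (v 0), sq_nonneg (v 1)]) h1.le
  have h3 := abs_le.1 h2
  refine Real.cos_arccos ?_ ?_
  · rw [le_div_iff₀ h1]; linarith
  · rw [div_le_one h1]; exact h3.2

theorem OffAxis.sq_pos {v : E3} (h : OffAxis v) : 0 < v 0 ^ 2 + v 1 ^ 2 := by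
  rcases h with h | h
  · have := sq_pos_of_ne_zero h; positivity
  · have := sq_pos_of_ne_zero h; positivity

/-- The azimuth is the imaginary part of `log (horizontal w / horizontal v)`. At `w = v` the
argument of the logarithm is `1`, away from the branch cut. -/
theorem hasFDerivAt_azimuthFrom {v : E3} (h : OffAxis v) :
    HasFDerivAt (azimuthFrom v)
      ((v 0 ^ 2 + v 1 ^ 2)⁻¹ • (v 0 • coord 1 - v 1 • coord 0)) v := by
  have h0 := horizontal_ne_zero h
  let H : E3 →L[ℝ] ℂ := Complex.ofRealCLM ∘L coord 0 +
    (ContinuousLinearMap.toSpanSingleton ℝ Complex.I) ∘L coord 1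
  have hH : ∀ w, H w = horizontal w := fun w => by simp [H, horizontal]
  have h1 : HasFDerivAt horizontal H v := by
    have : horizontal = H := funext fun w => (hH w).symm
    rw [this]
    exact H.hasFDerivAt
  have h2 : HasFDerivAt (fun w => horizontal w * (horizontal v)⁻¹) ((horizontal v)⁻¹ • H) v :=
    h1.mul_const _
  have h3 : HasFDerivAt Complex.log
      ((ContinuousLinearMap.toSpanSingleton ℂ (1 : ℂ)⁻¹).restrictScalars ℝ)
      (horizontal v * (horizontal v)⁻¹) := by
    rw [mul_inv_cancel₀ h0]
    exact (Complex.hasDerivAt_log Complex.one_mem_slitPlane).hasFDerivAt.restrictScalars ℝ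
  have h4 := Complex.imCLM.hasFDerivAt.comp v (h3.comp v h2)
  have h5 : azimuthFrom v = Complex.imCLM ∘ Complex.log ∘
      fun w => horizontal w * (horizontal v)⁻¹ := by
    funext w
    simp [azimuthFrom, Complex.log_im, div_eq_mul_inv]
  rw [h5]
  refine h4.congr_fderiv (DFunLike.ext _ _ fun w => ?_)
  have h6 : Complex.normSq (horizontal v) = v 0 ^ 2 + v 1 ^ 2 := by
    simp [horizontal, Complex.normSq_apply]; ring
  have h7 : (horizontal v).re = v 0 := by simp [horizontal]
  have h8 : (horizontal v).im = v 1 := by simp [horizontal]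
  have h9 := h.sq_pos.ne'
  simp [hH, Complex.inv_re, Complex.inv_im, h6, h7, h8]
  simp [horizontal]
  field_simp
  ring

theorem dPhi_apply {v : E3} (h : OffAxis v) (w : E3) :
    dPhi v w = (v 0 * w 1 - v 1 * w 0) / (v 0 ^ 2 + v 1 ^ 2) := by
  rw [dPhi, (hasFDerivAt_azimuthFrom h).fderiv]
  simp
  ring

theorem dPhi_of_not_offAxis {v : E3} (h : ¬ OffAxis v) : dPhi v = 0 := by
  have h1 : azimuthFrom v = fun _ => 0 := funext fun w => azimuthFrom_eq_zero h w
  rw [dPhi, h1]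
  exact fderiv_const_apply _

theorem areaAt_apply (v w w' : E3) : areaAt v ![w, w'] =
    (((‖v‖ ^ 3)⁻¹ * (v 0 * (w 1 * w' 2 - w 2 * w' 1) - v 1 * (w 0 * w' 2 - w 2 * w' 0) +
      v 2 * (w 0 * w' 1 - w 1 * w' 0)) : ℝ) : ℂ) := by
  change (((‖v‖ ^ 3)⁻¹ * volForm (Matrix.vecCons v ![w, w']) : ℝ) : ℂ) = _
  rw [volForm_apply, Matrix.det_fin_three]
  change (((‖v‖ ^ 3)⁻¹ * (v 0 * w 1 * w' 2 - v 0 * w 2 * w' 1 - v 1 * w 0 * w' 2 +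
    v 1 * w 2 * w' 0 + v 2 * w 0 * w' 1 - v 2 * w 1 * w' 0) : ℝ) : ℂ) = _
  congr 1
  ring

theorem hasFDerivAt_cos_colatitude {v : E3} (hv : v ≠ 0) :
    HasFDerivAt (fun y : E3 => y 2 * ‖y‖⁻¹)
      (‖v‖⁻¹ • coord 2 - (v 2 / ‖v‖ ^ 3) • (v 0 • coord 0 + v 1 • coord 1 + v 2 • coord 2)) v := by
  have h0 : ‖v‖ ≠ 0 := norm_ne_zero_iff.2 hv
  have h1 := (hasFDerivAt_coord 2 v).mul ((hasDerivAt_inv h0).comp_hasFDerivAt v (hasFDerivAt_norm_E3 hv))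
  refine h1.congr_fderiv (DFunLike.ext _ _ fun w => ?_)
  simp
  field_simp
  ring

/-- `sin θ dθ ∧ dφ` is the area form of the unit sphere. -/
theorem sin_dTheta_dPhi {v : E3} (h : OffAxis v) (w w' : E3) :
    ((Real.sin (colatitude v) * (dTheta v w * dPhi v w' - dTheta v w' * dPhi v w) : ℝ) : ℂ) =
      areaAt v ![w, w'] := by
  have hv : v ≠ 0 := by rintro rfl; simp [OffAxis] at h
  have hr : ‖v‖ ≠ 0 := norm_ne_zero_iff.2 hv
  have hp := h.sq_pos
  have hn := norm_sq_E3 v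
  have hlt : v 2 ^ 2 < ‖v‖ ^ 2 := by rw [hn]; linarith
  have hne1 : v 2 * ‖v‖⁻¹ ≠ -1 := fun h1 => by
    have h2 : v 2 = -‖v‖ := by field_simp at h1; exact h1
    rw [h2] at hlt
    simp at hlt
  have hne2 : v 2 * ‖v‖⁻¹ ≠ 1 := fun h1 => by
    have h2 : v 2 = ‖v‖ := by field_simp at h1; exact h1
    rw [h2] at hlt
    simp at hlt
  have hd := (Real.hasDerivAt_arccos hne1 hne2).comp_hasFDerivAt v (hasFDerivAt_cos_colatitude hv)
  have hs : 0 < 1 - (v 2 * ‖v‖⁻¹) ^ 2 := by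
    rw [mul_pow, inv_pow, sub_pos, mul_inv_lt_iff₀ (by positivity), one_mul]
    exact hlt
  have hsq := (Real.sqrt_pos.2 hs).ne'
  -- `sin θ dθ = -d(cos θ)` with `cos θ = z / r`: the square root from `sin (arccos t)` cancels the
  -- one in the derivative of `arccos`.
  have hθ : ∀ w : E3, Real.sin (colatitude v) * dTheta v w =
      -(w 2 / ‖v‖ - v 2 / ‖v‖ ^ 3 * (v 0 * w 0 + v 1 * w 1 + v 2 * w 2)) := by
    intro w
    have h1 : colatitude = Real.arccos ∘ fun y : E3 => y 2 * ‖y‖⁻¹ := by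
      funext y
      simp [colatitude, div_eq_mul_inv]
    rw [dTheta, h1, hd.fderiv, Function.comp_apply, Real.sin_arccos]
    simp only [smul_apply, sub_apply,
      add_apply, smul_eq_mul, coord_apply]
    generalize √(1 - (v 2 * ‖v‖⁻¹) ^ 2) = t at hsq
    field_simp
  rw [areaAt_apply]
  congr 1
  have h1 : Real.sin (colatitude v) * (dTheta v w * dPhi v w' - dTheta v w' * dPhi v w) =
    (Real.sin (colatitude v) * dTheta v w) * dPhi v w' -
      (Real.sin (colatitude v) * dTheta v w') * dPhi v w := by ring
  rw [h1, hθ, hθ, dPhi_apply h, dPhi_apply h]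
  have hp' := hp.ne'
  have e3 : v 0 ^ 2 + v 1 ^ 2 = ‖v‖ ^ 2 - v 2 ^ 2 := by rw [hn]; ring
  field_simp
  set x := v 0
  set y := v 1
  set z := v 2
  set k := w 0 * w' 1 - w 1 * w' 0
  set det := x * (w 1 * w' 2 - w 2 * w' 1) - y * (w 0 * w' 2 - w 2 * w' 0) + z * k
  -- The third component of the vector identity `v × (v × (w × w')) = (v · (w × w')) v - |v|² (w ×
  -- w')`.
  have e1 : (x * w 1 - y * w 0) * (x * w' 0 + y * w' 1 + z * w' 2) -
      (x * w' 1 - y * w' 0) * (x * w 0 + y * w 1 + z * w 2) = z * det - k * ‖v‖ ^ 2 := by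
    rw [hn]; ring
  have e2 : (x * w 1 - y * w 0) * w' 2 - (x * w' 1 - y * w' 0) * w 2 = det - z * k := by ring
  linear_combination ‖v‖ ^ 2 * e2 - z * e1 - det * e3

/-- The form `ε (x dy - y dx) / (r (r + ε z))` on `ℝ³`. -/
def monopoleForm (ε : ℝ) (v : E3) : E3 →L[ℝ] ℝ :=
  (ε * (‖v‖ * (‖v‖ + ε * v 2))⁻¹) • (v 0 • coord 1 - v 1 • coord 0)

/-- Off the opposite half-axis, `(ε - cos θ) dφ = ε (x dy - y dx) / (r (r + ε z))`. -/
theorem sub_cos_smul_dPhi {ε : ℝ} (hε : ε ^ 2 = 1) {v : E3} (hv : v ≠ 0)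
    (h : ‖v‖ + ε * v 2 ≠ 0) :
    (ε - Real.cos (colatitude v)) • dPhi v = monopoleForm ε v := by
  by_cases ho : OffAxis v
  · refine ContinuousLinearMap.ext fun w => ?_
    have hr : ‖v‖ ≠ 0 := norm_ne_zero_iff.2 hv
    have hn := norm_sq_E3 v
    have hp := ho.sq_pos.ne'
    have e3 : v 0 ^ 2 + v 1 ^ 2 = ‖v‖ ^ 2 - v 2 ^ 2 := by rw [hn]; ring
    simp only [smul_apply, monopoleForm, smul_eq_mul, dPhi_apply ho,
      cos_colatitude hv, sub_apply, coord_apply]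
    field_simp
    rw [e3]
    -- The cancellation rests on `x² + y² = r² - z² = (r - ε z)(r + ε z)`, valid because `ε² = 1`.
    linear_combination (v 0 * w 1 - v 1 * w 0) * ‖v‖ * v 2 * hε
  · rw [dPhi_of_not_offAxis ho]
    simp only [OffAxis, not_or, not_not] at ho
    rw [monopoleForm, ho.1, ho.2]
    simp

theorem contDiffAt_coord (i : Fin 3) (v : E3) : ContDiffAt ℝ ∞ (fun y : E3 => y i) v :=
  (coord i).contDiff.contDiffAt

theorem contDiffAt_monopoleForm {ε : ℝ} {v : E3} (hv : v ≠ 0) (h : ‖v‖ + ε * v 2 ≠ 0) :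
    ContDiffAt ℝ ∞ (monopoleForm ε) v := by
  have hr : ‖v‖ ≠ 0 := norm_ne_zero_iff.2 hv
  have h1 : ContDiffAt ℝ ∞ (fun y : E3 => ‖y‖) v := contDiffAt_id.norm ℝ hv
  have h2 := contDiffAt_coord
  exact (contDiffAt_const.mul ((h1.mul (h1.add (contDiffAt_const.mul (h2 2 v)))).inv
    (mul_ne_zero hr h))).smul
    (((h2 0 v).smul contDiffAt_const).sub ((h2 1 v).smul contDiffAt_const))

/-- The quotient rule with `dr(w) = ⟨v, w⟩ / r`. Only the values of the derivative are needed, so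
the linear map itself is left existential. -/
theorem hasFDerivAt_monopoleForm {ε : ℝ} {v : E3} (hv : v ≠ 0) (h : ‖v‖ + ε * v 2 ≠ 0) (w' : E3) :
    ∃ L : E3 →L[ℝ] ℝ, HasFDerivAt (fun y => monopoleForm ε y w') L v ∧ ∀ w, L w =
      ε * (w 0 * w' 1 - w 1 * w' 0) / (‖v‖ * (‖v‖ + ε * v 2)) -
      ε * (v 0 * w' 1 - v 1 * w' 0) * (2 * ‖v‖ * (v 0 * w 0 + v 1 * w 1 + v 2 * w 2) +
        ε * v 2 * (v 0 * w 0 + v 1 * w 1 + v 2 * w 2) + ε * ‖v‖ ^ 2 * w 2) /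
          (‖v‖ * (‖v‖ * (‖v‖ + ε * v 2)) ^ 2) := by
  have hr : ‖v‖ ≠ 0 := norm_ne_zero_iff.2 hv
  have h1 := hasFDerivAt_norm_E3 hv
  have hc := fun i => hasFDerivAt_coord i v
  have h2 := h1.mul (h1.add ((hc 2).const_mul ε))
  have h3 := ((hasDerivAt_inv (mul_ne_zero hr h)).comp_hasFDerivAt v h2).const_mul ε
  have h4 := h3.mul (((hc 0).mul_const (w' 1)).sub ((hc 1).mul_const (w' 0)))
  refine ⟨_, h4, fun w => ?_⟩
  simp
  field_simp
  ring

/-- The curvature of the monopole potential is the area form. -/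
theorem monopoleForm_curl {ε : ℝ} (hε : ε ^ 2 = 1) {v : E3} (hv : v ≠ 0) (h : ‖v‖ + ε * v 2 ≠ 0)
    (w w' : E3) :
    ((fderiv ℝ (fun y => monopoleForm ε y w') v w - fderiv ℝ (fun y => monopoleForm ε y w) v w' : ℝ) : ℂ)
      = areaAt v ![w, w'] := by
  have hr : ‖v‖ ≠ 0 := norm_ne_zero_iff.2 hv
  have hn := norm_sq_E3 v
  obtain ⟨L, hL, hLw⟩ := hasFDerivAt_monopoleForm hv h w'
  obtain ⟨L', hL', hLw'⟩ := hasFDerivAt_monopoleForm hv h w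
  rw [hL.fderiv, hL'.fderiv, hLw, hLw', areaAt_apply]
  congr 1
  set x := v 0
  set y := v 1
  set z := v 2
  set r := ‖v‖
  set k := w 0 * w' 1 - w 1 * w' 0
  set q := x * w 0 + y * w 1 + z * w 2
  set q' := x * w' 0 + y * w' 1 + z * w' 2
  set det := x * (w 1 * w' 2 - w 2 * w' 1) - y * (w 0 * w' 2 - w 2 * w' 0) + z * k
  have e0 : w' 0 * w 1 - w' 1 * w 0 = -k := by ring
  -- Again the third component of the expansion of `v × (v × (w × w'))`; `e2` is the cofactor
  -- expansion of `det` along the third coordinate.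
  have e1 : (x * w 1 - y * w 0) * q' - (x * w' 1 - y * w' 0) * q = z * det - k * r ^ 2 := by
    rw [hn]; ring
  have e2 : (x * w 1 - y * w 0) * w' 2 - (x * w' 1 - y * w' 0) * w 2 = det - z * k := by ring
  rw [e0]
  generalize x * w 1 - y * w 0 = a at *
  generalize x * w' 1 - y * w' 0 = a' at *
  field_simp
  linear_combination ε * (2 * r + ε * z) * e1 + ε ^ 2 * r ^ 2 * e2 + det * r ^ 2 * hε

end Monopole

/-! ## The Dirac connection -/

section MonopoleOneForm

theorem alternating_two_ext {E : Type*} [AddCommGroup E] [Module ℝ E] [TopologicalSpace E]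
    {a b : E [⋀^Fin 2]→L[ℝ] ℂ} (h : ∀ v w, a ![v, w] = b ![v, w]) : a = b := by
  ext v
  have hv : v = ![v 0, v 1] := by
    funext i
    fin_cases i <;> rfl
  rw [hv]
  exact h _ _

/-- The potential `½ iν ε (x dy - y dx) / (r (r + ε z))` of a magnetic monopole on `ℝ³`. -/
def monopolePotential (ε ν : ℝ) (v : E3) : E3 [⋀^Fin 1]→L[ℝ] ℂ :=
  ContinuousAlternatingMap.ofSubsingleton ℝ E3 ℂ (0 : Fin 1)
    (((1 / 2 : ℂ) * Complex.I * ν) • (Complex.ofRealCLM ∘L monopoleForm ε v))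

theorem contDiffAt_monopolePotential {ε : ℝ} (ν : ℝ) {v : E3} (hv : v ≠ 0)
    (h : ‖v‖ + ε * v 2 ≠ 0) :
    ContDiffAt ℝ ∞ (monopolePotential ε ν) v := by
  refine contDiffAt_alternating fun w => ?_
  have h1 : ContDiffAt ℝ ∞ (fun y => monopoleForm ε y (w 0)) v :=
    (contDiffAt_monopoleForm hv h).clm_apply contDiffAt_const
  have h2 : ContDiffAt ℝ ∞ (fun y => ((monopoleForm ε y (w 0) : ℝ) : ℂ)) v :=
    Complex.ofRealCLM.contDiff.contDiffAt.comp v h1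
  exact (contDiffAt_const (c := (1 / 2 : ℂ) * Complex.I * ν)).mul h2

/-- On constant vectors `dA(w, w') = ∂_w A(w') - ∂_{w'} A(w)`, which is the curl computed in
`monopoleForm_curl`. -/
theorem extD_monopolePotential {ε : ℝ} (hε : ε ^ 2 = 1) (ν : ℝ) {v : E3} (hv : v ≠ 0)
    (h : ‖v‖ + ε * v 2 ≠ 0) :
    extD 3 (monopolePotential ε ν) v = ((1 / 2 : ℂ) * Complex.I * ν) • areaAt v := by
  refine (extD_euclidean (monopolePotential ε ν) v).trans (alternating_two_ext fun w w' => ?_)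
  have h1 := extDeriv_apply ((contDiffAt_monopolePotential ν hv h).differentiableAt (by simp)) ![w, w']
  have hd : ∀ u u' : E3, fderiv ℝ (fun y => monopolePotential ε ν y ![u']) v u =
      (1 / 2 : ℂ) * Complex.I * ν * (fderiv ℝ (fun y => monopoleForm ε y u') v u : ℝ) := by
    intro u u'
    obtain ⟨L, hL, -⟩ := hasFDerivAt_monopoleForm hv h u'
    have h2 := (Complex.ofRealCLM.hasFDerivAt.comp v hL).const_mul ((1 / 2 : ℂ) * Complex.I * ν)
    rw [hL.fderiv]
    exact congrArg (fun M : E3 →L[ℝ] ℂ => M u) h2.fderiv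
  refine h1.trans ?_
  rw [Fin.sum_univ_two]
  have h4 : (0 : Fin 2).removeNth ![w, w'] = ![w'] := by
    funext i; fin_cases i; rfl
  have h5 : (1 : Fin 2).removeNth ![w, w'] = ![w] := by
    funext i; fin_cases i; rfl
  rw [h4, h5]
  simp only [Fin.val_zero, pow_zero, one_smul, Fin.val_one, pow_one, neg_smul,
    Matrix.cons_val_zero, Matrix.cons_val_one]
  rw [hd, hd, ContinuousAlternatingMap.smul_apply, ← monopoleForm_curl hε hv h]
  push_cast
  rw [smul_eq_mul]
  ring

theorem differentiableAt_azimuthFrom (v : E3) : DifferentiableAt ℝ (azimuthFrom v) v := by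
  by_cases h : OffAxis v
  · exact (hasFDerivAt_azimuthFrom h).differentiableAt
  · have h1 : azimuthFrom v = fun _ => 0 := funext fun w => azimuthFrom_eq_zero h w
    rw [h1]
    exact differentiableAt_const _

theorem volForm_linearIsometry (R : E3 ≃ₗᵢ[ℝ] E3)
    (hR : LinearMap.det (R.toLinearEquiv : E3 →ₗ[ℝ] E3) = 1) (w : Fin 3 → E3) :
    volForm (fun i => R (w i)) = volForm w := by
  have h1 : ∀ w : Fin 3 → E3, volForm w = (EuclideanSpace.basisFun (Fin 3) ℝ).toBasis.det w := by
    intro w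
    rw [volForm_apply, Module.Basis.det_apply, ← Matrix.det_transpose]
    rfl
  have h2 := (EuclideanSpace.basisFun (Fin 3) ℝ).toBasis.det_comp
    (R.toLinearEquiv : E3 →ₗ[ℝ] E3) w
  rw [hR, one_mul] at h2
  rw [h1, h1]
  exact h2

theorem areaAt_linearIsometry (R : E3 ≃ₗᵢ[ℝ] E3)
    (hR : LinearMap.det (R.toLinearEquiv : E3 →ₗ[ℝ] E3) = 1) (v w w' : E3) :
    areaAt (R v) ![R w, R w'] = areaAt v ![w, w'] := by
  have h1 := volForm_linearIsometry R hR ![v, w, w']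
  have h2 : (fun i => R (![v, w, w'] i)) = ![R v, R w, R w'] := by
    funext i; fin_cases i <;> rfl
  rw [h2] at h1
  change (((‖R v‖ ^ 3)⁻¹ * volForm ![R v, R w, R w'] : ℝ) : ℂ) =
    (((‖v‖ ^ 3)⁻¹ * volForm ![v, w, w'] : ℝ) : ℂ)
  rw [h1, R.norm_map]

end MonopoleOneForm

/-! ### The Dirac connection, its curvature, Chern class and rotations -/

section DiracConnection

variable {n : ℕ} {X : Type} [TopologicalSpace X] [ChartedSpace (EuclideanSpace ℝ (Fin n)) X]
  [IsManifold (𝓡 n) ∞ X] (p : RadiusVector n X) {a b : ℝ}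

theorem neg_one_pow_sq (i : Fin 2) : (((-1 : ℝ) ^ (i : ℕ)) ^ 2) = 1 := by
  rw [← pow_mul, mul_comm, pow_mul]
  simp

/-- `r + ε z` vanishes only on the half-axis `θ = π` for `ε = 1` and `θ = 0` for `ε = -1`, excluded
by `θ < b ≤ π` and `θ > a ≥ 0` respectively. -/
theorem diracCover_ne_zero (ha : 0 ≤ a) (hb : b ≤ Real.pi) (i : Fin 2) {x : X}
    (hx : x ∈ diracCover p a b i) : ‖p.pos x‖ + (-1) ^ (i : ℕ) * p.pos x 2 ≠ 0 := by
  have h0 := norm_ne_zero_iff.2 (p.ne_zero x)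
  intro h
  fin_cases i
  · have h1 : colatitude (p.pos x) < b := hx
    have h2 : p.pos x 2 = -‖p.pos x‖ := by
      simp only [pow_zero, one_mul] at h
      linarith
    rw [colatitude, h2, neg_div, div_self h0, Real.arccos_neg_one] at h1
    exact absurd (h1.trans_le hb) (lt_irrefl _)
  · have h1 : a < colatitude (p.pos x) := hx
    have h2 : p.pos x 2 = ‖p.pos x‖ := by
      simp only [pow_one] at h
      linarith
    rw [colatitude, h2, div_self h0, Real.arccos_one] at h1
    exact absurd (ha.trans_lt h1) (lt_irrefl _)

theorem diracPotential_apply (ν : ℝ) (i : Fin 2) (x : X) (v : TangentSpace (𝓡 n) x) :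
    diracPotential p ν i x ![v] =
      (1 / 2 : ℂ) * Complex.I * ν * ((-1) ^ (i : ℕ) - Real.cos (colatitude (p.pos x))) *
        (dPhi (p.pos x) (mfderiv (𝓡 n) 𝓘(ℝ, E3) p.pos x v) : ℝ) := rfl

theorem diracPotential_eq_pullForm (ha : 0 ≤ a) (hb : b ≤ Real.pi) (ν : ℝ) (i : Fin 2) {x : X}
    (hx : x ∈ diracCover p a b i) :
    diracPotential p ν i x =
      pullForm n p.pos (monopolePotential ((-1) ^ (i : ℕ)) ν) x := by
  refine oneForm_ext fun v => ?_
  have h1 := sub_cos_smul_dPhi (neg_one_pow_sq i) (p.ne_zero x) (diracCover_ne_zero p ha hb i hx)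
  let w : E3 := mfderiv (𝓡 n) 𝓘(ℝ, E3) p.pos x v
  change _ = (1 / 2 : ℂ) * Complex.I * ν * (monopoleForm ((-1) ^ (i : ℕ)) (p.pos x) w : ℝ)
  rw [diracPotential_apply, ← h1]
  change _ = (1 / 2 : ℂ) * Complex.I * ν *
    ((((-1) ^ (i : ℕ) - Real.cos (colatitude (p.pos x))) * dPhi (p.pos x) w : ℝ) : ℂ)
  push_cast
  ring

theorem smoothAt_monopolePotential (ha : 0 ≤ a) (hb : b ≤ Real.pi) (ν : ℝ) (i : Fin 2) {x : X}
    (hx : x ∈ diracCover p a b i) :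
    SmoothAt (monopolePotential ((-1) ^ (i : ℕ)) ν) (p.pos x) :=
  smoothAt_euclidean.2 (contDiffAt_monopolePotential ν (p.ne_zero x) (diracCover_ne_zero p ha hb i hx))

theorem eventually_diracPotential_eq (ha : 0 ≤ a) (hb : b ≤ Real.pi) (ν : ℝ) (i : Fin 2) {x : X}
    (hx : x ∈ diracCover p a b i) : ∀ᶠ y in 𝓝 x,
      pullForm n p.pos (monopolePotential ((-1) ^ (i : ℕ)) ν) y = diracPotential p ν i y := by
  filter_upwards [(diracCover p a b i).isOpen.mem_nhds hx] with y hy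
  exact (diracPotential_eq_pullForm p ha hb ν i hy).symm

theorem hasLogAt_one (x : X) {u : X → ℂ} (hu : ∀ y, u y = 0) : HasLogAt (1 : Stalk n X x) u :=
  ⟨⊤, 1, trivial, map_one ((phasePresheaf n X).germ ⊤ x trivial).hom, 1,
    .of_forall fun y _ => by rw [hu]; simp⟩

/-- The phase `-½ iν (ε_i - ε_j) φ` of the transition section `g_ij`. -/
def diracPhase (ν : ℝ) (i j : Fin 2) (q w : E3) : ℂ :=
  ((-(ν * (((-1) ^ (i : ℕ) - (-1) ^ (j : ℕ)) / 2) * azimuthFrom q w) : ℝ) : ℂ) * Complex.I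

theorem hasLogAt_diracTransition (ν : ℝ) (i j : Fin 2) (x : X) :
    HasLogAt (diracTransition p ν i j x) (fun y => diracPhase ν i j (p.pos x) (p.pos y)) := by
  have h : HasLogAt (phaseGerm p ν x) (fun y => diracPhase ν 0 1 (p.pos x) (p.pos y)) := by
    refine ⟨azimuthDomain p x, localPhase p ν x, mem_azimuthDomain p x, rfl, 1,
      .of_forall fun y hy => ?_⟩
    change ((Circle.exp (-(ν * azimuthFrom (p.pos x) (p.pos y))) : Circle) : ℂ) = _
    simp only [Circle.coe_exp, one_mul, diracPhase]
    norm_num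
  fin_cases i <;> fin_cases j
  · exact hasLogAt_one x fun y => by simp [diracPhase]
  · exact h
  · have h1 := h.inv
    have h2 : -(fun y => diracPhase ν 0 1 (p.pos x) (p.pos y)) =
        fun y => diracPhase ν 1 0 (p.pos x) (p.pos y) := by
      funext y
      simp only [Pi.neg_apply, diracPhase]
      push_cast
      simp
      ring
    rw [h2] at h1
    exact h1
  · exact hasLogAt_one x fun y => by simp [diracPhase]

theorem diracPotential_re (ν : ℝ) (i : Fin 2) (x : X) (v : Fin 1 → TangentSpace (𝓡 n) x) :
    (diracPotential p ν i x v).re = 0 := by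
  have hv : v = ![v 0] := by funext j; fin_cases j; rfl
  rw [hv]
  refine (congrArg Complex.re (diracPotential_apply p ν i x (v 0))).trans ?_
  generalize dPhi (p.pos x) (mfderiv (𝓡 n) 𝓘(ℝ, E3) p.pos x (v 0)) = d
  have h1 : (1 / 2 : ℂ) * Complex.I * ν * ((-1) ^ (i : ℕ) - Real.cos (colatitude (p.pos x))) * d =
    ((1 / 2 * ν * ((-1) ^ (i : ℕ) - Real.cos (colatitude (p.pos x))) * d : ℝ) : ℂ) * Complex.I := by
    push_cast
    ring
  rw [h1, Complex.re_ofReal_mul, Complex.I_re, mul_zero]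

/-- `A_i - A_j = ½ iν (ε_i - ε_j) dφ`, since the `cos θ` terms cancel, and this is minus the
differential of `diracPhase`. On the axis `dPhi` and `azimuthFrom` vanish, so the identity persists
there. -/
theorem diracPotential_gauge (ν : ℝ) (i j : Fin 2) {x : X} {V : Opens X}
    {g : C^∞⟮𝓡 n, V; 𝓡 1, Circle⟯} (hxV : x ∈ V)
    (hg : germOf n g x hxV = diracTransition p ν i j x) (v : TangentSpace (𝓡 n) x) :
    diracPotential p ν i x ![v] = diracPotential p ν j x ![v] + logDer n g⁻¹ x hxV v := by
  have hF : DifferentiableAt ℝ (diracPhase ν i j (p.pos x)) (p.pos x) :=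
    ((Complex.ofRealCLM.differentiableAt.comp (p.pos x)
      (((differentiableAt_azimuthFrom (p.pos x)).const_mul _).neg)).mul_const _)
  have hd : ∀ w, fderiv ℝ (diracPhase ν i j (p.pos x)) (p.pos x) w =
      ((-(ν * (((-1) ^ (i : ℕ) - (-1) ^ (j : ℕ)) / 2) * dPhi (p.pos x) w) : ℝ) : ℂ) *
        Complex.I := by
    intro w
    have h1 := (Complex.ofRealCLM.hasFDerivAt.comp (p.pos x)
      (((differentiableAt_azimuthFrom (p.pos x)).hasFDerivAt.const_mul
        (ν * (((-1) ^ (i : ℕ) - (-1) ^ (j : ℕ)) / 2))).neg)).mul_const Complex.I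
    refine (congrArg (fun M : E3 →L[ℝ] ℂ => M w) h1.fderiv).trans ?_
    rw [dPhi]
    simp
    ring
  have hF' : MDifferentiableAt (𝓡 3) 𝓘(ℝ, ℂ) (diracPhase ν i j (p.pos x)) (p.pos x) :=
    mdifferentiableAt_iff_differentiableAt.2 hF
  have hu := hF'.comp x (p.smooth.mdifferentiableAt (by simp) (x := x))
  have hl : HasLogAt (diracTransition p ν i j x) (diracPhase ν i j (p.pos x) ∘ p.pos) :=
    hasLogAt_diracTransition p ν i j x
  rw [hl.inv.logDer_eq hu.neg ((germOf_inv g x hxV).trans (congrArg _ hg)), exactForm_neg,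
    exactForm_comp p.smooth hF']
  let w : E3 := mfderiv (𝓡 n) 𝓘(ℝ, E3) p.pos x v
  have h2 : (-pullForm n p.pos (exactForm 3 (diracPhase ν i j (p.pos x))) x) ![v] =
      -(((-(ν * (((-1) ^ (i : ℕ) - (-1) ^ (j : ℕ)) / 2) * dPhi (p.pos x) w) : ℝ) : ℂ) *
        Complex.I) := by
    rw [← hd w, ← mfderiv_eq_fderiv]
    rfl
  rw [h2, diracPotential_apply, diracPotential_apply]
  change _ * ((dPhi (p.pos x) w : ℝ) : ℂ) = _ * ((dPhi (p.pos x) w : ℝ) : ℂ) + _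
  push_cast
  ring

theorem isConnection_dirac (ha : 0 ≤ a) (hab : a < b) (hb : b ≤ Real.pi) (ν : ℝ) :
    IsConnection (diracPresentation p ha hab hb ν) (diracPotential p ν) where
  smooth i := smoothOn_iff.2 fun _ hx =>
    ((smoothAt_monopolePotential p ha hb ν i hx).pullForm p.smooth).congr
      (eventually_diracPotential_eq p ha hb ν i hx)
  imaginary i x _ v := diracPotential_re p ν i x v
  gauge i j _ _ _ _ hxV hg v := diracPotential_gauge p ν i j hxV hg v

theorem curvature_dirac (ha : 0 ≤ a) (hb : b ≤ Real.pi) (ν : ℝ) (i : Fin 2) {x : X}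
    (hx : x ∈ diracCover p a b i) :
    curvature (diracPotential p ν) i x = ((1 / 2 : ℂ) * Complex.I * ν) • areaForm p x := by
  rw [curvature, ← extD_congr (eventually_diracPotential_eq p ha hb ν i hx),
    extD_pullForm p.smooth (smoothAt_monopolePotential p ha hb ν i hx)]
  unfold pullForm
  rw [extD_monopolePotential (neg_one_pow_sq i) ν (p.ne_zero x) (diracCover_ne_zero p ha hb i hx)]
  rfl

theorem areaForm_apply (x : X) (v w : TangentSpace (𝓡 n) x) (v' w' : E3)
    (hv : mfderiv (𝓡 n) 𝓘(ℝ, E3) p.pos x v = v') (hw : mfderiv (𝓡 n) 𝓘(ℝ, E3) p.pos x w = w') :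
    areaForm p x ![v, w] = areaAt (p.pos x) ![v', w'] := by
  subst hv hw
  change areaAt (p.pos x) (mfderiv (𝓡 n) 𝓘(ℝ, E3) p.pos x ∘ ![v, w]) = _
  congr 1
  funext i
  fin_cases i <;> rfl

theorem areaForm_eq_sinThetaDThetaDPhi {x : X} (h : OffAxis (p.pos x))
    (v w : TangentSpace (𝓡 n) x) : areaForm p x ![v, w] = sinThetaDThetaDPhi p x v w := by
  rw [areaForm_apply p x v w _ _ rfl rfl]
  exact (sin_dTheta_dPhi h _ _).symm

theorem representsFirstChernClass_dirac (ha : 0 ≤ a) (hab : a < b) (hb : b ≤ Real.pi) (ν : ℝ) :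
    RepresentsFirstChernClass (diracBundle p ha hab hb ν)
      ((-(ν : ℂ) / (4 * Real.pi)) • areaForm p) := by
  refine representsFirstChernClass_of_curvature (isConnection_dirac p ha hab hb ν) fun i x hx => ?_
  refine Eq.trans ?_ (congrArg (fun c => (Complex.I / (2 * (Real.pi : ℂ))) • c)
    (curvature_dirac p ha hb ν i hx).symm)
  -- The constant comes from `(i / 2π) · (iν / 2) = -ν / 4π`.
  rw [smul_smul]
  refine congrArg (fun c : ℂ => c • areaForm p x) ?_
  have hpi : (Real.pi : ℂ) ≠ 0 := Complex.ofReal_ne_zero.2 Real.pi_ne_zero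
  field_simp
  rw [Complex.I_sq]
  ring

variable {p}

/-- The area form is built from the determinant and the norm, both invariant under rotations, and by
the chain rule `f` acts on the images of tangent vectors in `ℝ³` as `R` does. -/
theorem pullForm_areaForm {m : ℕ} {Y : Type} [TopologicalSpace Y]
    [ChartedSpace (EuclideanSpace ℝ (Fin m)) Y] [IsManifold (𝓡 m) ∞ Y] {q : RadiusVector m Y}
    {f : X → Y} (hf : ContMDiff (𝓡 n) (𝓡 m) ∞ f) {R : E3 ≃ₗᵢ[ℝ] E3}
    (hR : LinearMap.det (R.toLinearEquiv : E3 →ₗ[ℝ] E3) = 1)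
    (hfR : ∀ x, q.pos (f x) = R (p.pos x)) : pullForm n f (areaForm q) = areaForm p := by
  funext x
  refine alternating_two_ext fun v w => ?_
  have h1 : mfderiv (𝓡 n) 𝓘(ℝ, E3) (q.pos ∘ f) x = mfderiv (𝓡 n) 𝓘(ℝ, E3) (R ∘ p.pos) x := by
    rw [show q.pos ∘ f = R ∘ p.pos from funext hfR]
  have hRd : HasMFDerivAt 𝓘(ℝ, E3) 𝓘(ℝ, E3) R (p.pos x)
      (R.toContinuousLinearEquiv : E3 →L[ℝ] E3) :=
    (R.toContinuousLinearEquiv : E3 →L[ℝ] E3).hasFDerivAt.hasMFDerivAt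
  have h2 := (hRd.comp x (p.smooth.mdifferentiableAt (by simp)).hasMFDerivAt).mfderiv
  have h3 := mfderiv_comp x (q.smooth.mdifferentiableAt (by simp)) (hf.mdifferentiableAt (by simp))
  have h4 : ∀ v, mfderiv (𝓡 m) 𝓘(ℝ, E3) q.pos (f x) (mfderiv (𝓡 n) (𝓡 m) f x v) =
      R (mfderiv (𝓡 n) 𝓘(ℝ, E3) p.pos x v) := fun v =>
    (DFunLike.congr_fun h3 v).symm.trans ((DFunLike.congr_fun h1 v).trans (DFunLike.congr_fun h2 v))
  have h5 : pullForm n f (areaForm q) x ![v, w] =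
      areaForm q (f x) ![mfderiv (𝓡 n) (𝓡 m) f x v, mfderiv (𝓡 n) (𝓡 m) f x w] := by
    change areaForm q (f x) (mfderiv (𝓡 n) (𝓡 m) f x ∘ ![v, w]) = _
    congr 1
    funext i
    fin_cases i <;> rfl
  rw [h5, areaForm_apply q (f x) _ _ _ _ (h4 v) (h4 w), hfR, areaForm_apply p x v w _ _ rfl rfl]
  exact areaAt_linearIsometry R hR _ _ _

theorem connectionEquivalent_dirac_pullback (ha : 0 ≤ a) (hab : a < b) (hb : b ≤ Real.pi) (ν : ℝ)
    {f : X → X} (hf : ContMDiff (𝓡 n) (𝓡 n) ∞ f) {R : E3 ≃ₗᵢ[ℝ] E3}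
    (hR : LinearMap.det (R.toLinearEquiv : E3 →ₗ[ℝ] E3) = 1)
    (hfR : ∀ x, p.pos (f x) = R (p.pos x)) :
    ConnectionEquivalent ((diracPresentation p ha hab hb ν).pullback hf)
      (fun i => pullForm n f (diracPotential p ν i))
      (diracPresentation p ha hab hb ν) (diracPotential p ν) := by
  have h := isConnection_dirac p ha hab hb ν
  refine connectionEquivalent_of_curvature_eq (h.pullback hf) h fun i j x hx => ?_
  have h1 := curvature_dirac p ha hb ν i (x := f x) hx.1
  have h2 := curvature_dirac p ha hb ν j hx.2
  refine (curvature_pullForm hf h hx.1).trans (Eq.trans ?_ h2.symm)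
  rw [← pullForm_areaForm hf hR hfR]
  exact congrArg (fun c => c.compContinuousLinearMap (mfderiv (𝓡 n) (𝓡 n) f x)) h1

end DiracConnection

/-! ## The area form of the sphere is not exact -/

section Area

/-- The Euclidean plane. -/
abbrev E2 : Type := EuclideanSpace ℝ (Fin 2)

/-- Stokes on the rectangle `[0, π] × [0, 2π]`: periodicity cancels the edges `t = 0` and `t = 2π`,
and `β` vanishes along the edges over the poles, so the integral `4π c` of `dβ` is zero. -/
theorem eq_zero_of_extDeriv_eq_sin {β : E2 → E2 [⋀^Fin 1]→L[ℝ] ℂ} (hβ : ContDiff ℝ ∞ β) {c : ℂ}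
    (hper : ∀ s : ℝ, β !₂[s, 2 * Real.pi] ![!₂[1, 0]] = β !₂[s, 0] ![!₂[1, 0]])
    (h0 : ∀ t : ℝ, β !₂[0, t] ![!₂[0, 1]] = 0) (hπ : ∀ t : ℝ, β !₂[Real.pi, t] ![!₂[0, 1]] = 0)
    (hd : ∀ y : E2, extDeriv β y ![!₂[1, 0], !₂[0, 1]] = c * Real.sin (y 0)) : c = 0 := by
  let J : ℝ × ℝ →L[ℝ] E2 := (EuclideanSpace.equiv (Fin 2) ℝ).symm.toContinuousLinearMap ∘L
    ContinuousLinearMap.pi ![ContinuousLinearMap.fst ℝ ℝ ℝ, ContinuousLinearMap.snd ℝ ℝ ℝ]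
  have hJ : ∀ z, J z = !₂[z.1, z.2] := by
    intro z
    ext i
    fin_cases i <;> rfl
  have hβJ : ∀ u : E2, ContDiff ℝ ∞ fun z => β (J z) ![u] := fun u =>
    (ContinuousAlternatingMap.apply ℝ E2 ℂ ![u]).contDiff.comp (hβ.comp J.contDiff)
  have hdJ : ∀ u z w, fderiv ℝ (fun z => β (J z) ![u]) z w =
      fderiv ℝ (fun y => β y ![u]) (J z) (J w) := by
    intro u z w
    have h1 : DifferentiableAt ℝ (fun y => β y ![u]) (J z) :=
      ((ContinuousAlternatingMap.apply ℝ E2 ℂ ![u]).contDiff.comp hβ).contDiffAt.differentiableAt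
        (by simp)
    exact DFunLike.congr_fun (h1.hasFDerivAt.comp z J.hasFDerivAt).fderiv w
  -- Stokes for `β = β_s ds + β_t dt` is the divergence theorem for the vector field `(β_t, -β_s)`.
  have key : ∀ z : ℝ × ℝ, fderiv ℝ (fun z => β (J z) ![!₂[0, 1]]) z (1, 0) +
      fderiv ℝ (fun z => -β (J z) ![!₂[1, 0]]) z (0, 1) = c * Real.sin z.1 := by
    intro z
    have h1 := extDeriv_apply (hβ.contDiffAt.differentiableAt (x := J z) (by simp))
      ![!₂[1, 0], !₂[0, 1]]
    have h4 : (0 : Fin 2).removeNth ![(!₂[1, 0] : E2), !₂[0, 1]] = ![!₂[0, 1]] := by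
      funext i; fin_cases i; rfl
    have h5 : (1 : Fin 2).removeNth ![(!₂[1, 0] : E2), !₂[0, 1]] = ![!₂[1, 0]] := by
      funext i; fin_cases i; rfl
    have h6 : fderiv ℝ (fun z => -β (J z) ![!₂[1, 0]]) z =
        -fderiv ℝ (fun z => β (J z) ![!₂[1, 0]]) z := fderiv_fun_neg
    have h7 := hd (J z)
    rw [h1, Fin.sum_univ_two, h4, h5] at h7
    simp only [Fin.val_zero, pow_zero, one_smul, Fin.val_one, pow_one, neg_smul,
      Matrix.cons_val_zero, Matrix.cons_val_one] at h7
    rw [h6, neg_apply, hdJ, hdJ, hJ (1, 0), hJ (0, 1), h7, hJ z]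
    rfl
  have hdiff : ∀ u z, HasFDerivAt (fun z => β (J z) ![u]) (fderiv ℝ (fun z => β (J z) ![u]) z) z :=
    fun u z => ((hβJ u).contDiffAt.differentiableAt (by simp)).hasFDerivAt
  have hdiff' : ∀ u z, HasFDerivAt (fun z => -β (J z) ![u])
      (fderiv ℝ (fun z => -β (J z) ![u]) z) z :=
    fun u z => ((hβJ u).neg.contDiffAt.differentiableAt (by simp)).hasFDerivAt
  have hS := MeasureTheory.integral2_divergence_prod_of_hasFDerivAt
    (fun z => β (J z) ![!₂[0, 1]]) (fun z => -β (J z) ![!₂[1, 0]]) _ _ 0 0 Real.pi (2 * Real.pi)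
    (hβJ _).continuous.continuousOn (hβJ _).neg.continuous.continuousOn
    (fun z _ => hdiff _ z) (fun z _ => hdiff' _ z)
    (by
      simp only [key]
      refine ContinuousOn.integrableOn_compact (isCompact_uIcc.prod isCompact_uIcc) ?_
      fun_prop)
  simp only [key] at hS
  simp only [hJ, hper, h0, hπ, sub_self, intervalIntegral.integral_zero, add_zero,
    intervalIntegral.integral_const, sub_zero] at hS
  rw [intervalIntegral.integral_smul, intervalIntegral.integral_const_mul,
    intervalIntegral.integral_ofReal, integral_sin] at hS
  simpa [Real.pi_ne_zero] using hS

/-- The point of the unit sphere with colatitude `y 0` and azimuth `y 1`. -/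
def sphericalPoint (y : E2) : E3 :=
  !₂[Real.sin (y 0) * Real.cos (y 1), Real.sin (y 0) * Real.sin (y 1), Real.cos (y 0)]

theorem contDiff_sphericalPoint : ContDiff ℝ ∞ sphericalPoint := by
  have h : ∀ i : Fin 2, ContDiff ℝ ∞ fun y : E2 => y i := fun i =>
    (EuclideanSpace.proj (𝕜 := ℝ) i).contDiff
  refine contDiff_euclidean.2 fun i => ?_
  fin_cases i
  · exact (Real.contDiff_sin.comp (h 0)).mul (Real.contDiff_cos.comp (h 1))
  · exact (Real.contDiff_sin.comp (h 0)).mul (Real.contDiff_sin.comp (h 1))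
  · exact Real.contDiff_cos.comp (h 0)

theorem norm_sphericalPoint (y : E2) : ‖sphericalPoint y‖ = 1 := by
  have h := norm_sq_E3 (sphericalPoint y)
  have h1 : sphericalPoint y 0 ^ 2 + sphericalPoint y 1 ^ 2 + sphericalPoint y 2 ^ 2 = 1 := by
    change (Real.sin (y 0) * Real.cos (y 1)) ^ 2 + (Real.sin (y 0) * Real.sin (y 1)) ^ 2 +
      Real.cos (y 0) ^ 2 = 1
    linear_combination Real.sin (y 0) ^ 2 * Real.sin_sq_add_cos_sq (y 1) +
      Real.sin_sq_add_cos_sq (y 0)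
  rw [h1] at h
  exact (pow_eq_one_iff_of_nonneg (norm_nonneg _) two_ne_zero).1 h

theorem fderiv_sphericalPoint (y v : E2) : fderiv ℝ sphericalPoint y v =
    !₂[Real.cos (y 0) * Real.cos (y 1) * v 0 - Real.sin (y 0) * Real.sin (y 1) * v 1,
      Real.cos (y 0) * Real.sin (y 1) * v 0 + Real.sin (y 0) * Real.cos (y 1) * v 1,
      -(Real.sin (y 0) * v 0)] := by
  have hp : ∀ i : Fin 2, HasFDerivAt (fun y : E2 => y i) (EuclideanSpace.proj (𝕜 := ℝ) i) y :=
    fun i => (EuclideanSpace.proj (𝕜 := ℝ) i).hasFDerivAt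
  have h : ∀ (i : Fin 3) (L : E2 →L[ℝ] ℝ), HasFDerivAt (fun y => sphericalPoint y i) L y →
      fderiv ℝ sphericalPoint y v i = L v := fun i L hL =>
    DFunLike.congr_fun (HasFDerivAt.unique ((EuclideanSpace.proj (𝕜 := ℝ) i).hasFDerivAt.comp y
      (contDiff_sphericalPoint.contDiffAt.differentiableAt (by simp)).hasFDerivAt) hL) v
  ext i
  fin_cases i
  · refine (h 0 _ ((hp 0).sin.mul (hp 1).cos)).trans ?_
    simp
    ring
  · refine (h 1 _ ((hp 0).sin.mul (hp 1).sin)).trans ?_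
    simp
    ring
  · refine (h 2 _ (hp 0).cos).trans ?_
    simp

theorem areaAt_sphericalPoint (y : E2) :
    areaAt (sphericalPoint y) ![fderiv ℝ sphericalPoint y !₂[1, 0],
      fderiv ℝ sphericalPoint y !₂[0, 1]] = Real.sin (y 0) := by
  rw [areaAt_apply, norm_sphericalPoint, fderiv_sphericalPoint, fderiv_sphericalPoint]
  congr 1
  simp only [sphericalPoint, PiLp.toLp_apply, Matrix.cons_val]
  linear_combination Real.sin (y 0) ^ 3 * Real.sin_sq_add_cos_sq (y 1) +
    Real.sin (y 0) * Real.cos (y 0) ^ 2 * Real.sin_sq_add_cos_sq (y 1) +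
      Real.sin (y 0) * Real.sin_sq_add_cos_sq (y 0)

/-- `sphericalPoint`, as a map to the unit sphere. -/
def toSphere (y : E2) : S2 := ⟨sphericalPoint y, by simp [norm_sphericalPoint]⟩

theorem contMDiff_toSphere : ContMDiff (𝓡 2) (𝓡 2) ∞ toSphere :=
  contDiff_sphericalPoint.contMDiff.codRestrict_sphere _

theorem toSphere_pole {s : ℝ} (hs : Real.sin s = 0) (t : ℝ) :
    toSphere !₂[s, t] = toSphere !₂[s, 0] :=
  Subtype.ext (by simp [toSphere, sphericalPoint, hs])

end Area

/-! ### Inequivalence of Dirac bundles with different parameters -/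

section Inequivalence

variable {n : ℕ} {X : Type} [TopologicalSpace X] [ChartedSpace (EuclideanSpace ℝ (Fin n)) X]
  [IsManifold (𝓡 n) ∞ X]

theorem mfderiv_apply_eq_zero_of_const {Y : Type} [TopologicalSpace Y]
    [ChartedSpace (EuclideanSpace ℝ (Fin n)) Y] {Φ : E2 → Y} (hΦ : ContMDiff (𝓡 2) (𝓡 n) ∞ Φ)
    {y v : E2} (h : ∀ t : ℝ, Φ (y + t • v) = Φ y) : mfderiv (𝓡 2) (𝓡 n) Φ y v = 0 := by
  have hl : HasFDerivAt (fun t : ℝ => y + t • v) (ContinuousLinearMap.toSpanSingleton ℝ v) 0 :=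
    ((ContinuousLinearMap.toSpanSingleton ℝ v).hasFDerivAt).const_add y
  have h0 : y + (0 : ℝ) • v = y := by simp
  have h1 : HasMFDerivAt (𝓡 2) (𝓡 n) Φ (y + (0 : ℝ) • v) (mfderiv (𝓡 2) (𝓡 n) Φ (y + (0 : ℝ) • v)) :=
    ((hΦ _).mdifferentiableAt (by simp)).hasMFDerivAt
  have h2 := h1.comp (0 : ℝ) hl.hasMFDerivAt
  have h3 : Φ ∘ (fun t : ℝ => y + t • v) = fun _ => Φ y := funext h
  rw [h3] at h2
  have h4 := hasMFDerivAt_unique h2 (hasMFDerivAt_const (Φ y) (0 : ℝ))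
  have h5 : mfderiv (𝓡 2) (𝓡 n) Φ (y + (0 : ℝ) • v) ((1 : ℝ) • v) = 0 :=
    DFunLike.congr_fun h4 (1 : ℝ)
  rw [one_smul] at h5
  rw [h0] at h5
  exact h5

/-- Translation by `T` has the identity as derivative, so `Φ` has the same derivative at `y` and `y
+ T`. -/
theorem pullForm_apply_eq_of_periodic {Y : Type} [TopologicalSpace Y]
    [ChartedSpace (EuclideanSpace ℝ (Fin n)) Y] {Φ : E2 → Y} (hΦ : ContMDiff (𝓡 2) (𝓡 n) ∞ Φ)
    {T : E2} (hT : ∀ y, Φ (y + T) = Φ y) (η : DiffForm n Y 1) (y u : E2) :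
    pullForm 2 Φ η (y + T) ![u] = pullForm 2 Φ η y ![u] := by
  have hτ : HasMFDerivAt (𝓡 2) (𝓡 2) (fun y : E2 => y + T) y (ContinuousLinearMap.id ℝ E2) :=
    ((hasFDerivAt_id y).add_const T).hasMFDerivAt
  have h1 := ((hΦ (y + T)).mdifferentiableAt (by simp)).hasMFDerivAt.comp y hτ
  have h2 : pullForm 2 (Φ ∘ fun y : E2 => y + T) η y ![u] = pullForm 2 Φ η (y + T) ![u] := by
    unfold pullForm
    rw [h1.mfderiv]
    rfl
  exact h2.symm.trans (congrArg (fun F => pullForm 2 F η y ![u]) (funext hT))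

theorem pullForm_areaForm_apply (p : RadiusVector n X) {Φ : E2 → X}
    (hΦ : ContMDiff (𝓡 2) (𝓡 n) ∞ Φ) (hp : ∀ y, p.pos (Φ y) = sphericalPoint y) (y v w : E2) :
    pullForm 2 Φ (areaForm p) y ![v, w] =
      areaAt (sphericalPoint y) ![fderiv ℝ sphericalPoint y v, fderiv ℝ sphericalPoint y w] := by
  have h1 : mfderiv (𝓡 2) 𝓘(ℝ, E3) sphericalPoint y =
      (mfderiv (𝓡 n) 𝓘(ℝ, E3) p.pos (Φ y)).comp (mfderiv (𝓡 2) (𝓡 n) Φ y) := by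
    rw [← show p.pos ∘ Φ = sphericalPoint from funext hp]
    exact mfderiv_comp y ((p.smooth _).mdifferentiableAt (by simp))
      ((hΦ y).mdifferentiableAt (by simp))
  have h2 : mfderiv (𝓡 2) 𝓘(ℝ, E3) sphericalPoint y = fderiv ℝ sphericalPoint y := mfderiv_eq_fderiv
  have h3 : ∀ u, mfderiv (𝓡 n) 𝓘(ℝ, E3) p.pos (Φ y) (mfderiv (𝓡 2) (𝓡 n) Φ y u) =
      fderiv ℝ sphericalPoint y u := fun u => DFunLike.congr_fun (h1.symm.trans h2) u
  have h4 := areaForm_apply p (Φ y) (mfderiv (𝓡 2) (𝓡 n) Φ y v) (mfderiv (𝓡 2) (𝓡 n) Φ y w) _ _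
    (h3 v) (h3 w)
  rw [hp] at h4
  refine Eq.trans ?_ h4
  change areaForm p (Φ y) (mfderiv (𝓡 2) (𝓡 n) Φ y ∘ ![v, w]) = _
  congr 1
  funext i
  fin_cases i <;> rfl

/-- If the unit sphere embeds into `X` compatibly with radius vectors, no nonzero multiple of the
area form is exact. -/
theorem eq_zero_of_extD_eq_smul_areaForm (p : RadiusVector n X) {σ : S2 → X}
    (hσ : ContMDiff (𝓡 2) (𝓡 n) ∞ σ) (hp : ∀ s, p.pos (σ s) = s) {η : DiffForm n X 1}
    (hη : SmoothOn n η ⊤) {c : ℂ} (h : ∀ x, extD n η x = c • areaForm p x) : c = 0 := by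
  have hΦ : ContMDiff (𝓡 2) (𝓡 n) ∞ (σ ∘ toSphere) := hσ.comp contMDiff_toSphere
  have hsm : ∀ x, SmoothAt η x := fun x => smoothOn_iff.1 hη x trivial
  -- Where `sin s = 0`, the whole line `s = const` is mapped to one pole, so the derivative in the
  -- direction of `t` vanishes.
  have hpole : ∀ s t : ℝ, Real.sin s = 0 → pullForm 2 (σ ∘ toSphere) η !₂[s, t] ![!₂[0, 1]] = 0 := by
    intro s t hs
    have h1 : mfderiv (𝓡 2) (𝓡 n) (σ ∘ toSphere) !₂[s, t] !₂[0, 1] = 0 := by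
      refine mfderiv_apply_eq_zero_of_const hΦ fun u => congrArg σ ?_
      have h2 : (!₂[s, t] : E2) + u • !₂[0, 1] = !₂[s, t + u] := by
        ext i
        fin_cases i <;> simp
      rw [h2, toSphere_pole hs, toSphere_pole hs t]
    exact (η _).map_coord_zero (0 : Fin 1) h1
  refine eq_zero_of_extDeriv_eq_sin (β := pullForm 2 (σ ∘ toSphere) η)
    (contDiff_iff_contDiffAt.2 fun y => smoothAt_euclidean.1 ((hsm _).pullForm hΦ)) ?_
    (fun t => hpole 0 t Real.sin_zero) (fun t => hpole Real.pi t Real.sin_pi) fun y => ?_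
  · intro s
    have h1 : (!₂[s, 0] : E2) + !₂[0, 2 * Real.pi] = !₂[s, 2 * Real.pi] := by
      ext i
      fin_cases i <;> simp
    have h2 := pullForm_apply_eq_of_periodic hΦ (T := !₂[0, 2 * Real.pi])
      (fun y => congrArg σ (Subtype.ext (by simp [toSphere, sphericalPoint]))) η !₂[s, 0] !₂[1, 0]
    rw [h1] at h2
    exact h2
  · have h1 := (extD_euclidean (pullForm 2 (σ ∘ toSphere) η) y).symm.trans
      (extD_pullForm hΦ (hsm _))
    refine (DFunLike.congr_fun h1 _).trans ?_
    have h2 : pullForm 2 (σ ∘ toSphere) (extD n η) y =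
        c • pullForm 2 (σ ∘ toSphere) (areaForm p) y := by
      unfold pullForm
      rw [h]
      rfl
    refine (DFunLike.congr_fun h2 _).trans ?_
    refine congrArg (c * ·) ((pullForm_areaForm_apply p hΦ (fun y => hp _) y _ _).trans ?_)
    exact areaAt_sphericalPoint y

/-- An equivalence would make the difference of curvatures `½ i (ν - ν') dS` exact. -/
theorem not_equivalent_dirac (p : RadiusVector n X) {σ : S2 → X}
    (hσ : ContMDiff (𝓡 2) (𝓡 n) ∞ σ) (hp : ∀ s, p.pos (σ s) = s) {a b : ℝ}
    (ha : 0 ≤ a) (hab : a < b) (hb : b ≤ Real.pi) {ν ν' : ℝ} (hν : ν ≠ ν') :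
    ¬ (diracBundle p ha hab hb ν).Equivalent (diracBundle p ha hab hb ν') := by
  intro e
  obtain ⟨η, hη, h⟩ := exists_difference_form (isConnection_dirac p ha hab hb ν')
    (isConnection_dirac p ha hab hb ν) e
  refine hν (sub_eq_zero.1 (Complex.ofReal_eq_zero.1 ?_))
  have hc := eq_zero_of_extD_eq_smul_areaForm p hσ hp hη
    (c := (1 / 2 : ℂ) * Complex.I * (ν - ν' : ℝ)) fun x => by
      obtain ⟨i, hi⟩ := (diracPresentation p ha hab hb ν).covers x
      refine (h i i x ⟨hi, hi⟩).trans ?_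
      refine (congrArg₂ (· - ·) (curvature_dirac p ha hb ν i hi)
        (curvature_dirac p ha hb ν' i hi)).trans ((sub_smul _ _ _).symm.trans
          (congrArg (fun c : ℂ => c • areaForm p x) ?_))
      push_cast
      ring
  simpa using hc

end Inequivalence

/-! ### Rotations and a test sphere in Minkowski space -/

section Bases

theorem pos_minkowskiRot (R : E3 ≃ₗᵢ[ℝ] E3) (x : R4) :
    minkowskiRadius.pos (minkowskiRot R x) = R (minkowskiRadius.pos x) := by
  ext i
  fin_cases i <;> rfl

/-- The unit sphere in the hyperplane `x⁰ = 0`. -/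
def sphereToMinkowski (s : S2) : R4 :=
  ⟨!₂[0, s.1 0, s.1 1, s.1 2], by
    have h := norm_sq_E3 s.1
    rw [norm_eq_of_mem_sphere s] at h
    change 0 < s.1 0 ^ 2 + s.1 1 ^ 2 + s.1 2 ^ 2
    rw [← h]
    norm_num⟩

theorem contMDiff_sphereToMinkowski : ContMDiff (𝓡 2) (𝓡 4) ∞ sphereToMinkowski := by
  refine (ContMDiff.subtypeVal_comp_iff minkowskiOpen _).1 ?_
  have h : ContDiff ℝ ∞ fun v : E3 => (!₂[0, v 0, v 1, v 2] : EuclideanSpace ℝ (Fin 4)) := by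
    refine contDiff_euclidean.2 fun i => ?_
    fin_cases i
    · exact contDiff_const
    · exact (EuclideanSpace.proj (𝕜 := ℝ) (0 : Fin 3)).contDiff
    · exact (EuclideanSpace.proj (𝕜 := ℝ) (1 : Fin 3)).contDiff
    · exact (EuclideanSpace.proj (𝕜 := ℝ) (2 : Fin 3)).contDiff
  exact h.contMDiff.comp contMDiff_coe_sphere

theorem pos_sphereToMinkowski (s : S2) : minkowskiRadius.pos (sphereToMinkowski s) = s := by
  ext i
  fin_cases i <;> rfl

end Bases

end

end DiracSheaf

theorem mainTheorem5 (a b : ℝ) (ha : 0 ≤ a) (hab : a < b) (hb : b ≤ Real.pi) :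
    (∀ ν : ℝ,
      IsConnection (diracPresentation sphereRadius ha hab hb ν) (diracPotential sphereRadius ν) ∧
      (∀ R : E3 ≃ₗᵢ[ℝ] E3, LinearMap.det (R.toLinearEquiv : E3 →ₗ[ℝ] E3) = 1 →
        ConnectionEquivalent
          ((diracPresentation sphereRadius ha hab hb ν).pullback (contMDiff_sphereRot R))
          (fun i => pullForm 2 (sphereRot R) (diracPotential sphereRadius ν i))
          (diracPresentation sphereRadius ha hab hb ν) (diracPotential sphereRadius ν)) ∧
      (∀ i, ∀ x ∈ diracCover sphereRadius a b i,
        curvature (diracPotential sphereRadius ν) i x =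
          ((1 / 2 : ℂ) * Complex.I * ν) • areaForm sphereRadius x) ∧
      (∀ i, ∀ x ∈ diracCover sphereRadius a b i, OffAxis (sphereRadius.pos x) → ∀ v w,
        curvature (diracPotential sphereRadius ν) i x ![v, w] =
          (1 / 2 : ℂ) * Complex.I * ν * sinThetaDThetaDPhi sphereRadius x v w) ∧
      RepresentsFirstChernClass (diracBundle sphereRadius ha hab hb ν)
        ((-(ν : ℂ) / (4 * Real.pi)) • areaForm sphereRadius)) ∧
    (∀ ν ν' : ℝ, ν ≠ ν' →
      ¬ (diracBundle sphereRadius ha hab hb ν).Equivalent (diracBundle sphereRadius ha hab hb ν')) ∧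
    (∀ ν : ℝ,
      IsConnection (diracPresentation minkowskiRadius ha hab hb ν) (diracPotential minkowskiRadius ν) ∧
      (∀ R : E3 ≃ₗᵢ[ℝ] E3, LinearMap.det (R.toLinearEquiv : E3 →ₗ[ℝ] E3) = 1 →
        ConnectionEquivalent
          ((diracPresentation minkowskiRadius ha hab hb ν).pullback (contMDiff_minkowskiRot R))
          (fun i => pullForm 4 (minkowskiRot R) (diracPotential minkowskiRadius ν i))
          (diracPresentation minkowskiRadius ha hab hb ν) (diracPotential minkowskiRadius ν)) ∧
      (∀ i, ∀ x ∈ diracCover minkowskiRadius a b i,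
        curvature (diracPotential minkowskiRadius ν) i x =
          ((1 / 2 : ℂ) * Complex.I * ν) • areaForm minkowskiRadius x) ∧
      (∀ i, ∀ x ∈ diracCover minkowskiRadius a b i, OffAxis (minkowskiRadius.pos x) → ∀ v w,
        curvature (diracPotential minkowskiRadius ν) i x ![v, w] =
          (1 / 2 : ℂ) * Complex.I * ν * sinThetaDThetaDPhi minkowskiRadius x v w) ∧
      RepresentsFirstChernClass (diracBundle minkowskiRadius ha hab hb ν)
        ((-(ν : ℂ) / (4 * Real.pi)) • areaForm minkowskiRadius)) ∧
    (∀ ν ν' : ℝ, ν ≠ ν' →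
      ¬ (diracBundle minkowskiRadius ha hab hb ν).Equivalent (diracBundle minkowskiRadius ha hab hb ν')) := by
  refine ⟨?_, ?_, ?_, ?_⟩
  · intro ν
    exact ⟨isConnection_dirac _ ha hab hb ν,
      fun R hR => connectionEquivalent_dirac_pullback ha hab hb ν _ hR (fun _ => rfl),
      fun i x hx => curvature_dirac _ ha hb ν i hx,
      fun i x hx h v w => (DFunLike.congr_fun (curvature_dirac _ ha hb ν i hx) _).trans
        (congrArg (_ * ·) (areaForm_eq_sinThetaDThetaDPhi _ h v w)),
      representsFirstChernClass_dirac _ ha hab hb ν⟩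
  -- The sphere serves as its own test surface; in Minkowski space the test surface is the unit
  -- sphere at `x⁰ = 0`.
  · exact fun ν ν' h => not_equivalent_dirac _ contMDiff_id (fun _ => rfl) ha hab hb h
  · intro ν
    exact ⟨isConnection_dirac _ ha hab hb ν,
      fun R hR => connectionEquivalent_dirac_pullback ha hab hb ν _ hR (pos_minkowskiRot R),
      fun i x hx => curvature_dirac _ ha hb ν i hx,
      fun i x hx h v w => (DFunLike.congr_fun (curvature_dirac _ ha hb ν i hx) _).trans
        (congrArg (_ * ·) (areaForm_eq_sinThetaDThetaDPhi _ h v w)),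
      representsFirstChernClass_dirac _ ha hab hb ν⟩
  · exact fun ν ν' h => not_equivalent_dirac _ contMDiff_sphereToMinkowski pos_sphereToMinkowski ha hab hb h
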